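/- Let $V$ be a nonzero finite-dimensional complex symplectic vector space, $\mathcal O_V$ the Poisson algebra of formal power series on $V$ (at the origin), and $n\ge 0$. A polydifferential operator in $n$ functions is a linear combination of maps $\mathcal O_V^{\otimes n}\to\mathcal O_V$, $f_1\otimes\cdots\otimes f_n\mapsto a\,(D_1f_1)\cdots(D_nf_n)$, with $a\in\mathcal O_V$ and $D_i$ differential operators on $\mathcal O_V$. Let $\operatorname{Inv}_n(V)$ be the space of those polydifferential operators that commute with all formal symplectic automorphisms of $V$ (the automorphisms of the algebra $\mathcal O_V$ preserving the Poisson bracket). The group $S_{n+1}$ acts on $\operatorname{Inv}_n(V)$ by permuting the $n+1$ arguments of the distribution $f_0\otimes\cdots\otimes f_n\mapsto\int f_0\,\phi(f_1,\dots,f_n)$ attached to $\phi$; that is, $\sigma\phi$ is the unique operator such that $f_0\,(\sigma\phi)(f_1,\dots,f_n)$ and $f_{\sigma(0)}\,\phi(f_{\sigma(1)},\dots,f_{\sigma(n)})$ differ by a total divergence $\sum_i\partial_iB_i(f_0,\dots,f_n)$, with $B_i$ polydifferential operators. An operator has order $r$ if it is a linear combination of operators $f_1\otimes\cdots\otimes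 f_n\mapsto(\partial^{\alpha_1}f_1)\cdots(\partial^{\alpha_n}f_n)$ with $|\alpha_1|+\cdots+|\alpha_n|=r$. Let $\mathfrak h=\{v\in\mathbb C^{n+1}:\sum_iv_i=0\}$ be the reflection representation of $S_{n+1}$. For a representation $R$ of $S_{n+1}$, we say that an order $r$ occurs in $\operatorname{Hom}_{S_{n+1}}(R,\operatorname{Inv}_n(V))$ with multiplicity $k$ if the homomorphisms whose image consists of operators of order $r$ form a subspace of dimension $k$. **Theorem.** (i) $\operatorname{Inv}_n(V)^{S_{n+1}}$ has dimension one and occurs in order $0$: it consists of the constant multiples of the multiplication operator $f_1\otimes\cdots\otimes f_n\mapsto f_1\cdots f_n$. (ii) $\operatorname{Hom}_{S_{n+1}}(\mathfrak h,\operatorname{Inv}_n(V))=0$. (iii) $\operatorname{Hom}_{S_{n+1}}(\wedge^2\mathfrak h,\operatorname{Inv}_n(V))$ has dimension $\lfloor n/2\rfloor$; it is spanned by homomorphisms into the operators of a single order, and the orders that occur are $2,6,10,\dots,2\bigl(2\lfloor n/2\rfloor-1\bigr)$, each with multiplicity one. (iv) Let $n\ge 2$. There is a representation $W=\operatorname{Sym}^2\mathfrak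 h\ominus(\mathfrak h\oplus\mathbb C)$ of $S_{n+1}$, that is, one with $W\oplus\mathfrak h\oplus\mathbb C\cong\operatorname{Sym}^2\mathfrak h$, where $\mathbb C$ is the trivial representation. For every such $W$, $\operatorname{Hom}_{S_{n+1}}(W,\operatorname{Inv}_n(V))$ has dimension $\lfloor (n-1)/2\rfloor$; it is spanned by homomorphisms into the operators of a single order, and the orders that occur are $4,8,\dots,4\lfloor (n-1)/2\rfloor$, each with multiplicity one. -/

import Mathlib

noncomputable section

namespace InvPoly

open MvPowerSeries

/-- `O_V`: formal power series in linear coordinates `(x_i)_{i ∈ ι}` on `V`. -/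
abbrev Fn (ι : Type*) : Type _ := MvPowerSeries ι ℂ

/-- The partial derivative `∂_i` as a linear operator on `O_V`. -/
def pd {ι : Type*} (i : ι) : Module.End ℂ (Fn ι) := (pderiv ℂ i).toLinearMap

/-- The algebra of differential operators on `O_V`: generated, inside the linear endomorphisms
of `O_V`, by the multiplications by functions and the partial derivatives. -/
def diffOp (ι : Type*) : Subalgebra ℂ (Module.End ℂ (Fn ι)) :=
  Algebra.adjoin ℂ (Set.range (LinearMap.mulLeft ℂ) ∪ Set.range pd)

/-- `n`-linear maps `O_V × ⋯ × O_V → O_V`. -/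
abbrev MultiOp (ι : Type*) (n : ℕ) : Type _ := MultilinearMap ℂ (fun _ : Fin n => Fn ι) (Fn ι)

/-- The operator `f₁ ⊗ ⋯ ⊗ fₙ ↦ a (D₁ f₁) ⋯ (Dₙ fₙ)`. -/
def prodOp {ι : Type*} {n : ℕ} (a : Fn ι) (D : Fin n → Module.End ℂ (Fn ι)) : MultiOp ι n :=
  a • (MultilinearMap.mkPiAlgebra ℂ (Fin n) (Fn ι)).compLinearMap D

/-- Polydifferential operators in `n` functions. -/
def polyDiffOp (ι : Type*) (n : ℕ) : Submodule ℂ (MultiOp ι n) :=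
  Submodule.span ℂ {B | ∃ (a : Fn ι) (D : Fin n → Module.End ℂ (Fn ι)),
    (∀ k, D k ∈ diffOp ι) ∧ B = prodOp a D}

/-- The iterated partial derivative `∂_{i₁} ⋯ ∂_{iᵣ}` attached to a list of coordinates. -/
def partials {ι : Type*} (w : List ι) : Module.End ℂ (Fn ι) := (w.map pd).prod

/-- The constant coefficient polydifferential operators that are homogeneous of (total) order
`r`. -/
def orderPart (ι : Type*) (n r : ℕ) : Submodule ℂ (MultiOp ι n) :=
  Submodule.span ℂ {B | ∃ w : Fin n → List ι,
    ∑ k, (w k).length = r ∧ B = prodOp 1 (fun k => partials (w k))}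

/-- The matrix `({x_i, x_j})_{i,j}` of the Poisson bivector of the symplectic form `ω` in the
coordinates dual to the basis `b`: the transposed inverse of the Gram matrix of `ω`. -/
def poissonMatrix {V ι : Type*} [AddCommGroup V] [Module ℂ V] [Fintype ι] [DecidableEq ι]
    (b : Module.Basis ι ℂ V) (ω : LinearMap.BilinForm ℂ V) : Matrix ι ι ℂ :=
  ((LinearMap.BilinForm.toMatrix b ω)⁻¹).transpose

/-- The Poisson bracket `{f, h} = ∑ P_{ij} ∂_i f ∂_j h` of a constant bivector `P`. -/
def bracket {ι : Type*} [Fintype ι] (P : Matrix ι ι ℂ) (f h : Fn ι) : Fn ι :=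
  ∑ i, ∑ j, P i j • (pd i f * pd j h)

/-- Formal symplectic automorphisms of `V`, as automorphisms of the algebra `O_V` that preserve
the Poisson bracket. -/
def IsSymplectic {ι : Type*} [Fintype ι] (P : Matrix ι ι ℂ) (g : Fn ι ≃ₐ[ℂ] Fn ι) : Prop :=
  ∀ f h, g (bracket P f h) = bracket P (g f) (g h)

/-- `Inv_n(V)`: the polydifferential operators in `n` functions that commute with all formal
symplectic automorphisms. -/
def Inv {ι : Type*} [Fintype ι] (P : Matrix ι ι ℂ) (n : ℕ) : Submodule ℂ (MultiOp ι n) where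
  carrier := {B | B ∈ polyDiffOp ι n ∧ ∀ g : Fn ι ≃ₐ[ℂ] Fn ι, IsSymplectic P g →
    ∀ f : Fin n → Fn ι, B (fun k => g (f k)) = g (B f)}
  zero_mem' := ⟨zero_mem _, by simp⟩
  add_mem' := fun {B C} hB hC => ⟨add_mem hB.1 hC.1, fun g hg f => by
    simp [hB.2 g hg f, hC.2 g hg f]⟩
  smul_mem' := fun c B hB => ⟨Submodule.smul_mem _ c hB.1, fun g hg f => by
    simp [hB.2 g hg f]⟩

/-- The total divergences `∑_i ∂_i B_i` among the polydifferential operators: those operators whose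
integral vanishes identically. -/
def totalDiv (ι : Type*) (n : ℕ) : Submodule ℂ (MultiOp ι n) :=
  Submodule.span ℂ {C | ∃ i : ι, ∃ B ∈ polyDiffOp ι n, C = (pd i).compMultilinearMap B}

/-- `f₀ ⊗ f₁ ⊗ ⋯ ⊗ fₙ ↦ (D f₀) B(f₁, …, fₙ)`. -/
def outer {ι : Type*} {n : ℕ} (D : Module.End ℂ (Fn ι)) (B : MultiOp ι n) :
    MultiOp ι (n + 1) :=
  LinearMap.uncurryLeft
    { toFun := fun f => (D f) • B
      map_add' := fun f h => by simp [add_smul]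
      map_smul' := fun c f => by ext; simp }

@[simp] lemma outer_apply {ι : Type*} {n : ℕ} (D : Module.End ℂ (Fn ι)) (B : MultiOp ι n)
    (f : Fin (n + 1) → Fn ι) : outer D B f = D (f 0) * B (fun k => f k.succ) := rfl

/-- An operator `B` in `n` functions, regarded as the density
`f₀ ⊗ f₁ ⊗ ⋯ ⊗ fₙ ↦ f₀ B(f₁, …, fₙ)` of a distribution on `n + 1` functions. -/
def density {ι : Type*} {n : ℕ} (B : MultiOp ι n) : MultiOp ι (n + 1) := outer 1 B

/-- `C` is the operator obtained from `B` by the permutation `σ` of the `n + 1` arguments of the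
distribution `∫ f₀ B(f₁, …, fₙ)`, that is
`∫ f₀ C(f₁, …, fₙ) = ∫ f_{σ 0} B(f_{σ 1}, …, f_{σ n})`; equality of integrals means equality of the
integrands up to total divergences. -/
def IsPermuted {ι : Type*} {n : ℕ} (σ : Equiv.Perm (Fin (n + 1))) (B C : MultiOp ι n) : Prop :=
  density C - (density B).domDomCongr σ ∈ totalDiv ι (n + 1)

/-! ### Uniqueness of the permuted operator -/

/-- The partial derivative with multi-index `α`, on coefficients. -/
def dA {ι : Type*} (α : ι →₀ ℕ) : Module.End ℂ (Fn ι) where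
  toFun f := fun m => (α.prod fun i k => (((m i + k).descFactorial k : ℕ) : ℂ)) *
    coeff (m + α) f
  map_add' f h := by
    funext m; exact (congrArg _ (map_add _ _ _)).trans (mul_add _ _ _)
  map_smul' c f := by
    funext m
    exact mul_left_comm _ c _

lemma coeff_dA {ι : Type*} (α : ι →₀ ℕ) (f : Fn ι) (m : ι →₀ ℕ) :
    coeff m (dA α f) = (α.prod fun i k => (((m i + k).descFactorial k : ℕ) : ℂ)) *
      coeff (m + α) f := rfl

lemma dA_zero {ι : Type*} : dA (0 : ι →₀ ℕ) = 1 := by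
  ext f m
  simp [coeff_dA]

lemma coeff_pd {ι : Type*} (i : ι) (f : Fn ι) (m : ι →₀ ℕ) :
    coeff m (pd i f) = coeff (m + Finsupp.single i 1) f * (m i + 1) :=
  coeff_pderiv f m

lemma prod_add_single {ι : Type*} (α m : ι →₀ ℕ) (i : ι) :
    ((α + Finsupp.single i 1).prod fun j k => (((m j + k).descFactorial k : ℕ) : ℂ)) =
      (m i + α i + 1) * (α.prod fun j k => (((m j + k).descFactorial k : ℕ) : ℂ)) := by
  classical
  rw [← Finsupp.mul_prod_erase' (α + Finsupp.single i 1) i _ (by simp),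
    ← Finsupp.mul_prod_erase' α i _ (by simp)]
  have : (α + Finsupp.single i 1).erase i = α.erase i := by
    ext j; by_cases h : j = i
    · simp [h]
    · simp [Finsupp.erase_ne h]
  rw [this, ← mul_assoc]
  congr 1
  simp only [Finsupp.add_apply, Finsupp.single_eq_same]
  rw [← add_assoc, Nat.succ_descFactorial_succ]
  push_cast; ring

lemma prod_shift {ι : Type*} (α m : ι →₀ ℕ) (i : ι) :
    (α.prod fun j k => ((((m + Finsupp.single i 1 : ι →₀ ℕ) j + k).descFactorial k : ℕ) : ℂ)) *
      (m i + 1) =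
    (m i + α i + 1) * (α.prod fun j k => (((m j + k).descFactorial k : ℕ) : ℂ)) := by
  classical
  rw [← Finsupp.mul_prod_erase' α i _ (by simp),
    ← Finsupp.mul_prod_erase' α i (fun j k => (((m j + k).descFactorial k : ℕ) : ℂ)) (by simp)]
  have h2 : ((α.erase i).prod fun j k =>
      ((((m + Finsupp.single i 1 : ι →₀ ℕ) j + k).descFactorial k : ℕ) : ℂ)) =
      ((α.erase i).prod fun j k => (((m j + k).descFactorial k : ℕ) : ℂ)) := by
    refine Finsupp.prod_congr fun j hj => ?_
    have : j ≠ i := by rintro rfl; simp at hj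
    simp [Finsupp.single_eq_of_ne this]
  rw [h2, mul_right_comm, ← mul_assoc]
  congr 1
  simp only [Finsupp.add_apply, Finsupp.single_eq_same]
  have := Nat.succ_descFactorial (m i + α i) (α i)
  rw [show m i + α i + 1 - α i = m i + 1 by omega] at this
  have h3 := congrArg (Nat.cast : ℕ → ℂ) this
  push_cast at h3
  rw [show m i + 1 + α i = m i + α i + 1 by ring, mul_comm]
  exact h3

lemma pd_dA {ι : Type*} (i : ι) (α : ι →₀ ℕ) (f : Fn ι) :
    pd i (dA α f) = dA (α + Finsupp.single i 1) f := by
  ext m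
  rw [coeff_pd, coeff_dA, coeff_dA, prod_add_single, ← prod_shift,
    show m + Finsupp.single i 1 + α = m + (α + Finsupp.single i 1) by abel]
  ring

lemma dA_pd {ι : Type*} (i : ι) (α : ι →₀ ℕ) (f : Fn ι) :
    dA α (pd i f) = dA (α + Finsupp.single i 1) f := by
  ext m
  rw [coeff_dA, coeff_pd, coeff_dA, prod_add_single,
    show m + α + Finsupp.single i 1 = m + (α + Finsupp.single i 1) by abel]
  simp only [Finsupp.add_apply]; push_cast; ring

lemma pd_mul {ι : Type*} (i : ι) (f h : Fn ι) : pd i (f * h) = pd i f * h + f * pd i h := by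
  have := (pderiv ℂ i).leibniz f h
  simp only [smul_eq_mul] at this
  change pderiv ℂ i (f * h) = pderiv ℂ i f * h + f * pderiv ℂ i h
  rw [this]; ring

/-- The operator `∑ c_α ∂^α`. -/
def opOf (ι : Type*) : ((ι →₀ ℕ) →₀ Fn ι) →ₗ[ℂ] Module.End ℂ (Fn ι) :=
  Finsupp.lsum ℂ fun α => (LinearMap.lcomp ℂ (Fn ι) (dA α)) ∘ₗ LinearMap.mul ℂ (Fn ι)

lemma opOf_single {ι : Type*} (α : ι →₀ ℕ) (a f : Fn ι) :
    opOf ι (Finsupp.single α a) f = a * dA α f := by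
  simp [opOf]

/-- The function `∑ (-∂)^α c_α`, the transpose of `∑ c_α ∂^α` applied to `1`. -/
def transposeOne (ι : Type*) : ((ι →₀ ℕ) →₀ Fn ι) →ₗ[ℂ] Fn ι :=
  Finsupp.lsum ℂ fun α => ((-1 : ℂ) ^ α.degree) • dA α

lemma transposeOne_single {ι : Type*} (α : ι →₀ ℕ) (a : Fn ι) :
    transposeOne ι (Finsupp.single α a) = ((-1 : ℂ) ^ α.degree) • dA α a := by
  simp [transposeOne]

lemma opOf_apply {ι : Type*} (c : (ι →₀ ℕ) →₀ Fn ι) (f : Fn ι) :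
    opOf ι c f = c.sum fun α a => a * dA α f := by
  simp [opOf, Finsupp.sum, LinearMap.sum_apply]

lemma opOf_injective (ι : Type*) : Function.Injective (opOf ι) := by
  classical
  rw [← LinearMap.ker_eq_bot, LinearMap.ker_eq_bot']
  intro c hc
  ext1 β
  induction β using WellFoundedLT.induction with
  | ind β ih =>
    have h := congrArg (fun D : Module.End ℂ (Fn ι) => D (monomial β 1)) hc
    simp only [opOf_apply, LinearMap.zero_apply] at h
    have key : ∀ α ∈ c.support, α ≠ β → c α * dA α (monomial β (1 : ℂ)) = 0 := by
      intro α hα hne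
      by_cases hlt : α ≤ β
      · rw [ih α (lt_of_le_of_ne hlt hne)]; simp
      · have : dA α (monomial β (1 : ℂ)) = 0 := by
          ext m
          rw [coeff_dA, coeff_monomial, if_neg, mul_zero, map_zero]
          rintro rfl
          exact hlt (by simp)
        rw [this, mul_zero]
    rw [Finsupp.sum, Finset.sum_eq_single β key (by intro hb; simp at hb; simp [hb])] at h
    have hd : dA β (monomial β (1 : ℂ)) ≠ 0 := by
      intro h0
      have := congrArg (coeff 0) h0
      rw [coeff_dA, zero_add, coeff_monomial_same, mul_one, map_zero] at this
      simp only [Finsupp.coe_zero, Pi.zero_apply, zero_add, Nat.descFactorial_self] at this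
      rw [Finsupp.prod, Finset.prod_eq_zero_iff] at this
      obtain ⟨i, _, hi⟩ := this
      exact Nat.factorial_ne_zero _ (by exact_mod_cast hi)
    exact (mul_eq_zero.mp h).resolve_right hd

lemma pd_opOf {ι : Type*} (i : ι) (c : (ι →₀ ℕ) →₀ Fn ι) :
    ∃ c', pd i * opOf ι c = opOf ι c' ∧ transposeOne ι c' = 0 := by
  induction c using Finsupp.induction_linear with
  | zero => exact ⟨0, by simp, by simp⟩
  | add c d hc hd =>
    obtain ⟨c', h1, h2⟩ := hc
    obtain ⟨d', h3, h4⟩ := hd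
    exact ⟨c' + d', by simp [mul_add, h1, h3], by simp [h2, h4]⟩
  | single α a =>
    refine ⟨Finsupp.single α (pd i a) + Finsupp.single (α + Finsupp.single i 1) a, ?_, ?_⟩
    · apply LinearMap.ext
      intro f
      simp only [map_add, LinearMap.add_apply, Module.End.mul_apply, opOf_single, pd_mul, pd_dA]
    · simp only [map_add, transposeOne_single, dA_pd]
      simp [pow_succ]

lemma mulLeft_opOf {ι : Type*} (b : Fn ι) (c : (ι →₀ ℕ) →₀ Fn ι) :
    ∃ c', LinearMap.mulLeft ℂ b * opOf ι c = opOf ι c' := by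
  induction c using Finsupp.induction_linear with
  | zero => exact ⟨0, by simp⟩
  | add c d hc hd =>
    obtain ⟨c', h1⟩ := hc
    obtain ⟨d', h3⟩ := hd
    exact ⟨c' + d', by simp [mul_add, h1, h3]⟩
  | single α a =>
    refine ⟨Finsupp.single α (b * a), ?_⟩
    apply LinearMap.ext
    intro f
    simp only [Module.End.mul_apply, opOf_single, LinearMap.mulLeft_apply, mul_assoc]

lemma exists_opOf {ι : Type*} {D : Module.End ℂ (Fn ι)} (hD : D ∈ diffOp ι) :
    ∃ c, D = opOf ι c := by
  have : ∀ c, ∃ c', D * opOf ι c = opOf ι c' := by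
    induction hD using Algebra.adjoin_induction with
    | mem x hx =>
      intro c
      rcases hx with ⟨a, rfl⟩ | ⟨i, rfl⟩
      · exact mulLeft_opOf a c
      · obtain ⟨c', h, -⟩ := pd_opOf i c
        exact ⟨c', h⟩
    | algebraMap r => exact fun c => ⟨r • c, by rw [map_smul, Algebra.algebraMap_eq_smul_one,
        smul_mul_assoc, one_mul]⟩
    | add x y _ _ hx hy =>
      intro c
      obtain ⟨c1, h1⟩ := hx c
      obtain ⟨c2, h2⟩ := hy c
      exact ⟨c1 + c2, by rw [add_mul, h1, h2, map_add]⟩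
    | mul x y _ _ hx hy =>
      intro c
      obtain ⟨c2, h2⟩ := hy c
      obtain ⟨c1, h1⟩ := hx c2
      exact ⟨c1, by rw [mul_assoc, h2, h1]⟩
  obtain ⟨c', h⟩ := this (Finsupp.single 0 1)
  refine ⟨c', ?_⟩
  rw [← h]
  apply LinearMap.ext
  intro f
  simp [Module.End.mul_apply, opOf_single, dA_zero]

lemma prodOp_apply {ι : Type*} {n : ℕ} (a : Fn ι) (D : Fin n → Module.End ℂ (Fn ι))
    (f : Fin n → Fn ι) : prodOp a D f = a * ∏ k, D k (f k) := rfl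

lemma mulLeft_mem {ι : Type*} (a : Fn ι) : LinearMap.mulLeft ℂ a ∈ diffOp ι :=
  Algebra.subset_adjoin (Or.inl ⟨a, rfl⟩)

lemma pd_mem {ι : Type*} (i : ι) : pd i ∈ diffOp ι :=
  Algebra.subset_adjoin (Or.inr ⟨i, rfl⟩)

lemma slot_mem {ι : Type*} {n : ℕ} {B : MultiOp ι (n + 1)} (hB : B ∈ polyDiffOp ι (n + 1))
    (f : Fin n → Fn ι) : ∃ D ∈ diffOp ι, ∀ h, B (Fin.cons h f) = D h := by
  induction hB using Submodule.span_induction with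
  | mem B hB =>
    obtain ⟨a, D, hD, rfl⟩ := hB
    refine ⟨LinearMap.mulLeft ℂ (a * ∏ k : Fin n, D k.succ (f k)) * D 0,
      mul_mem (mulLeft_mem _) (hD 0), fun h => ?_⟩
    simp only [prodOp_apply, Fin.prod_univ_succ, Fin.cons_zero, Fin.cons_succ,
      Module.End.mul_apply, LinearMap.mulLeft_apply]
    ring
  | zero => exact ⟨0, zero_mem _, by simp⟩
  | add x y _ _ hx hy =>
    obtain ⟨D, hD, h1⟩ := hx
    obtain ⟨E, hE, h2⟩ := hy
    exact ⟨D + E, add_mem hD hE, fun h => by simp [h1, h2]⟩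
  | smul c x _ hx =>
    obtain ⟨D, hD, h1⟩ := hx
    exact ⟨c • D, Subalgebra.smul_mem _ hD c, fun h => by simp [h1]⟩

lemma eq_zero_of_density_mem {ι : Type*} {n : ℕ} {B : MultiOp ι n}
    (hB : density B ∈ totalDiv ι (n + 1)) : B = 0 := by
  ext1 f
  have key : ∀ C ∈ totalDiv ι (n + 1), ∃ c, (∀ h, C (Fin.cons h f) = opOf ι c h) ∧
      transposeOne ι c = 0 := by
    intro C hC
    induction hC using Submodule.span_induction with
    | mem C hC =>
      obtain ⟨i, B, hB, rfl⟩ := hC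
      obtain ⟨D, hD, h1⟩ := slot_mem hB f
      obtain ⟨c, rfl⟩ := exists_opOf hD
      obtain ⟨c', h2, h3⟩ := pd_opOf i c
      refine ⟨c', fun h => ?_, h3⟩
      rw [← h2]
      simp [h1]
    | zero => exact ⟨0, by simp, by simp⟩
    | add x y _ _ hx hy =>
      obtain ⟨c, h1, h2⟩ := hx
      obtain ⟨d, h3, h4⟩ := hy
      exact ⟨c + d, fun h => by simp [h1, h3], by simp [h2, h4]⟩
    | smul r x _ hx =>
      obtain ⟨c, h1, h2⟩ := hx
      exact ⟨r • c, fun h => by simp [h1], by simp [h2]⟩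
  obtain ⟨c, h1, h2⟩ := key _ hB
  have h3 : opOf ι c = opOf ι (Finsupp.single 0 (B f)) := by
    apply LinearMap.ext
    intro h
    rw [← h1, opOf_single, dA_zero]
    simp [density, mul_comm]
  rw [opOf_injective ι h3, transposeOne_single, dA_zero] at h2
  simpa using h2

/-! ### Existence of the permuted operator -/

lemma smul_mem_polyDiffOp {ι : Type*} {n : ℕ} (a : Fn ι) {B : MultiOp ι n}
    (hB : B ∈ polyDiffOp ι n) : a • B ∈ polyDiffOp ι n := by
  induction hB using Submodule.span_induction with
  | mem B hB =>
    obtain ⟨b, D, hD, rfl⟩ := hB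
    exact Submodule.subset_span ⟨a * b, D, hD, by
      ext1 f; simp [prodOp_apply, mul_assoc]⟩
  | zero => simp
  | add x y _ _ hx hy => rw [smul_add]; exact add_mem hx hy
  | smul r x _ hx => 
    have : a • r • x = r • a • x := by ext1 f; simp
    rw [this]; exact Submodule.smul_mem _ r hx

lemma pd_prod {ι κ : Type*} [DecidableEq κ] (i : ι) (s : Finset κ) (f : κ → Fn ι) :
    pd i (∏ k ∈ s, f k) = ∑ k ∈ s, pd i (f k) * ∏ l ∈ s.erase k, f l := by
  induction s using Finset.induction_on with
  | empty => simp [pd]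
  | insert k s hk ih =>
    rw [Finset.prod_insert hk, pd_mul, ih, Finset.sum_insert hk, Finset.erase_insert hk,
      Finset.mul_sum]
    congr 1
    refine Finset.sum_congr rfl fun l hl => ?_
    have : k ≠ l := by rintro rfl; exact hk hl
    rw [Finset.erase_insert_of_ne this, Finset.prod_insert (by simp [hk])]
    ring

lemma pd_mem_polyDiffOp {ι : Type*} {n : ℕ} (i : ι) {B : MultiOp ι n}
    (hB : B ∈ polyDiffOp ι n) : (pd i).compMultilinearMap B ∈ polyDiffOp ι n := by
  induction hB using Submodule.span_induction with
  | mem B hB =>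
    obtain ⟨a, D, hD, rfl⟩ := hB
    have : (pd i).compMultilinearMap (prodOp a D) = prodOp (pd i a) D +
        ∑ k, prodOp a (Function.update D k (pd i * D k)) := by
      ext1 f
      simp only [LinearMap.compMultilinearMap_apply, prodOp_apply, pd_mul, pd_prod,
        _root_.add_apply, _root_.sum_apply, Finset.mul_sum]
      congr 1
      refine Finset.sum_congr rfl fun k _ => ?_
      rw [← Finset.mul_prod_erase Finset.univ _ (Finset.mem_univ k)]
      simp only [Function.update_self, Module.End.mul_apply]
      congr 2
      refine Finset.prod_congr rfl fun l hl => ?_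
      rw [Function.update_of_ne (Finset.ne_of_mem_erase hl)]
    rw [this]
    refine add_mem (Submodule.subset_span ⟨_, D, hD, rfl⟩) (sum_mem fun k _ =>
      Submodule.subset_span ⟨_, _, fun l => ?_, rfl⟩)
    by_cases h : l = k
    · subst h; simpa using mul_mem (pd_mem i) (hD l)
    · simpa [Function.update_of_ne h] using hD l
  | zero =>
    have : (pd i).compMultilinearMap (0 : MultiOp ι n) = 0 := by ext1 f; simp
    rw [this]; exact zero_mem _
  | add x y _ _ hx hy =>
    have : (pd i).compMultilinearMap (x + y) =
      (pd i).compMultilinearMap x + (pd i).compMultilinearMap y := by ext1 f; simp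
    rw [this]; exact add_mem hx hy
  | smul r x _ hx =>
    have : (pd i).compMultilinearMap (r • x) =
      r • (pd i).compMultilinearMap x := by ext1 f; simp
    rw [this]; exact Submodule.smul_mem _ r hx

lemma outer_mem {ι : Type*} {n : ℕ} {D : Module.End ℂ (Fn ι)} (hD : D ∈ diffOp ι)
    {B : MultiOp ι n} (hB : B ∈ polyDiffOp ι n) : outer D B ∈ polyDiffOp ι (n + 1) := by
  induction hB using Submodule.span_induction with
  | mem B hB =>
    obtain ⟨a, E, hE, rfl⟩ := hB
    refine Submodule.subset_span ⟨a, Fin.cons D E, fun k => ?_, ?_⟩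
    · refine Fin.cases ?_ (fun k => ?_) k
      · simpa using hD
      · simpa using hE k
    · ext1 f
      simp only [outer_apply, prodOp_apply, Fin.prod_univ_succ, Fin.cons_zero, Fin.cons_succ]
      ring
  | zero =>
    have : outer D (0 : MultiOp ι n) = 0 := by ext1 f; simp
    rw [this]; exact zero_mem _
  | add x y _ _ hx hy =>
    have : outer D (x + y) = outer D x + outer D y := by ext1 f; simp [mul_add]
    rw [this]; exact add_mem hx hy
  | smul r x _ hx =>
    have : outer D (r • x) = r • outer D x := by ext1 f; simp
    rw [this]; exact Submodule.smul_mem _ r hx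

lemma outer_reduce {ι : Type*} {n : ℕ} {D : Module.End ℂ (Fn ι)} (hD : D ∈ diffOp ι) :
    ∀ E ∈ diffOp ι, ∀ B ∈ polyDiffOp ι n, ∃ C ∈ polyDiffOp ι n,
      outer E C - outer (D * E) B ∈ totalDiv ι (n + 1) := by
  induction hD using Algebra.adjoin_induction with
  | mem x hx =>
    intro E hE B hB
    rcases hx with ⟨a, rfl⟩ | ⟨i, rfl⟩
    · refine ⟨a • B, smul_mem_polyDiffOp a hB, ?_⟩
      have : outer E (a • B) - outer (LinearMap.mulLeft ℂ a * E) B = 0 := by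
        ext1 f
        simp only [_root_.sub_apply, outer_apply, Module.End.mul_apply,
          LinearMap.mulLeft_apply, _root_.smul_apply, smul_eq_mul,
          _root_.zero_apply]
        ring
      rw [this]; exact zero_mem _
    · refine ⟨-(pd i).compMultilinearMap B, neg_mem (pd_mem_polyDiffOp i hB), ?_⟩
      have : outer E (-(pd i).compMultilinearMap B) - outer (pd i * E) B =
          -(pd i).compMultilinearMap (outer E B) := by
        ext1 f
        simp only [_root_.sub_apply, outer_apply, Module.End.mul_apply,
          _root_.neg_apply, LinearMap.compMultilinearMap_apply, pd_mul]
        ring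
      rw [this]
      exact neg_mem (Submodule.subset_span ⟨i, _, outer_mem hE hB, rfl⟩)
  | algebraMap r =>
    intro E hE B hB
    refine ⟨r • B, Submodule.smul_mem _ r hB, ?_⟩
    have : outer E (r • B) - outer (algebraMap ℂ (Module.End ℂ (Fn ι)) r * E) B = 0 := by
      ext1 f
      simp [Algebra.algebraMap_eq_smul_one]
    rw [this]; exact zero_mem _
  | add x y _ _ hx hy =>
    intro E hE B hB
    obtain ⟨C1, h1, h2⟩ := hx E hE B hB
    obtain ⟨C2, h3, h4⟩ := hy E hE B hB
    refine ⟨C1 + C2, add_mem h1 h3, ?_⟩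
    have : outer E (C1 + C2) - outer ((x + y) * E) B =
        (outer E C1 - outer (x * E) B) + (outer E C2 - outer (y * E) B) := by
      ext1 f
      simp [add_mul, mul_add]; ring
    rw [this]; exact add_mem h2 h4
  | mul x y hx' hy' hx hy =>
    intro E hE B hB
    obtain ⟨C1, h1, h2⟩ := hx (y * E) (mul_mem hy' hE) B hB
    obtain ⟨C2, h3, h4⟩ := hy E hE C1 h1
    refine ⟨C2, h3, ?_⟩
    have := add_mem h4 h2
    rwa [sub_add_sub_cancel, ← mul_assoc] at this

lemma exists_density {ι : Type*} {n : ℕ} {B : MultiOp ι (n + 1)}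
    (hB : B ∈ polyDiffOp ι (n + 1)) :
    ∃ C ∈ polyDiffOp ι n, density C - B ∈ totalDiv ι (n + 1) := by
  induction hB using Submodule.span_induction with
  | mem B hB =>
    obtain ⟨a, D, hD, rfl⟩ := hB
    obtain ⟨C, hC, h⟩ := outer_reduce (hD 0) 1 (one_mem _) (prodOp a fun k => D k.succ)
      (Submodule.subset_span ⟨_, _, fun k => hD k.succ, rfl⟩)
    refine ⟨C, hC, ?_⟩
    have : outer (D 0 * 1) (prodOp a fun k => D k.succ) = prodOp a D := by
      ext1 f
      simp only [outer_apply, prodOp_apply, Fin.prod_univ_succ, mul_one]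
      ring
    rwa [this] at h
  | zero =>
    refine ⟨0, zero_mem _, ?_⟩
    have : density (0 : MultiOp ι n) = 0 := by ext1 f; simp [density]
    rw [this, sub_zero]; exact zero_mem _
  | add x y _ _ hx hy =>
    obtain ⟨C1, h1, h2⟩ := hx
    obtain ⟨C2, h3, h4⟩ := hy
    refine ⟨C1 + C2, add_mem h1 h3, ?_⟩
    have : density (C1 + C2) - (x + y) = (density C1 - x) + (density C2 - y) := by
      ext1 f; simp [density, mul_add]; ring
    rw [this]; exact add_mem h2 h4
  | smul r x _ hx =>
    obtain ⟨C, h1, h2⟩ := hx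
    refine ⟨r • C, Submodule.smul_mem _ r h1, ?_⟩
    have : density (r • C) - r • x = r • (density C - x) := by
      ext1 f; simp [density, smul_sub]
    rw [this]; exact Submodule.smul_mem _ r h2

lemma density_mem {ι : Type*} {n : ℕ} {B : MultiOp ι n} (hB : B ∈ polyDiffOp ι n) :
    density B ∈ polyDiffOp ι (n + 1) := outer_mem (one_mem _) hB

lemma perm_mem_polyDiffOp {ι : Type*} {n : ℕ} (σ : Equiv.Perm (Fin n)) {B : MultiOp ι n}
    (hB : B ∈ polyDiffOp ι n) : B.domDomCongr σ ∈ polyDiffOp ι n := by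
  induction hB using Submodule.span_induction with
  | mem B hB =>
    obtain ⟨a, D, hD, rfl⟩ := hB
    refine Submodule.subset_span ⟨a, fun k => D (σ.symm k), fun k => hD _, ?_⟩
    ext1 f
    simp only [MultilinearMap.domDomCongr_apply, prodOp_apply]
    congr 1
    exact Fintype.prod_equiv σ _ _ (by simp)
  | zero => exact zero_mem _
  | add x y _ _ hx hy => exact add_mem hx hy
  | smul r x _ hx => exact Submodule.smul_mem _ r hx

lemma perm_mem_totalDiv {ι : Type*} {n : ℕ} (σ : Equiv.Perm (Fin n)) {B : MultiOp ι n}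
    (hB : B ∈ totalDiv ι n) : B.domDomCongr σ ∈ totalDiv ι n := by
  induction hB using Submodule.span_induction with
  | mem B hB =>
    obtain ⟨i, C, hC, rfl⟩ := hB
    exact Submodule.subset_span ⟨i, _, perm_mem_polyDiffOp σ hC, rfl⟩
  | zero => exact zero_mem _
  | add x y _ _ hx hy => exact add_mem hx hy
  | smul r x _ hx => exact Submodule.smul_mem _ r hx

lemma IsPermuted.unique {ι : Type*} {n : ℕ} {σ : Equiv.Perm (Fin (n + 1))} {B C C' : MultiOp ι n}
    (h : IsPermuted σ B C) (h' : IsPermuted σ B C') : C = C' := by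
  have := sub_mem h h'
  rw [sub_sub_sub_cancel_right] at this
  refine sub_eq_zero.mp (eq_zero_of_density_mem ?_)
  convert this using 1
  ext1 f; simp [density, mul_sub]

lemma exists_isPermuted {ι : Type*} {n : ℕ} (σ : Equiv.Perm (Fin (n + 1))) {B : MultiOp ι n}
    (hB : B ∈ polyDiffOp ι n) : ∃ C ∈ polyDiffOp ι n, IsPermuted σ B C :=
  exists_density (perm_mem_polyDiffOp σ (density_mem hB))

lemma IsPermuted.add {ι : Type*} {n : ℕ} {σ : Equiv.Perm (Fin (n + 1))} {B B' C C' : MultiOp ι n}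
    (h : IsPermuted σ B C) (h' : IsPermuted σ B' C') : IsPermuted σ (B + B') (C + C') := by
  have := add_mem h h'
  unfold IsPermuted
  convert this using 1
  ext1 f; simp [density, mul_add]; ring

lemma IsPermuted.smul {ι : Type*} {n : ℕ} {σ : Equiv.Perm (Fin (n + 1))} {B C : MultiOp ι n}
    (c : ℂ) (h : IsPermuted σ B C) : IsPermuted σ (c • B) (c • C) := by
  have := Submodule.smul_mem _ c h
  unfold IsPermuted
  convert this using 1
  ext1 f; simp [density, smul_sub]

lemma IsPermuted.one {ι : Type*} {n : ℕ} (B : MultiOp ι n) : IsPermuted 1 B B := by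
  have : density B - (density B).domDomCongr (1 : Equiv.Perm (Fin (n + 1))) = 0 := by
    ext1 f; simp
  unfold IsPermuted
  rw [this]; exact zero_mem _

lemma IsPermuted.mul {ι : Type*} {n : ℕ} {σ τ : Equiv.Perm (Fin (n + 1))} {B C E : MultiOp ι n}
    (h : IsPermuted τ B C) (h' : IsPermuted σ C E) : IsPermuted (σ * τ) B E := by
  have := add_mem h' (perm_mem_totalDiv σ h)
  unfold IsPermuted
  convert this using 1
  ext1 f; simp

/-! ### Stability of the invariant operators -/

/-- The operator `B` transported by the automorphism `g`. -/
def conj {ι : Type*} {n : ℕ} (g : Fn ι ≃ₐ[ℂ] Fn ι) (B : MultiOp ι n) : MultiOp ι n :=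
  g.toLinearMap.compMultilinearMap (B.compLinearMap fun _ => g.symm.toLinearMap)

@[simp] lemma conj_apply {ι : Type*} {n : ℕ} (g : Fn ι ≃ₐ[ℂ] Fn ι) (B : MultiOp ι n)
    (f : Fin n → Fn ι) : conj g B f = g (B fun k => g.symm (f k)) := rfl

lemma bracket_eq_pd {ι : Type*} [Fintype ι] [DecidableEq ι] {P : Matrix ι ι ℂ}
    (hP : IsUnit P.det) (j : ι) (f : Fn ι) :
    pd j f = ∑ i, P⁻¹ j i • bracket P (X i) f := by
  have h1 : ∀ i, bracket P (X i) f = ∑ k, P i k • pd k f := by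
    intro i
    unfold bracket
    rw [Finset.sum_eq_single i]
    · refine Finset.sum_congr rfl fun k _ => ?_
      simp [pd]
    · intro l _ hl
      refine Finset.sum_eq_zero fun k _ => ?_
      have : pd l (X i : Fn ι) = 0 := pderiv_X_of_ne hl.symm
      simp [this]
    · simp
  simp only [h1, Finset.smul_sum, smul_smul]
  rw [Finset.sum_comm]
  simp only [← Finset.sum_smul, ← Matrix.mul_apply, Matrix.nonsing_inv_mul P hP, Matrix.one_apply,
    ite_smul, one_smul, zero_smul, Finset.sum_ite_eq, Finset.mem_univ, if_true]

/-- The Hamiltonian vector field `{h, ·}`. -/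
def ham {ι : Type*} [Fintype ι] (P : Matrix ι ι ℂ) (h : Fn ι) : Module.End ℂ (Fn ι) :=
  ∑ i, ∑ j, P i j • (LinearMap.mulLeft ℂ (pd i h) * pd j)

lemma ham_apply {ι : Type*} [Fintype ι] (P : Matrix ι ι ℂ) (h f : Fn ι) :
    ham P h f = bracket P h f := by
  simp [ham, bracket, LinearMap.sum_apply]

lemma ham_mem {ι : Type*} [Fintype ι] (P : Matrix ι ι ℂ) (h : Fn ι) : ham P h ∈ diffOp ι :=
  sum_mem fun _ _ => sum_mem fun j _ =>
    Subalgebra.smul_mem _ (mul_mem (mulLeft_mem _) (pd_mem j)) _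

lemma conj_pd {ι : Type*} [Fintype ι] [DecidableEq ι] {P : Matrix ι ι ℂ} (hP : IsUnit P.det)
    {g : Fn ι ≃ₐ[ℂ] Fn ι} (hg : IsSymplectic P g) (j : ι) (f : Fn ι) :
    g (pd j (g.symm f)) = ∑ i, P⁻¹ j i • ham P (g (X i)) f := by
  rw [bracket_eq_pd hP j, map_sum]
  refine Finset.sum_congr rfl fun i _ => ?_
  rw [map_smul, hg, AlgEquiv.apply_symm_apply, ham_apply]

lemma conj_diffOp {ι : Type*} [Fintype ι] [DecidableEq ι] {P : Matrix ι ι ℂ} (hP : IsUnit P.det)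
    {g : Fn ι ≃ₐ[ℂ] Fn ι} (hg : IsSymplectic P g) {D : Module.End ℂ (Fn ι)} (hD : D ∈ diffOp ι) :
    g.toLinearMap ∘ₗ D ∘ₗ g.symm.toLinearMap ∈ diffOp ι := by
  induction hD using Algebra.adjoin_induction with
  | mem x hx =>
    rcases hx with ⟨a, rfl⟩ | ⟨i, rfl⟩
    · convert mulLeft_mem (g a) using 1
      apply LinearMap.ext
      intro f; simp
    · have : g.toLinearMap ∘ₗ pd i ∘ₗ g.symm.toLinearMap =
          ∑ k, P⁻¹ i k • ham P (g (X k)) := by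
        apply LinearMap.ext
        intro f
        simp only [LinearMap.comp_apply, AlgEquiv.toLinearMap_apply, LinearMap.sum_apply,
          LinearMap.smul_apply]
        exact conj_pd hP hg i f
      rw [this]
      exact sum_mem fun k _ => Subalgebra.smul_mem _ (ham_mem P _) _
  | algebraMap r =>
    convert (diffOp ι).algebraMap_mem r using 1
    apply LinearMap.ext
    intro f; simp [Algebra.algebraMap_eq_smul_one]
  | add x y _ _ hx hy =>
    rw [LinearMap.add_comp, LinearMap.comp_add]
    exact add_mem hx hy
  | mul x y _ _ hx hy =>
    convert mul_mem hx hy using 1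
    apply LinearMap.ext
    intro f; simp

lemma conj_mem_polyDiffOp {ι : Type*} [Fintype ι] [DecidableEq ι] {P : Matrix ι ι ℂ} {n : ℕ}
    (hP : IsUnit P.det) {g : Fn ι ≃ₐ[ℂ] Fn ι} (hg : IsSymplectic P g) {B : MultiOp ι n}
    (hB : B ∈ polyDiffOp ι n) : conj g B ∈ polyDiffOp ι n := by
  induction hB using Submodule.span_induction with
  | mem B hB =>
    obtain ⟨a, D, hD, rfl⟩ := hB
    refine Submodule.subset_span ⟨g a, fun k => g.toLinearMap ∘ₗ D k ∘ₗ g.symm.toLinearMap,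
      fun k => conj_diffOp hP hg (hD k), ?_⟩
    ext1 f
    simp [prodOp_apply]
  | zero =>
    have : conj g (0 : MultiOp ι n) = 0 := by ext1 f; simp
    rw [this]; exact zero_mem _
  | add x y _ _ hx hy =>
    have : conj g (x + y) = conj g x + conj g y := by ext1 f; simp
    rw [this]; exact add_mem hx hy
  | smul r x _ hx =>
    have : conj g (r • x) = r • conj g x := by ext1 f; simp
    rw [this]; exact Submodule.smul_mem _ r hx

lemma pd_comm {ι : Type*} (i j : ι) (f : Fn ι) : pd i (pd j f) = pd j (pd i f) := by
  have h1 := dA_pd i (Finsupp.single j 1) f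
  have h2 : dA (Finsupp.single j 1) = (pd j : Module.End ℂ (Fn ι)) := by
    apply LinearMap.ext
    intro f
    have := pd_dA j 0 f
    rw [dA_zero, zero_add] at this
    exact this.symm
  have h3 := pd_dA i (Finsupp.single j 1) f
  rw [h2] at h1 h3
  rw [h3, h1]

/-- Hamiltonian vector fields are divergence free. -/
lemma ham_mem_totalDiv {ι : Type*} [Fintype ι] {P : Matrix ι ι ℂ} {n : ℕ} (hP : P.transpose = -P)
    (h : Fn ι) {B : MultiOp ι n} (hB : B ∈ polyDiffOp ι n) :
    (ham P h).compMultilinearMap B ∈ totalDiv ι n := by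
  have : (ham P h).compMultilinearMap B =
      ∑ j, (pd j).compMultilinearMap ((∑ i, P i j • pd i h) • B) := by
    ext1 f
    simp only [LinearMap.compMultilinearMap_apply, ham_apply, _root_.sum_apply,
      _root_.smul_apply, smul_eq_mul, pd_mul, Finset.sum_add_distrib]
    have h0 : ∑ j, pd j (∑ i, P i j • pd i h) * B f = 0 := by
      rw [← Finset.sum_mul]
      simp only [map_sum, map_smul]
      have : ∑ j, ∑ i, P i j • pd j (pd i h) = -∑ j, ∑ i, P i j • pd j (pd i h) := by
        conv_lhs => rw [Finset.sum_comm]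
        rw [← Finset.sum_neg_distrib]
        refine Finset.sum_congr rfl fun i _ => ?_
        rw [← Finset.sum_neg_distrib]
        refine Finset.sum_congr rfl fun j _ => ?_
        have := congrFun (congrFun hP j) i
        simp only [Matrix.transpose_apply, Matrix.neg_apply] at this
        rw [this, pd_comm, neg_smul]
      have h2 : (2 : ℂ) • ∑ j, ∑ i, P i j • pd j (pd i h) = 0 := by
        rw [two_smul]
        nth_rewrite 1 [this]
        exact neg_add_cancel _
      rw [(IsUnit.mk0 (2 : ℂ) two_ne_zero).smul_eq_zero.mp h2, zero_mul]
    rw [h0, zero_add]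
    unfold bracket
    rw [Finset.sum_comm]
    refine Finset.sum_congr rfl fun j _ => ?_
    rw [Finset.sum_mul]
    exact Finset.sum_congr rfl fun i _ => (smul_mul_assoc _ _ _).symm
  rw [this]
  exact sum_mem fun j _ => Submodule.subset_span ⟨j, _, smul_mem_polyDiffOp _ hB, rfl⟩

lemma conj_mem_totalDiv {ι : Type*} [Fintype ι] [DecidableEq ι] {P : Matrix ι ι ℂ} {n : ℕ}
    (hP : P.transpose = -P) (hP' : IsUnit P.det) {g : Fn ι ≃ₐ[ℂ] Fn ι} (hg : IsSymplectic P g)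
    {B : MultiOp ι n} (hB : B ∈ totalDiv ι n) : conj g B ∈ totalDiv ι n := by
  induction hB using Submodule.span_induction with
  | mem B hB =>
    obtain ⟨j, C, hC, rfl⟩ := hB
    have : conj g ((pd j).compMultilinearMap C) =
        ∑ i, P⁻¹ j i • (ham P (g (X i))).compMultilinearMap (conj g C) := by
      ext1 f
      have := conj_pd hP' hg j (g (C fun k => g.symm (f k)))
      rw [AlgEquiv.symm_apply_apply] at this
      simpa using this
    rw [this]
    exact sum_mem fun i _ => Submodule.smul_mem _ _
      (ham_mem_totalDiv hP _ (conj_mem_polyDiffOp hP' hg hC))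
  | zero =>
    have : conj g (0 : MultiOp ι n) = 0 := by ext1 f; simp
    rw [this]; exact zero_mem _
  | add x y _ _ hx hy =>
    have : conj g (x + y) = conj g x + conj g y := by ext1 f; simp
    rw [this]; exact add_mem hx hy
  | smul r x _ hx =>
    have : conj g (r • x) = r • conj g x := by ext1 f; simp
    rw [this]; exact Submodule.smul_mem _ r hx

lemma isPermuted_mem_Inv {ι : Type*} [Fintype ι] [DecidableEq ι] {P : Matrix ι ι ℂ} {n : ℕ}
    (hP : P.transpose = -P) (hP' : IsUnit P.det) {σ : Equiv.Perm (Fin (n + 1))}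
    {B C : MultiOp ι n} (hB : B ∈ Inv P n) (hC : C ∈ polyDiffOp ι n) (h : IsPermuted σ B C) :
    C ∈ Inv P n := by
  refine ⟨hC, fun g hg f => ?_⟩
  have h1 : IsPermuted σ B (conj g C) := by
    have := conj_mem_totalDiv hP hP' hg h
    unfold IsPermuted
    convert this using 1
    ext1 f
    have h2 := hB.2 g hg
    simp [density, ← h2]
  have := h1.unique h
  conv_lhs => rw [← this]
  simp

lemma exists_perm_Inv {ι : Type*} [Fintype ι] [DecidableEq ι] {P : Matrix ι ι ℂ} {n : ℕ}
    (hP : P.transpose = -P) (hP' : IsUnit P.det) (σ : Equiv.Perm (Fin (n + 1)))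
    (B : Inv P n) : ∃ C : Inv P n, IsPermuted σ B.1 C.1 := by
  obtain ⟨C, hC, h⟩ := exists_isPermuted σ B.2.1
  exact ⟨⟨C, isPermuted_mem_Inv hP hP' B.2 hC h⟩, h⟩

/-- The action of `S_{n+1}` on `Inv_n(V)` by permutations of the `n + 1` arguments of the
distributions `∫ f₀ B(f₁, …, fₙ)`. -/
def invRepOfMatrix {ι : Type*} [Fintype ι] [DecidableEq ι] (P : Matrix ι ι ℂ)
    (hP : P.transpose = -P) (hP' : IsUnit P.det) (n : ℕ) :
    Representation ℂ (Equiv.Perm (Fin (n + 1))) (Inv P n) where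
  toFun σ :=
    { toFun := fun B => (exists_perm_Inv hP hP' σ B).choose
      map_add' := fun B C => Subtype.ext
        ((exists_perm_Inv hP hP' σ (B + C)).choose_spec.unique
          ((exists_perm_Inv hP hP' σ B).choose_spec.add
            (exists_perm_Inv hP hP' σ C).choose_spec))
      map_smul' := fun c B => Subtype.ext
        ((exists_perm_Inv hP hP' σ (c • B)).choose_spec.unique
          ((exists_perm_Inv hP hP' σ B).choose_spec.smul c)) }
  map_one' := LinearMap.ext fun B => Subtype.ext
    ((exists_perm_Inv hP hP' 1 B).choose_spec.unique (IsPermuted.one B.1))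
  map_mul' σ τ := LinearMap.ext fun B => Subtype.ext
    ((exists_perm_Inv hP hP' (σ * τ) B).choose_spec.unique
      ((exists_perm_Inv hP hP' τ B).choose_spec.mul (exists_perm_Inv hP hP' σ _).choose_spec))

lemma poissonMatrix_transpose {V ι : Type*} [AddCommGroup V] [Module ℂ V] [Fintype ι]
    [DecidableEq ι] (b : Module.Basis ι ℂ V) {ω : LinearMap.BilinForm ℂ V} (hω : ω.IsAlt)
    (hω' : ω.Nondegenerate) :
    (poissonMatrix b ω).transpose = -poissonMatrix b ω := by
  have h : (LinearMap.BilinForm.toMatrix b ω).transpose = -LinearMap.BilinForm.toMatrix b ω := by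
    ext i j
    simp [LinearMap.BilinForm.toMatrix_apply, hω.neg_eq]
  have hd : IsUnit (LinearMap.BilinForm.toMatrix b ω).det :=
    isUnit_iff_ne_zero.mpr ((LinearMap.BilinForm.nondegenerate_iff_det_ne_zero b).mp hω')
  unfold poissonMatrix
  rw [Matrix.transpose_transpose, Matrix.transpose_nonsing_inv, h]
  refine neg_eq_iff_eq_neg.mp (Matrix.inv_eq_left_inv ?_).symm
  rw [neg_mul_neg, Matrix.nonsing_inv_mul _ hd]

lemma poissonMatrix_det {V ι : Type*} [AddCommGroup V] [Module ℂ V] [Fintype ι]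
    [DecidableEq ι] (b : Module.Basis ι ℂ V) {ω : LinearMap.BilinForm ℂ V}
    (hω : ω.Nondegenerate) : IsUnit (poissonMatrix b ω).det := by
  have h := (LinearMap.BilinForm.nondegenerate_iff_det_ne_zero b).mp hω
  unfold poissonMatrix
  rw [Matrix.det_transpose]
  exact Matrix.isUnit_nonsing_inv_det _ (isUnit_iff_ne_zero.mpr h)

/-- The action of `S_{n+1}` on `Inv_n(V)` for a symplectic vector space `(V, ω)`. -/
def invRep {V ι : Type*} [AddCommGroup V] [Module ℂ V] [Fintype ι] [DecidableEq ι]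
    (b : Module.Basis ι ℂ V) {ω : LinearMap.BilinForm ℂ V} (hω : ω.IsAlt)
    (hω' : ω.Nondegenerate) (n : ℕ) :
    Representation ℂ (Equiv.Perm (Fin (n + 1))) (Inv (poissonMatrix b ω) n) :=
  invRepOfMatrix _ (poissonMatrix_transpose b hω hω') (poissonMatrix_det b hω') n

lemma invRep_spec {V ι : Type*} [AddCommGroup V] [Module ℂ V] [Fintype ι] [DecidableEq ι]
    (b : Module.Basis ι ℂ V) {ω : LinearMap.BilinForm ℂ V} (hω : ω.IsAlt)
    (hω' : ω.Nondegenerate) (n : ℕ) (σ : Equiv.Perm (Fin (n + 1)))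
    (B : Inv (poissonMatrix b ω) n) : IsPermuted σ B.1 (invRep b hω hω' n σ B).1 :=
  (exists_perm_Inv (poissonMatrix_transpose b hω hω') (poissonMatrix_det b hω') σ B).choose_spec

/-- The subspace `Inv_n(V)^{S_{n+1}}`. -/
def invariantPart {V ι : Type*} [AddCommGroup V] [Module ℂ V] [Fintype ι] [DecidableEq ι]
    (b : Module.Basis ι ℂ V) {ω : LinearMap.BilinForm ℂ V} (hω : ω.IsAlt)
    (hω' : ω.Nondegenerate) (n : ℕ) : Submodule ℂ (Inv (poissonMatrix b ω) n) :=
  Representation.invariants (k := ℂ) (V := Inv (poissonMatrix b ω) n) (invRep b hω hω' n)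

/-! ### Representations of the symmetric group -/

/-- The permutation representation `ℂ^{n+1}` of `S_{n+1}`. -/
def permRep (n : ℕ) : Representation ℂ (Equiv.Perm (Fin (n + 1))) (Fin (n + 1) → ℂ) where
  toFun σ := LinearMap.funLeft ℂ ℂ σ.symm
  map_one' := rfl
  map_mul' _ _ := rfl

/-- The vectors of `ℂ^{n+1}` with coordinate sum zero. -/
def sumZero (n : ℕ) : Submodule ℂ (Fin (n + 1) → ℂ) where
  carrier := {v | ∑ i, v i = 0}
  zero_mem' := by simp
  add_mem' := fun {v w} hv hw => by
    simp only [Set.mem_ofPred_eq] at hv hw ⊢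
    simp [Finset.sum_add_distrib, hv, hw]
  smul_mem' := fun c v hv => by
    simp only [Set.mem_ofPred_eq] at hv ⊢
    simp [← Finset.mul_sum, hv]

/-- The reflection representation `𝔥` of `S_{n+1}`. -/
def reflRep (n : ℕ) : Representation ℂ (Equiv.Perm (Fin (n + 1))) (sumZero n) :=
  (permRep n).subrepresentation (sumZero n) fun σ v (hv : ∑ i, v i = 0) =>
    (Equiv.sum_comp σ.symm v).trans hv

/-- The second exterior power of a representation. -/
def extSq {G W : Type*} [Group G] [AddCommGroup W] [Module ℂ W] (ρ : Representation ℂ G W) :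
    Representation ℂ G (⋀[ℂ]^2 W) where
  toFun g := exteriorPower.map 2 (ρ g)
  map_one' := by rw [map_one]; exact exteriorPower.map_id (M := W)
  map_mul' g h := by rw [map_mul]; exact exteriorPower.map_comp (n := 2) (ρ h) (ρ g)

open scoped TensorProduct in
/-- Functoriality of the symmetric powers. -/
def symMap {W : Type*} [AddCommGroup W] [Module ℂ W] (κ : Type) (u : W →ₗ[ℂ] W) :
    SymmetricPower ℂ κ W →ₗ[ℂ] SymmetricPower ℂ κ W where
  __ := AddCon.lift _
    ((SymmetricPower.mk ℂ κ W) ∘ₗ (PiTensorProduct.map fun _ => u)).toAddMonoidHom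
    (AddCon.addConGen_le.mpr fun x y h => by
      cases h with
      | perm e f =>
        rw [AddCon.ker_rel]
        simp only [LinearMap.toAddMonoidHom_coe, LinearMap.comp_apply, PiTensorProduct.map_tprod]
        exact (SymmetricPower.tprod_equiv e fun i => u (f i)).symm)
  map_smul' c x := by
    induction x using AddCon.induction_on with
    | H x =>
      exact map_smul ((SymmetricPower.mk ℂ κ W) ∘ₗ (PiTensorProduct.map fun _ => u)) c x

lemma symMap_mk {W : Type*} [AddCommGroup W] [Module ℂ W] (κ : Type) (u : W →ₗ[ℂ] W)
    (x : PiTensorProduct ℂ fun _ : κ => W) :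
    symMap κ u (SymmetricPower.mk ℂ κ W x) =
      SymmetricPower.mk ℂ κ W (PiTensorProduct.map (fun _ => u) x) := rfl

/-- The second symmetric power of a representation. -/
def symSq {G W : Type*} [Group G] [AddCommGroup W] [Module ℂ W] (ρ : Representation ℂ G W) :
    Representation ℂ G (SymmetricPower ℂ (Fin 2) W) where
  toFun g := symMap (Fin 2) (ρ g)
  map_one' := by
    apply LinearMap.ext
    intro x
    induction x using AddCon.induction_on with
    | H x =>
      refine (symMap_mk _ _ x).trans ?_
      rw [map_one]
      exact congrArg _ (LinearMap.congr_fun PiTensorProduct.map_id x)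
  map_mul' g h := by
    apply LinearMap.ext
    intro x
    induction x using AddCon.induction_on with
    | H x =>
      refine (symMap_mk _ _ x).trans ?_
      rw [map_mul]
      exact congrArg _ (LinearMap.congr_fun (PiTensorProduct.map_comp _ _) x)

/-- The homomorphisms of representations `W → Inv_n(V)` whose image consists of operators of
order `r`. -/
def homOfOrder {V ι W : Type*} [AddCommGroup V] [Module ℂ V] [Fintype ι] [DecidableEq ι]
    [AddCommGroup W] [Module ℂ W] (b : Module.Basis ι ℂ V) {ω : LinearMap.BilinForm ℂ V}
    (hω : ω.IsAlt) (hω' : ω.Nondegenerate) (n : ℕ)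
    (τ : Representation ℂ (Equiv.Perm (Fin (n + 1))) W) (r : ℕ) :
    Submodule ℂ (τ.IntertwiningMap (invRep b hω hω' n)) where
  carrier := {T | ∀ w, (T w).1 ∈ orderPart ι n r}
  zero_mem' := fun _ => zero_mem _
  add_mem' := fun hS hT w => add_mem (hS w) (hT w)
  smul_mem' := fun c _ hT w => Submodule.smul_mem _ c (hT w)

end InvPoly

end

/-!
An invariant polydifferential operator `B` commutes with all Hamiltonian vector fields: for
Hamiltonians of degree at least three one differentiates the automorphism `exp (t {h, ·})`, and a
differential equation for `h` that holds for all `h` of high degree holds for every `h`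
(`isHamInvariant_of_mem_Inv`).

Fix a nonzero linear function `q`. Every function is of the form `{h, q}`, so an invariant operator
that is symmetric in some of its arguments is determined by its values with `q` in all of these
arguments (`IsHamInvariant.eq_zero`). If `B` is symmetric in all of its `n` arguments,
then `B(q, …, q)` is invariant under the flows that preserve `q` and has weight `n` under the flow
rescaling `q`, so it is a multiple of `q ^ n`, and `B` is a multiple of the product
(`exists_eq_smul_mulInv`). If `B` is symmetric in the first `m = n - 1` arguments only, then
`B(q, …, q, ·)` is a differential operator that commutes with the Hamiltonian vector fields of all
functions Poisson commuting with `q` and that has weight `m` under the rescaling flow; such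
operators are the combinations of `q ^ (m - b) {q, ·} ^ b`, `0 ≤ b ≤ m`
(`IsStabilized.exists_eq_sum`). Hence the operators fixed by the permutations of `f₁, …, f_m` have
as a basis the symmetrizations of `f₁ ⋯ f_{m-b} {f_{m-b+1}, {…, {f_m, f_{m+1}}}}`, of order `2 b`,
and the exchange of `f₀` and `f_{m+1}` multiplies the one with `b` brackets by `(-1) ^ b`, because
Hamiltonian vector fields are antiselfadjoint (`linearIndependent_symBracket`,
`symBracket_mem_orderPart`, `symBracket_swap`).

The rest is representation theory. The vectors fixed by the stabilizer of one letter are the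
multiples of the product, so the invariants have dimension one and the reflection representation,
which is spanned by the orbit of a vector with that stabilizer and with sum zero, does not occur
(`HasOnePoint.hom_reflRep_eq_zero`). By a form of Frobenius reciprocity, the homomorphisms from the
symmetric or exterior square of the reflection representation correspond to the vectors that are
fixed by the stabilizer of two letters and on which the exchange of these letters acts by `1` or
`-1` (`IsReflSquare.evalEquiv`): the symmetrized brackets with `b` even or odd. This gives the
exterior square. For the complement of `𝔥 ⊕ ℂ` in the symmetric square, the homomorphism with
`b = 0` factors through the projection to the trivial summand, and the others vanish on `𝔥 ⊕ ℂ`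
(`IsGradedModel.exists_basis_complement`). The order of an operator is detected by the commutator
with the Euler field (`eulerCommutator_of_mem_orderPart`) and is preserved by the permutations,
since integration by parts does not change it (`invRepOfMatrix_mem_orderPart`).
-/

noncomputable section

namespace InvPoly

open MvPowerSeries

/-! ### Jets of formal power series -/

/-- The power series all of whose coefficients of degree `< N` vanish, that is the `N`-th power
of the maximal ideal. -/
def jetIdeal (ι : Type*) (N : ℕ) : Ideal (Fn ι) where
  carrier := {f | ∀ m : ι →₀ ℕ, m.degree < N → coeff m f = 0}
  zero_mem' := fun m _ => map_zero _
  add_mem' := fun {f h} hf hh m hm => by rw [map_add, hf m hm, hh m hm, add_zero]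
  smul_mem' := fun a f hf m hm => by
    classical
    rw [smul_eq_mul, coeff_mul]
    refine Finset.sum_eq_zero fun p hp => ?_
    have h : p.1 + p.2 = m := Finset.HasAntidiagonal.mem_antidiagonal.mp hp
    rw [hf p.2, mul_zero]
    rw [← h, map_add] at hm
    omega

lemma mem_jetIdeal_zero {ι : Type*} (f : Fn ι) : f ∈ jetIdeal ι 0 :=
  fun _ hm => absurd hm (Nat.not_lt_zero _)

lemma jetIdeal_anti {ι : Type*} {M N : ℕ} (h : M ≤ N) : jetIdeal ι N ≤ jetIdeal ι M :=
  fun _ hf m hm => hf m (hm.trans_le h)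

lemma smul_mem_jetIdeal {ι : Type*} {N : ℕ} (c : ℂ) {f : Fn ι} (hf : f ∈ jetIdeal ι N) :
    c • f ∈ jetIdeal ι N := Submodule.smul_of_tower_mem _ c hf

lemma mul_mem_jetIdeal {ι : Type*} {M N : ℕ} {f h : Fn ι} (hf : f ∈ jetIdeal ι M)
    (hh : h ∈ jetIdeal ι N) : f * h ∈ jetIdeal ι (M + N) := by
  classical
  intro m hm
  rw [coeff_mul]
  refine Finset.sum_eq_zero fun p hp => ?_
  have h : p.1 + p.2 = m := Finset.HasAntidiagonal.mem_antidiagonal.mp hp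
  rw [← h, map_add] at hm
  by_cases h1 : p.1.degree < M
  · rw [hf _ h1, zero_mul]
  · rw [hh _ (by omega), mul_zero]

lemma pd_mem_jetIdeal {ι : Type*} {N : ℕ} (i : ι) {f : Fn ι} (hf : f ∈ jetIdeal ι N) :
    pd i f ∈ jetIdeal ι (N - 1) := by
  intro m hm
  rw [coeff_pd, hf, zero_mul]
  rw [map_add, Finsupp.degree_single]
  omega

lemma X_mem_jetIdeal {ι : Type*} (i : ι) : (X i : Fn ι) ∈ jetIdeal ι 1 := by
  classical
  intro m hm
  rw [coeff_X, if_neg]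
  rintro rfl
  simp at hm

lemma eq_of_sub_mem_jetIdeal {ι : Type*} {f h : Fn ι} (H : ∀ N, f - h ∈ jetIdeal ι N) :
    f = h := by
  ext m
  have := H (m.degree + 1) m (Nat.lt_succ_self _)
  rwa [map_sub, sub_eq_zero] at this

/-- Differential operators are continuous for the adic topology. -/
lemma exists_jetIdeal_of_diffOp {ι : Type*} {D : Module.End ℂ (Fn ι)} (hD : D ∈ diffOp ι) :
    ∀ N, ∃ M, ∀ f ∈ jetIdeal ι M, D f ∈ jetIdeal ι N := by
  induction hD using Algebra.adjoin_induction with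
  | mem x hx =>
    intro N
    rcases hx with ⟨a, rfl⟩ | ⟨i, rfl⟩
    · exact ⟨N, fun f hf => Ideal.mul_mem_left _ a hf⟩
    · exact ⟨N + 1, fun f hf => pd_mem_jetIdeal i hf⟩
  | algebraMap r =>
    exact fun N => ⟨N, fun f hf => by
      simpa [Algebra.algebraMap_eq_smul_one] using smul_mem_jetIdeal r hf⟩
  | add x y _ _ hx hy =>
    intro N
    obtain ⟨M, hM⟩ := hx N
    obtain ⟨M', hM'⟩ := hy N
    exact ⟨max M M', fun f hf => add_mem (hM f (jetIdeal_anti (le_max_left _ _) hf))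
      (hM' f (jetIdeal_anti (le_max_right _ _) hf))⟩
  | mul x y _ _ hx hy =>
    intro N
    obtain ⟨M, hM⟩ := hx N
    obtain ⟨M', hM'⟩ := hy M
    exact ⟨M', fun f hf => hM _ (hM' f hf)⟩

/-! ### Exponentials of topologically nilpotent derivations -/

section Exponential

variable {ι : Type*}

/-- The `k`-th term `t^k A^k / k!` of the exponential series. -/
def expTerm (A : Module.End ℂ (Fn ι)) (t : ℂ) (k : ℕ) : Module.End ℂ (Fn ι) :=
  (t ^ k / (k.factorial : ℂ)) • A ^ k

/-- `exp (t A)`, for an operator `A` that raises the degree: the coefficient of degree `d` of the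
exponential series is a sum of at most `d + 1` nonzero terms. -/
def expOp (A : Module.End ℂ (Fn ι)) (t : ℂ) : Module.End ℂ (Fn ι) where
  toFun f := fun m => ∑ k ∈ Finset.range (m.degree + 1), coeff m (expTerm A t k f)
  map_add' f h := by
    funext m
    simp only [map_add, Finset.sum_add_distrib]
    rfl
  map_smul' c f := by
    funext m
    simp only [map_smul, ← Finset.smul_sum, RingHom.id_apply]
    rfl

lemma coeff_expOp (A : Module.End ℂ (Fn ι)) (t : ℂ) (f : Fn ι) (m : ι →₀ ℕ) :
    coeff m (expOp A t f) = ∑ k ∈ Finset.range (m.degree + 1), coeff m (expTerm A t k f) := rfl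

/-- The operator `A` raises the degree by at least one. -/
def RaisesDegree (A : Module.End ℂ (Fn ι)) : Prop :=
  ∀ N, ∀ f ∈ jetIdeal ι N, A f ∈ jetIdeal ι (N + 1)

variable {A : Module.End ℂ (Fn ι)}

lemma expTerm_mem (hA : RaisesDegree A) (t : ℂ) (k : ℕ) {N : ℕ} {f : Fn ι}
    (hf : f ∈ jetIdeal ι N) :
    expTerm A t k f ∈ jetIdeal ι (N + k) := by
  refine smul_mem_jetIdeal _ ?_
  induction k with
  | zero => simpa using hf
  | succ k ih =>
    rw [pow_succ', Module.End.mul_apply, ← add_assoc]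
    exact hA _ _ ih

lemma expOp_sub_mem (hA : RaisesDegree A) (t : ℂ) (f : Fn ι) (K : ℕ) :
    expOp A t f - ∑ k ∈ Finset.range K, expTerm A t k f ∈ jetIdeal ι K := by
  intro m hm
  rw [map_sub, map_sum, coeff_expOp, sub_eq_zero]
  refine Finset.sum_subset (Finset.range_subset_range.mpr (by omega)) fun k _ hk => ?_
  refine expTerm_mem hA t k (mem_jetIdeal_zero f) m ?_
  simp at hk; omega

lemma sum_range_sum_range_sub {E : Type*} [AddCommGroup E] (F : ℕ → ℕ → E) (K : ℕ) :
    (∑ i ∈ Finset.range K, ∑ j ∈ Finset.range K, F i j) -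
      ∑ n ∈ Finset.range K, ∑ p ∈ Finset.HasAntidiagonal.antidiagonal n, F p.1 p.2 =
    ∑ p ∈ (Finset.range K ×ˢ Finset.range K).filter (fun p => K ≤ p.1 + p.2), F p.1 p.2 := by
  rw [← Finset.sum_product', ← Finset.sum_filter_add_sum_filter_not
    (Finset.range K ×ˢ Finset.range K) (fun p => K ≤ p.1 + p.2), add_sub_assoc, add_eq_left,
    sub_eq_zero]
  rw [← Finset.sum_fiberwise_of_maps_to (t := Finset.range K) (g := fun p : ℕ × ℕ => p.1 + p.2)]
  · refine Finset.sum_congr rfl fun n hn => Finset.sum_congr ?_ fun _ _ => rfl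
    ext p
    simp only [Finset.mem_filter, Finset.mem_product, Finset.mem_range,
      Finset.HasAntidiagonal.mem_antidiagonal] at hn ⊢
    omega
  · intro p hp
    simp only [Finset.mem_filter, not_le] at hp
    simpa using hp.2

lemma expTerm_succ (t : ℂ) (k : ℕ) (f : Fn ι) :
    ((k : ℂ) + 1) • expTerm A t (k + 1) f = t • A (expTerm A t k f) := by
  have h1 : ((k : ℂ) + 1) ≠ 0 := by exact_mod_cast Nat.succ_ne_zero k
  have h2 : (k.factorial : ℂ) ≠ 0 := by exact_mod_cast k.factorial_ne_zero
  simp only [expTerm, LinearMap.smul_apply, map_smul, smul_smul, pow_succ' A k,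
    Module.End.mul_apply]
  congr 1
  rw [Nat.factorial_succ]; push_cast
  field_simp
  ring

/-- Leibniz's formula for the divided powers of a derivation of a bilinear operation. -/
lemma sum_antidiagonal_expTerm {β : Fn ι →ₗ[ℂ] Fn ι →ₗ[ℂ] Fn ι}
    (hder : ∀ f h, A (β f h) = β (A f) h + β f (A h)) (t : ℂ) (n : ℕ) (f h : Fn ι) :
    ∑ p ∈ Finset.HasAntidiagonal.antidiagonal n, β (expTerm A t p.1 f) (expTerm A t p.2 h) =
      expTerm A t n (β f h) := by
  induction n with
  | zero => simp [expTerm]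
  | succ n ih =>
    have h1 : ((n : ℂ) + 1) ≠ 0 := by exact_mod_cast Nat.succ_ne_zero n
    refine (smul_right_injective (Fn ι) h1) ?_
    simp only
    rw [expTerm_succ, ← ih, Finset.smul_sum]
    have h2 : ∀ p ∈ Finset.HasAntidiagonal.antidiagonal (n + 1),
        ((n : ℂ) + 1) • β (expTerm A t p.1 f) (expTerm A t p.2 h) =
        β ((p.1 : ℂ) • expTerm A t p.1 f) (expTerm A t p.2 h) +
        β (expTerm A t p.1 f) ((p.2 : ℂ) • expTerm A t p.2 h) := by
      intro p hp
      have h3 : ((n : ℂ) + 1) = p.1 + p.2 := by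
        exact_mod_cast (Finset.HasAntidiagonal.mem_antidiagonal.mp hp).symm
      rw [h3, add_smul, map_smul, map_smul, LinearMap.smul_apply]
    rw [Finset.sum_congr rfl h2, Finset.sum_add_distrib, Finset.Nat.sum_antidiagonal_succ,
      Finset.Nat.sum_antidiagonal_succ']
    simp only [Nat.cast_zero, zero_smul, map_zero, LinearMap.zero_apply, zero_add,
      Nat.cast_add, Nat.cast_one, expTerm_succ, map_smul, LinearMap.smul_apply, map_sum, hder,
      Finset.sum_add_distrib, smul_add, Finset.smul_sum]

/-- The exponential of a derivation of a bilinear operation `β` is an automorphism of `β`.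
The operation is allowed to lower the degree by `2`, as the Poisson bracket does. -/
lemma expOp_bilinear (hA : RaisesDegree A) {β : Fn ι →ₗ[ℂ] Fn ι →ₗ[ℂ] Fn ι}
    (hβ : ∀ M N, ∀ f ∈ jetIdeal ι M, ∀ h ∈ jetIdeal ι N, β f h ∈ jetIdeal ι (M + N - 2))
    (hder : ∀ f h, A (β f h) = β (A f) h + β f (A h)) (t : ℂ) (f h : Fn ι) :
    expOp A t (β f h) = β (expOp A t f) (expOp A t h) := by
  refine eq_of_sub_mem_jetIdeal fun K => ?_
  set S : Fn ι → Fn ι := fun f => ∑ k ∈ Finset.range (K + 2), expTerm A t k f with hS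
  have h0 : ∀ f, expOp A t f - S f ∈ jetIdeal ι (K + 2) := fun f => expOp_sub_mem hA t f _
  have h1 : β (S f) (S h) - S (β f h) ∈ jetIdeal ι K := by
    have h2 := sum_range_sum_range_sub
      (fun i j => β (expTerm A t i f) (expTerm A t j h)) (K + 2)
    simp only [sum_antidiagonal_expTerm hder] at h2
    rw [Finset.sum_comm] at h2
    simp only [hS, map_sum, LinearMap.sum_apply]
    rw [h2]
    refine sum_mem fun p hp => ?_
    have h2 := (Finset.mem_filter.mp hp).2
    exact jetIdeal_anti (by omega) (hβ _ _ _ (expTerm_mem hA t p.1 (mem_jetIdeal_zero f)) _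
      (expTerm_mem hA t p.2 (mem_jetIdeal_zero h)))
  have h2 : β (expOp A t f - S f) (expOp A t h) ∈ jetIdeal ι K :=
    jetIdeal_anti (by omega) (hβ _ _ _ (h0 f) _ (mem_jetIdeal_zero _))
  have h3 : β (S f) (expOp A t h - S h) ∈ jetIdeal ι K :=
    jetIdeal_anti (by omega) (hβ _ _ _ (mem_jetIdeal_zero _) _ (h0 h))
  have h4 := jetIdeal_anti (Nat.le_add_right K 2) (h0 (β f h))
  have h5 := sub_mem (sub_mem (sub_mem h4 h1) h2) h3
  convert h5 using 1
  simp only [map_sub, LinearMap.sub_apply]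
  abel

lemma expOp_expOp (hA : RaisesDegree A) (s t : ℂ) (f : Fn ι) :
    expOp A s (expOp A t f) = expOp A (s + t) f := by
  refine eq_of_sub_mem_jetIdeal fun K => ?_
  set S : ℂ → Fn ι → Fn ι := fun t f => ∑ k ∈ Finset.range K, expTerm A t k f with hS
  have h0 : ∀ t f, expOp A t f - S t f ∈ jetIdeal ι K := fun t f => expOp_sub_mem hA t f _
  have key : ∀ n, ∑ p ∈ Finset.HasAntidiagonal.antidiagonal n, expTerm A s p.1 (expTerm A t p.2 f) =
      expTerm A (s + t) n f := by
    intro n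
    have : ∀ p ∈ Finset.HasAntidiagonal.antidiagonal n, expTerm A s p.1 (expTerm A t p.2 f) =
        (s ^ p.1 / p.1.factorial * (t ^ p.2 / p.2.factorial)) • (A ^ n) f := by
      intro p hp
      rw [← Finset.HasAntidiagonal.mem_antidiagonal.mp hp, pow_add]
      simp [expTerm, smul_smul, mul_comm]
    rw [Finset.sum_congr rfl this, ← Finset.sum_smul]
    simp only [expTerm, LinearMap.smul_apply]
    congr 1
    have h2 := congrArg (PowerSeries.coeff n) (PowerSeries.exp_mul_exp_eq_exp_add (A := ℂ) s t)
    rw [PowerSeries.coeff_mul] at h2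
    simpa [PowerSeries.coeff_rescale, PowerSeries.coeff_exp, div_eq_mul_inv] using h2
  have h1 : S s (S t f) - S (s + t) f ∈ jetIdeal ι K := by
    have h2 := sum_range_sum_range_sub (fun i j => expTerm A s i (expTerm A t j f)) K
    simp only [key] at h2
    simp only [hS, map_sum]
    rw [h2]
    refine sum_mem fun p hp => ?_
    have h2 := (Finset.mem_filter.mp hp).2
    exact jetIdeal_anti (by omega)
      (expTerm_mem hA s p.1 (expTerm_mem hA t p.2 (mem_jetIdeal_zero f)))
  have h2 : S s (expOp A t f - S t f) ∈ jetIdeal ι K :=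
    sum_mem fun k _ => jetIdeal_anti (Nat.le_add_right _ _) (expTerm_mem hA s k (h0 t f))
  have h5 := sub_mem (add_mem (add_mem (h0 s (expOp A t f)) h2) h1) (h0 (s + t) f)
  convert h5 using 1
  simp only [hS, map_sub, Finset.sum_sub_distrib]
  abel

lemma expOp_zero (f : Fn ι) : expOp A 0 f = f := by
  ext m
  rw [coeff_expOp, Finset.sum_eq_single 0]
  · simp [expTerm]
  · intro k _ hk; simp [expTerm, hk]
  · simp

end Exponential

/-! ### From formal symplectic automorphisms to Hamiltonian vector fields -/

section Hamiltonian

variable {ι : Type*} [Fintype ι] {P : Matrix ι ι ℂ}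

lemma bracket_swap (hP : P.transpose = -P) (f h : Fn ι) : bracket P f h = -bracket P h f := by
  unfold bracket
  rw [Finset.sum_comm, ← Finset.sum_neg_distrib]
  refine Finset.sum_congr rfl fun i _ => ?_
  rw [← Finset.sum_neg_distrib]
  refine Finset.sum_congr rfl fun j _ => ?_
  have := congrFun (congrFun hP i) j
  simp only [Matrix.transpose_apply, Matrix.neg_apply] at this
  rw [this, neg_smul, mul_comm]

lemma ham_mul (P : Matrix ι ι ℂ) (h f g : Fn ι) :
    ham P h (f * g) = ham P h f * g + f * ham P h g := by
  simp only [ham_apply, bracket, pd_mul, Finset.sum_mul, Finset.mul_sum,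
    ← Finset.sum_add_distrib]
  refine Finset.sum_congr rfl fun i _ => Finset.sum_congr rfl fun j _ => ?_
  simp only [smul_mul_assoc, mul_smul_comm, ← smul_add]
  congr 1
  ring

/-- The Poisson bracket as a bilinear map. -/
def bracketₗ (P : Matrix ι ι ℂ) : Fn ι →ₗ[ℂ] Fn ι →ₗ[ℂ] Fn ι where
  toFun h := ham P h
  map_add' f g := by
    ext1 k
    simp only [LinearMap.add_apply, ham_apply, bracket, map_add, add_mul, smul_add,
      Finset.sum_add_distrib]
  map_smul' c f := by
    ext1 k
    simp only [LinearMap.smul_apply, ham_apply, bracket, map_smul, smul_mul_assoc,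
      Finset.smul_sum, RingHom.id_apply]
    exact Finset.sum_congr rfl fun i _ => Finset.sum_congr rfl fun j _ => smul_comm _ _ _

lemma bracketₗ_apply (P : Matrix ι ι ℂ) (h : Fn ι) : bracketₗ P h = ham P h := rfl

lemma ham_swap (hP : P.transpose = -P) (f h : Fn ι) : ham P f h = -ham P h f := by
  simp only [ham_apply]; exact bracket_swap hP f h

lemma ham_self (hP : P.transpose = -P) (f : Fn ι) : ham P f f = 0 := by
  have h : (2 : ℂ) • ham P f f = 0 := by
    rw [two_smul]; nth_rewrite 1 [ham_swap hP]; exact neg_add_cancel _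
  exact (smul_eq_zero.mp h).resolve_left two_ne_zero

lemma ham_mul_left (hP : P.transpose = -P) (f g h : Fn ι) :
    ham P (f * g) h = f * ham P g h + g * ham P f h := by
  rw [ham_swap hP, ham_mul, ham_swap hP h, ham_swap hP h]
  ring

lemma ham_pd (P : Matrix ι ι ℂ) (h f : Fn ι) (k : ι) :
    ham P h (pd k f) = pd k (ham P h f) - ∑ i, ∑ j, P i j • (pd k (pd i h) * pd j f) := by
  simp only [ham_apply, bracket, map_sum, map_smul, pd_mul, smul_add, Finset.sum_add_distrib]
  rw [add_sub_cancel_left]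
  exact Finset.sum_congr rfl fun i _ => Finset.sum_congr rfl fun j _ => by rw [pd_comm]

lemma sum_quadruple {κ E : Type*} [Fintype κ] [AddCommMonoid E] (F : κ → κ → κ → κ → E) :
    ∑ a, ∑ b, ∑ c, ∑ d, F a b c d = ∑ c, ∑ d, ∑ b, ∑ a, F a b c d := by
  have h1 : ∀ a, ∑ b, ∑ c, ∑ d, F a b c d = ∑ c, ∑ d, ∑ b, F a b c d := fun a => by
    rw [Finset.sum_comm]
    exact Finset.sum_congr rfl fun c _ => Finset.sum_comm
  simp only [h1]
  rw [Finset.sum_comm]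
  refine Finset.sum_congr rfl fun c _ => ?_
  rw [Finset.sum_comm]
  exact Finset.sum_congr rfl fun d _ => Finset.sum_comm

/-- The Jacobi identity. -/
lemma ham_jacobi (hP : P.transpose = -P) (h f g : Fn ι) :
    ham P h (ham P f g) = ham P (ham P h f) g + ham P f (ham P h g) := by
  have hP' : ∀ i j, P j i = -P i j := fun i j => by
    have := congrFun (congrFun hP i) j
    simpa only [Matrix.transpose_apply, Matrix.neg_apply] using this
  have e0 : ham P h (ham P f g) =
      ∑ k, ∑ l, P k l • (ham P h (pd k f) * pd l g + pd k f * ham P h (pd l g)) := by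
    rw [ham_apply P f g, bracket]
    simp only [map_sum, map_smul, ham_mul]
  have e1 : ∑ k, ∑ l, ∑ i, ∑ j, (P k l * P i j) • (pd k f * pd l (pd i h) * pd j g) =
      -∑ k, ∑ l, ∑ i, ∑ j, (P k l * P i j) • (pd k (pd i h) * pd j f * pd l g) := by
    rw [sum_quadruple]
    simp only [← Finset.sum_neg_distrib]
    refine Finset.sum_congr rfl fun i _ => Finset.sum_congr rfl fun j _ =>
      Finset.sum_congr rfl fun k _ => Finset.sum_congr rfl fun l _ => ?_
    rw [hP' k l, pd_comm k i, ← neg_smul]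
    congr 1
    · ring
    · ring
  rw [e0, ham_apply P (ham P h f), ham_apply P f, bracket, bracket, ← Finset.sum_add_distrib,
    ← sub_eq_zero, ← Finset.sum_sub_distrib]
  simp only [ham_pd, ← Finset.sum_add_distrib, ← Finset.sum_sub_distrib, sub_mul, mul_sub]
  rw [← neg_eq_zero, ← add_neg_eq_zero.mpr e1, neg_neg, add_comm]
  simp only [← Finset.sum_add_distrib, ← Finset.sum_neg_distrib]
  refine Finset.sum_congr rfl fun k _ => Finset.sum_congr rfl fun l _ => ?_
  simp only [Finset.sum_add_distrib, mul_smul, ← Finset.smul_sum, Finset.sum_mul, Finset.mul_sum,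
    smul_mul_assoc, mul_smul_comm, mul_assoc, smul_add, smul_sub]
  abel

lemma raisesDegree_ham (P : Matrix ι ι ℂ) {h : Fn ι} (hh : h ∈ jetIdeal ι 3) :
    RaisesDegree (ham P h) := by
  intro N f hf
  rw [ham_apply]
  refine sum_mem fun i _ => sum_mem fun j _ => smul_mem_jetIdeal _ ?_
  exact jetIdeal_anti (by omega) (mul_mem_jetIdeal (pd_mem_jetIdeal i hh) (pd_mem_jetIdeal j hf))

/-- The formal symplectic automorphism `exp (t {h, ·})`, for a Hamiltonian `h` of degree at
least three. -/
def expHam (P : Matrix ι ι ℂ) {h : Fn ι} (hh : h ∈ jetIdeal ι 3) (t : ℂ) : Fn ι ≃ₐ[ℂ] Fn ι :=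
  have hA := raisesDegree_ham P hh
  have mul : ∀ f g, expOp (ham P h) t (f * g) = expOp (ham P h) t f * expOp (ham P h) t g :=
    expOp_bilinear hA (β := LinearMap.mul ℂ (Fn ι))
      (fun _ _ _ hf _ hh => jetIdeal_anti (Nat.sub_le _ _) (mul_mem_jetIdeal hf hh))
      (ham_mul P h) t
  have inv : ∀ t f, expOp (ham P h) t (expOp (ham P h) (-t) f) = f := fun t f => by
    rw [expOp_expOp hA, add_neg_cancel, expOp_zero]
  AlgEquiv.ofLinearEquiv
    (LinearEquiv.ofLinearMap (expOp (ham P h) t) (expOp (ham P h) (-t))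
      (LinearMap.ext fun f => inv t f)
      (LinearMap.ext fun f => by simpa using inv (-t) f))
    (by
      have h1 := mul (expOp (ham P h) (-t) 1) 1
      rw [mul_one, inv, one_mul] at h1
      exact h1.symm)
    mul

lemma expHam_apply (P : Matrix ι ι ℂ) {h : Fn ι} (hh : h ∈ jetIdeal ι 3) (t : ℂ) (f : Fn ι) :
    expHam P hh t f = expOp (ham P h) t f := rfl

lemma isSymplectic_expHam (hP : P.transpose = -P) {h : Fn ι} (hh : h ∈ jetIdeal ι 3) (t : ℂ) :
    IsSymplectic P (expHam P hh t) := by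
  intro f g
  simp only [expHam_apply, ← ham_apply]
  refine expOp_bilinear (raisesDegree_ham P hh) (β := bracketₗ P) ?_ (ham_jacobi hP h) t f g
  intro M N f hf g hg
  rw [bracketₗ_apply, ham_apply]
  refine sum_mem fun i _ => sum_mem fun j _ => smul_mem_jetIdeal _ ?_
  exact jetIdeal_anti (by omega) (mul_mem_jetIdeal (pd_mem_jetIdeal i hf) (pd_mem_jetIdeal j hg))

end Hamiltonian

/-- The curve `c` of power series has coefficientwise derivative `v` at the parameter `0`. -/
def HasCoeffDeriv {ι : Type*} (c : ℂ → Fn ι) (v : Fn ι) : Prop :=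
  ∀ m, HasDerivAt (fun t => coeff m (c t)) (coeff m v) 0

section CoeffDeriv

variable {ι : Type*}

lemma HasCoeffDeriv.unique {c : ℂ → Fn ι} {v w : Fn ι} (hv : HasCoeffDeriv c v)
    (hw : HasCoeffDeriv c w) : v = w := by
  ext m
  exact (hv m).unique (hw m)

lemma HasCoeffDeriv.const (a : Fn ι) : HasCoeffDeriv (fun _ => a) 0 := fun m => by
  simpa using hasDerivAt_const (0 : ℂ) (coeff m a)

lemma HasCoeffDeriv.add {c d : ℂ → Fn ι} {v w : Fn ι} (hv : HasCoeffDeriv c v)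
    (hw : HasCoeffDeriv d w) : HasCoeffDeriv (fun t => c t + d t) (v + w) := fun m => by
  simpa using (hv m).fun_add (hw m)

lemma HasCoeffDeriv.smul {c : ℂ → Fn ι} {v : Fn ι} (r : ℂ) (hv : HasCoeffDeriv c v) :
    HasCoeffDeriv (fun t => r • c t) (r • v) := fun m => by
  simpa using (hv m).const_mul r

lemma HasCoeffDeriv.mul {c d : ℂ → Fn ι} {v w : Fn ι} (hv : HasCoeffDeriv c v)
    (hw : HasCoeffDeriv d w) : HasCoeffDeriv (fun t => c t * d t) (v * d 0 + c 0 * w) := by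
  classical
  intro m
  simp only [map_add, coeff_mul, ← Finset.sum_add_distrib]
  exact HasDerivAt.fun_sum fun p _ => (hv p.1).mul (hw p.2)

lemma HasCoeffDeriv.prod {κ : Type*} [DecidableEq κ] {s : Finset κ} {c : κ → ℂ → Fn ι}
    {v : κ → Fn ι} (hv : ∀ k ∈ s, HasCoeffDeriv (c k) (v k)) :
    HasCoeffDeriv (fun t => ∏ k ∈ s, c k t) (∑ k ∈ s, v k * ∏ l ∈ s.erase k, c l 0) := by
  induction s using Finset.induction_on with
  | empty => simpa using HasCoeffDeriv.const (1 : Fn ι)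
  | insert k s hk ih =>
    simp only [Finset.prod_insert hk]
    have := (hv k (Finset.mem_insert_self k s)).mul
      (ih fun l hl => hv l (Finset.mem_insert_of_mem hl))
    convert this using 1
    rw [Finset.sum_insert hk, Finset.erase_insert hk, Finset.mul_sum]
    congr 1
    refine Finset.sum_congr rfl fun l hl => ?_
    have : k ≠ l := by rintro rfl; exact hk hl
    rw [Finset.erase_insert_of_ne this, Finset.prod_insert (by simp [hk])]
    ring

lemma HasCoeffDeriv.diffOp {D : Module.End ℂ (Fn ι)} (hD : D ∈ diffOp ι) :
    ∀ {c : ℂ → Fn ι} {v : Fn ι}, HasCoeffDeriv c v → HasCoeffDeriv (fun t => D (c t)) (D v) := by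
  induction hD using Algebra.adjoin_induction with
  | mem x hx =>
    intro c v h
    rcases hx with ⟨a, rfl⟩ | ⟨i, rfl⟩
    · simpa using (HasCoeffDeriv.const a).mul h
    · intro m
      simp only [coeff_pd]
      exact (h _).mul_const _
  | algebraMap r =>
    intro c v h
    simpa [Algebra.algebraMap_eq_smul_one] using h.smul r
  | add x y _ _ hx hy => exact fun h => (hx h).add (hy h)
  | mul x y _ _ hx hy => exact fun h => hx (hy h)

lemma HasCoeffDeriv.polyDiffOp {n : ℕ} {B : MultiOp ι n} (hB : B ∈ polyDiffOp ι n)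
    {c : Fin n → ℂ → Fn ι} {v : Fin n → Fn ι} (h : ∀ k, HasCoeffDeriv (c k) (v k)) :
    HasCoeffDeriv (fun t => B (fun k => c k t))
      (∑ k, B (Function.update (fun k => c k 0) k (v k))) := by
  induction hB using Submodule.span_induction with
  | mem B hB =>
    obtain ⟨a, D, hD, rfl⟩ := hB
    have := (HasCoeffDeriv.const a).mul
      (HasCoeffDeriv.prod (s := Finset.univ) fun k _ => (h k).diffOp (hD k))
    simp only [prodOp_apply]
    convert this using 1
    rw [zero_mul, zero_add, Finset.mul_sum]
    refine Finset.sum_congr rfl fun k _ => ?_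
    rw [← Finset.mul_prod_erase Finset.univ _ (Finset.mem_univ k), Function.update_self]
    congr 2
    refine Finset.prod_congr rfl fun l hl => ?_
    rw [Function.update_of_ne (Finset.ne_of_mem_erase hl)]
  | zero => simpa using HasCoeffDeriv.const (0 : Fn ι)
  | add x y _ _ hx hy => simpa [Finset.sum_add_distrib] using hx.add hy
  | smul r x _ hx => simpa [Finset.smul_sum] using hx.smul r

lemma hasCoeffDeriv_expOp {A : Module.End ℂ (Fn ι)} (hA : RaisesDegree A) (f : Fn ι) :
    HasCoeffDeriv (fun t => expOp A t f) (A f) := by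
  intro m
  have h1 : coeff m (A f) = ∑ k ∈ Finset.range (m.degree + 1),
      (if k = 1 then coeff m (A f) else 0) := by
    rw [Finset.sum_ite_eq']
    split_ifs with h
    · rfl
    · refine (hA 0 f (mem_jetIdeal_zero f)) m ?_
      simp at h ⊢; omega
  rw [h1]
  simp only [coeff_expOp]
  refine HasDerivAt.fun_sum fun k _ => ?_
  have h2 : HasDerivAt (fun t : ℂ => t ^ k) ((k : ℂ) * 0 ^ (k - 1)) 0 := hasDerivAt_pow k 0
  have h3 := (h2.div_const (k.factorial : ℂ)).mul_const (coeff m ((A ^ k) f))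
  simp only [expTerm, LinearMap.smul_apply, map_smul, smul_eq_mul]
  refine h3.congr_deriv ?_
  split_ifs with hk
  · subst hk; simp
  · rcases k with _ | _ | k
    · simp
    · exact absurd rfl hk
    · simp

end CoeffDeriv

/-! ### The order of a differential operator -/

/-- `D` is a differential operator of order `< k` in the sense of Grothendieck. -/
def HasOrder {ι : Type*} : ℕ → Module.End ℂ (Fn ι) → Prop
  | 0, D => D = 0
  | k + 1, D => ∀ a : Fn ι, HasOrder k (D * LinearMap.mulLeft ℂ a - LinearMap.mulLeft ℂ a * D)

section Order

variable {ι : Type*}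

lemma HasOrder.zero (k : ℕ) : HasOrder k (0 : Module.End ℂ (Fn ι)) := by
  induction k with
  | zero => rfl
  | succ k ih => intro a; simpa using ih

lemma HasOrder.succ {k : ℕ} : ∀ {D : Module.End ℂ (Fn ι)}, HasOrder k D → HasOrder (k + 1) D := by
  induction k with
  | zero => intro D h a; rw [show D = 0 from h]; simpa using HasOrder.zero 0
  | succ k ih => exact fun h a => ih (h a)

lemma HasOrder.mono {k l : ℕ} (hkl : k ≤ l) {D : Module.End ℂ (Fn ι)} (h : HasOrder k D) :
    HasOrder l D := by
  induction hkl with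
  | refl => exact h
  | step _ ih => exact ih.succ

lemma HasOrder.add {k : ℕ} : ∀ {D E : Module.End ℂ (Fn ι)}, HasOrder k D → HasOrder k E →
    HasOrder k (D + E) := by
  induction k with
  | zero => intro D E h h'; rw [show D = 0 from h, show E = 0 from h']; exact add_zero _
  | succ k ih =>
    intro D E h h' a
    convert ih (h a) (h' a) using 1
    noncomm_ring

lemma HasOrder.mul : ∀ {N k l : ℕ}, k + l = N → ∀ {D E : Module.End ℂ (Fn ι)}, HasOrder k D →
    HasOrder l E → HasOrder (k + l) (D * E) := by
  intro N
  induction N with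
  | zero =>
    intro k l hkl D E h h'
    obtain rfl : k = 0 := by omega
    rw [show D = 0 from h, zero_mul]; exact HasOrder.zero _
  | succ N ih =>
    intro k l hkl D E h h'
    rcases k with _ | k
    · rw [show D = 0 from h, zero_mul]; exact HasOrder.zero _
    rcases l with _ | l
    · rw [show E = 0 from h', mul_zero]; exact HasOrder.zero _
    intro a
    have h1 := ih (k := k) (l := l + 1) (by omega) (h a) h'
    have h2 := ih (k := k + 1) (l := l) (by omega) h (h' a)
    convert (HasOrder.add (h1.mono (le_refl _)) (h2.mono (by omega))).mono
      (show k + (l + 1) ≤ (k + 1).add l by simp only [Nat.add_eq]; omega) using 1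
    simp only [sub_mul, mul_sub, mul_assoc]
    abel

lemma exists_hasOrder {D : Module.End ℂ (Fn ι)} (hD : D ∈ diffOp ι) : ∃ k, HasOrder k D := by
  induction hD using Algebra.adjoin_induction with
  | mem x hx =>
    rcases hx with ⟨a, rfl⟩ | ⟨i, rfl⟩
    · refine ⟨1, fun b => ?_⟩
      change _ = _
      ext1 f
      simp only [LinearMap.sub_apply, Module.End.mul_apply, LinearMap.mulLeft_apply,
        LinearMap.zero_apply]
      ring
    · refine ⟨2, fun b c => ?_⟩
      change _ = _
      ext1 f
      simp only [LinearMap.sub_apply, Module.End.mul_apply, LinearMap.mulLeft_apply,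
        LinearMap.zero_apply, pd_mul]
      ring
  | algebraMap r =>
    refine ⟨1, fun b => ?_⟩
    change _ = _
    ext1 f
    simp [Algebra.algebraMap_eq_smul_one]
  | add x y _ _ hx hy =>
    obtain ⟨k, hk⟩ := hx
    obtain ⟨l, hl⟩ := hy
    exact ⟨max k l, (hk.mono (le_max_left _ _)).add (hl.mono (le_max_right _ _))⟩
  | mul x y _ _ hx hy =>
    obtain ⟨k, hk⟩ := hx
    obtain ⟨l, hl⟩ := hy
    exact ⟨k + l, HasOrder.mul rfl hk hl⟩

/-- A differential operator that vanishes on all multiples of a nonzero function is zero. -/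
lemma diffOp_eq_zero_of_mul {D : Module.End ℂ (Fn ι)} (hD : D ∈ diffOp ι) {s : Fn ι}
    (hs : s ≠ 0) (h : ∀ f, D (s * f) = 0) : D = 0 := by
  obtain ⟨k, hk⟩ := exists_hasOrder hD
  clear hD
  induction k generalizing D with
  | zero => exact hk
  | succ k ih =>
    have h1 : ∀ a f, D (a * f) = a * D f := fun a f => by
      have := LinearMap.congr_fun (ih (D := D * LinearMap.mulLeft ℂ a - LinearMap.mulLeft ℂ a * D)
        (fun g => by
          simp only [LinearMap.sub_apply, Module.End.mul_apply, LinearMap.mulLeft_apply]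
          rw [mul_left_comm, h, h, mul_zero, sub_zero]) (hk a)) f
      simpa [sub_eq_zero] using this
    ext1 f
    have := h f
    rw [h1] at this
    simpa using (mul_eq_zero.mp this).resolve_left hs

end Order

/-! ### Infinitesimal invariance -/

section Infinitesimal

variable {ι : Type*}

lemma update_mem_diffOp {n : ℕ} {B : MultiOp ι n} (hB : B ∈ polyDiffOp ι n) (f : Fin n → Fn ι)
    (k : Fin n) : ∃ D ∈ diffOp ι, ∀ h, B (Function.update f k h) = D h := by
  induction hB using Submodule.span_induction with
  | mem B hB =>
    obtain ⟨a, D, hD, rfl⟩ := hB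
    refine ⟨LinearMap.mulLeft ℂ (a * ∏ l ∈ Finset.univ.erase k, D l (f l)) * D k,
      mul_mem (mulLeft_mem _) (hD k), fun h => ?_⟩
    rw [prodOp_apply, ← Finset.mul_prod_erase Finset.univ _ (Finset.mem_univ k)]
    rw [Finset.prod_congr rfl fun l hl => by
      rw [Function.update_of_ne (Finset.ne_of_mem_erase hl)]]
    simp only [Module.End.mul_apply, LinearMap.mulLeft_apply, Function.update_self]
    ring
  | zero => exact ⟨0, zero_mem _, by simp⟩
  | add x y _ _ hx hy =>
    obtain ⟨D, hD, h1⟩ := hx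
    obtain ⟨E, hE, h2⟩ := hy
    exact ⟨D + E, add_mem hD hE, fun h => by simp [h1, h2]⟩
  | smul c x _ hx =>
    obtain ⟨D, hD, h1⟩ := hx
    exact ⟨c • D, Subalgebra.smul_mem _ hD c, fun h => by simp [h1]⟩

variable [Fintype ι] {P : Matrix ι ι ℂ}

/-- `B` commutes with all Hamiltonian vector fields. -/
def IsHamInvariant (P : Matrix ι ι ℂ) {n : ℕ} (B : MultiOp ι n) : Prop :=
  ∀ (h : Fn ι) (f : Fin n → Fn ι),
    ham P h (B f) = ∑ k, B (Function.update f k (ham P h (f k)))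

/-- Operators commuting with the formal symplectic automorphisms commute with the Hamiltonian
vector fields. For Hamiltonians of degree at least three one differentiates
`exp (t {h, ·})`; the general case follows since the condition is a differential equation in the
Hamiltonian. -/
lemma isHamInvariant_of_mem_Inv [Nonempty ι] (hP : P.transpose = -P) {n : ℕ} {B : MultiOp ι n}
    (hB : B ∈ Inv P n) : IsHamInvariant P B := by
  have h3 : ∀ h ∈ jetIdeal ι 3, ∀ f : Fin n → Fn ι,
      ham P h (B f) = ∑ k, B (Function.update f k (ham P h (f k))) := by
    intro h hh f
    have hA := raisesDegree_ham P hh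
    have e1 := hasCoeffDeriv_expOp hA (B f)
    have e2 := HasCoeffDeriv.polyDiffOp hB.1 fun k => hasCoeffDeriv_expOp hA (f k)
    have e3 : (fun t => B fun k => expOp (ham P h) t (f k)) = fun t => expOp (ham P h) t (B f) :=
      funext fun t => hB.2 _ (isSymplectic_expHam hP hh t) f
    rw [e3] at e2
    simpa [expOp_zero] using e1.unique e2
  intro h f
  have key : ∃ D ∈ diffOp ι, ∀ h, D h =
      ham P h (B f) - ∑ k, B (Function.update f k (ham P h (f k))) := by
    choose E hE hE' using fun k => update_mem_diffOp hB.1 f k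
    refine ⟨-ham P (B f) + ∑ k, E k * ham P (f k), add_mem (neg_mem (ham_mem P _))
      (sum_mem fun k _ => mul_mem (hE k) (ham_mem P _)), fun h => ?_⟩
    simp only [LinearMap.add_apply, LinearMap.neg_apply, LinearMap.sum_apply,
      Module.End.mul_apply, hE', ham_swap hP h, map_neg, Finset.sum_neg_distrib, sub_neg_eq_add]
  obtain ⟨D, hD, hD'⟩ := key
  obtain ⟨i⟩ := ‹Nonempty ι›
  have hX : (X i : Fn ι) ^ 3 ∈ jetIdeal ι 3 := by
    have := mul_mem_jetIdeal (mul_mem_jetIdeal (X_mem_jetIdeal i) (X_mem_jetIdeal i))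
      (X_mem_jetIdeal i)
    rwa [pow_succ, sq]
  have hX0 : (X i : Fn ι) ^ 3 ≠ 0 := by
    refine pow_ne_zero 3 fun h0 => ?_
    have := congrArg (coeff (Finsupp.single i 1)) h0
    simp [coeff_index_single_self_X] at this
  have := diffOp_eq_zero_of_mul hD hX0 fun u => by
    rw [hD', h3 _ (Ideal.mul_mem_right u _ hX), sub_self]
  rw [this] at hD'
  exact sub_eq_zero.mp (hD' h).symm

end Infinitesimal

/-! ### Differential operators stabilized by the flows preserving a linear function -/

section Classification

variable {ι : Type*}

lemma exists_pd_eq (i : ι) (u : Fn ι) : ∃ h, pd i h = u := by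
  let h : Fn ι := fun m => coeff (m - Finsupp.single i 1) u * ((m i : ℂ))⁻¹
  have hc : ∀ m, coeff m h = coeff (m - Finsupp.single i 1) u * ((m i : ℂ))⁻¹ := fun _ => rfl
  refine ⟨h, ?_⟩
  ext m
  have : ((m i : ℂ) + 1) ≠ 0 := by exact_mod_cast Nat.succ_ne_zero (m i)
  rw [coeff_pd, hc, add_tsub_cancel_right]
  simp [this]

/-- The Euler vector field. -/
def euler [Fintype ι] : Module.End ℂ (Fn ι) := ∑ i, LinearMap.mulLeft ℂ (X i) * pd i

lemma euler_apply [Fintype ι] (f : Fn ι) : euler f = ∑ i, X i * pd i f := by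
  simp [euler, LinearMap.sum_apply]

lemma coeff_euler [Fintype ι] (f : Fn ι) (m : ι →₀ ℕ) :
    coeff m (euler f) = (m.degree : ℂ) * coeff m f := by
  classical
  have h : ∀ i, coeff m (X i * pd i f) = (m i : ℂ) * coeff m f := by
    intro i
    rw [X, coeff_monomial_mul]
    split_ifs with hi
    · rw [one_mul, coeff_pd, tsub_add_cancel_of_le hi, Finsupp.tsub_apply,
        Finsupp.single_eq_same]
      have : 1 ≤ m i := by simpa using hi
      push_cast [Nat.cast_sub this]
      ring
    · have : m i = 0 := by simpa using hi
      rw [this, Nat.cast_zero, zero_mul]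
  rw [euler_apply, map_sum, Finset.sum_congr rfl fun i _ => h i, ← Finset.sum_mul,
    Finsupp.degree_eq_sum]
  push_cast
  rfl

lemma pd_one (i : ι) : pd i (1 : Fn ι) = 0 := by
  simp [pd]

lemma pd_X_self (i : ι) : pd i (X i : Fn ι) = 1 := pderiv_X_self

lemma pd_X_of_ne {i j : ι} (h : i ≠ j) : pd i (X j : Fn ι) = 0 := pderiv_X_of_ne h.symm

lemma ham_one [Fintype ι] (P : Matrix ι ι ℂ) (h : Fn ι) : ham P h 1 = 0 := by
  simp [ham_apply, bracket, pd_one]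

/-- A function all of whose partial derivatives vanish is constant. -/
lemma eq_smul_one_of_pd [Fintype ι] {f : Fn ι} (h : ∀ i, pd i f = 0) :
    f = coeff 0 f • (1 : Fn ι) := by
  classical
  ext m
  have h1 := coeff_euler f m
  rw [euler_apply, Finset.sum_eq_zero fun i _ => by rw [h i, mul_zero], map_zero] at h1
  rw [map_smul, coeff_one]
  split_ifs with hm
  · simp [hm]
  · have : (m.degree : ℂ) ≠ 0 := by
      rw [Nat.cast_ne_zero]; simpa [Finsupp.degree_eq_zero_iff] using hm
    simpa [this] using h1.symm

/-- A differential operator that vanishes on polynomials is zero. -/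
lemma diffOp_eq_zero_of_polynomial [Fintype ι] {D : Module.End ℂ (Fn ι)} (hD : D ∈ diffOp ι)
    (h : ∀ p : MvPolynomial ι ℂ, D (p : Fn ι) = 0) : D = 0 := by
  classical
  ext1 f
  refine eq_of_sub_mem_jetIdeal fun N => ?_
  obtain ⟨M, hM⟩ := exists_jetIdeal_of_diffOp hD N
  have h1 : f - (truncTotal M f : MvPolynomial ι ℂ) ∈
      jetIdeal ι M := by
    intro m hm
    rw [map_sub, MvPolynomial.coeff_coe, coeff_truncTotal f hm, sub_self]
  have h2 := hM _ h1
  rw [map_sub, h, sub_zero] at h2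
  simpa using h2

lemma diffOp_eq_mulLeft [Fintype ι] {D : Module.End ℂ (Fn ι)} (hD : D ∈ diffOp ι)
    (h : ∀ j f, D (X j * f) = X j * D f) : D = LinearMap.mulLeft ℂ (D 1) := by
  rw [← sub_eq_zero]
  refine diffOp_eq_zero_of_polynomial (sub_mem hD (mulLeft_mem _)) fun p => ?_
  induction p using MvPolynomial.induction_on with
  | C c =>
    rw [MvPolynomial.coe_C, ← mul_one (C c), ← smul_eq_C_mul, map_smul]
    simp
  | add p q hp hq => rw [MvPolynomial.coe_add, map_add, hp, hq, add_zero]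
  | mul_X p j hp =>
    rw [MvPolynomial.coe_mul, MvPolynomial.coe_X, mul_comm]
    rw [LinearMap.sub_apply, LinearMap.mulLeft_apply] at hp ⊢
    rw [h, mul_left_comm, ← mul_sub, hp, mul_zero]

lemma pd_pow_mul {i : ι} {z : Fn ι} (hz : pd i z = 0) (b : ℕ) (f : Fn ι) :
    (pd i ^ b) (z * f) = z * (pd i ^ b) f := by
  induction b with
  | zero => rfl
  | succ b ih =>
    rw [pow_succ', Module.End.mul_apply, Module.End.mul_apply, ih, pd_mul, hz, zero_mul, zero_add]

lemma pd_pow_X_mul (i : ι) (b : ℕ) (f : Fn ι) :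
    (pd i ^ (b + 1)) (X i * f) = X i * (pd i ^ (b + 1)) f + ((b : ℂ) + 1) • (pd i ^ b) f := by
  induction b with
  | zero => simp [pd_mul, pd_X_self]; ring
  | succ b ih =>
    rw [pow_succ', Module.End.mul_apply, ih, map_add, pd_mul, pd_X_self, map_smul,
      Module.End.mul_apply, one_mul, ← Module.End.mul_apply (pd i) (pd i ^ b),
      ← pow_succ' (pd i) b]
    push_cast
    module

variable [Fintype ι] [DecidableEq ι] {P : Matrix ι ι ℂ}

/-- The linear function `q` with `{q, ·} = ∂_i`. -/
def dualCoord (P : Matrix ι ι ℂ) (i : ι) : Fn ι := ∑ j, P⁻¹ i j • X j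

lemma pd_eq_sum_ham (hP' : IsUnit P.det) (i : ι) (f : Fn ι) :
    pd i f = ∑ j, P⁻¹ i j • ham P (X j) f := by
  simp only [ham_apply]; exact bracket_eq_pd hP' i f

lemma ham_dualCoord (hP' : IsUnit P.det) (i : ι) : ham P (dualCoord P i) = pd i := by
  ext1 f
  rw [pd_eq_sum_ham hP', dualCoord, ← bracketₗ_apply, map_sum, LinearMap.sum_apply]
  refine Finset.sum_congr rfl fun j _ => ?_
  rw [map_smul, LinearMap.smul_apply, bracketₗ_apply]

lemma pd_dualCoord_self (hP : P.transpose = -P) (hP' : IsUnit P.det) (i : ι) :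
    pd i (dualCoord P i) = 0 := by
  rw [← ham_dualCoord hP', ham_self hP]

lemma ham_X_dualCoord (hP : P.transpose = -P) (hP' : IsUnit P.det) (i : ι) :
    ham P (X i) (dualCoord P i) = -1 := by
  rw [ham_swap hP, ham_dualCoord hP', pd_X_self]

lemma dualCoord_ne_zero (hP : P.transpose = -P) (hP' : IsUnit P.det) (i : ι) :
    dualCoord P i ≠ 0 := fun h0 => by
  have := ham_X_dualCoord hP hP' i
  rw [h0, map_zero] at this
  exact one_ne_zero (neg_eq_zero.mp this.symm)

lemma inv_antisymm (hP : P.transpose = -P) (i j : ι) (hP' : IsUnit P.det) :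
    P⁻¹ i j = -P⁻¹ j i := by
  have h : (P⁻¹).transpose = -P⁻¹ := by
    rw [Matrix.transpose_nonsing_inv, hP]
    refine Matrix.inv_eq_left_inv ?_
    rw [neg_mul_neg, Matrix.nonsing_inv_mul _ hP']
  have := congrFun (congrFun h j) i
  simpa only [Matrix.transpose_apply, Matrix.neg_apply] using this

/-- The functions `z` that Poisson commute with `q = dualCoord P i` are those with `∂_i z = 0`;
they are stable under `{·, x_i}`. -/
lemma pd_ham_X (hP : P.transpose = -P) (hP' : IsUnit P.det) {i : ι} {z : Fn ι}
    (hz : pd i z = 0) : pd i (ham P z (X i)) = 0 := by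
  have h := ham_jacobi hP (dualCoord P i) z (X i)
  rw [ham_dualCoord hP', hz, pd_X_self, ham_one, ← bracketₗ_apply P 0, map_zero,
    LinearMap.zero_apply, zero_add] at h
  exact h

/-- The weight relation for functions: `k` is the degree of homogeneity in `q`. -/
lemma ham_mul_X (hP : P.transpose = -P) (hP' : IsUnit P.det) (i : ι) (f : Fn ι) :
    ham P (dualCoord P i * X i) f = dualCoord P i * ham P (X i) f + X i * pd i f := by
  rw [ham_mul_left hP, ham_dualCoord hP']

lemma pd_eq_of_commute (hP : P.transpose = -P) (hP' : IsUnit P.det) {i : ι} {a : Fn ι}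
    (ha : ∀ z, pd i z = 0 → ham P z a = 0) (j : ι) :
    pd j a = -P⁻¹ i j • ham P (X i) a := by
  rw [pd_eq_sum_ham hP', Finset.sum_eq_single i, inv_antisymm hP j i hP']
  · intro l _ hl
    rw [ha _ (pd_X_of_ne hl.symm), smul_zero]
  · simp

lemma eq_zero_of_neg_weight (hP : P.transpose = -P) (hP' : IsUnit P.det) {i : ι} {a : Fn ι}
    (ha : ∀ z, pd i z = 0 → ham P z a = 0) {k : ℤ} (hk : k < 0)
    (hw : dualCoord P i * ham P (X i) a = -(k : ℂ) • a) : a = 0 := by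
  ext m
  have h1 := coeff_euler a m
  have h2 : euler a = (k : ℂ) • a := by
    rw [euler_apply, ← neg_neg ((k : ℂ) • a), ← neg_smul, ← hw, dualCoord, Finset.sum_mul,
      ← Finset.sum_neg_distrib]
    refine Finset.sum_congr rfl fun j _ => ?_
    rw [pd_eq_of_commute hP hP' ha, neg_smul, mul_neg, mul_smul_comm, smul_mul_assoc]
  rw [h2, map_smul, smul_eq_mul] at h1
  have h3 : ((k : ℂ) - m.degree) * coeff m a = 0 := by rw [sub_mul, h1, sub_self]
  refine (mul_eq_zero.mp h3).resolve_left ?_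
  refine sub_ne_zero.mpr ?_
  have : k ≠ (m.degree : ℤ) := by omega
  exact_mod_cast this

lemma eq_pow_of_weight (hP : P.transpose = -P) (hP' : IsUnit P.det) {i : ι} (k : ℕ) :
    ∀ {a : Fn ι}, (∀ z, pd i z = 0 → ham P z a = 0) →
    dualCoord P i * ham P (X i) a = -(k : ℂ) • a → ∃ c : ℂ, a = c • dualCoord P i ^ k := by
  have hq0 := dualCoord_ne_zero hP hP' i
  induction k with
  | zero =>
    intro a ha hw
    rw [Nat.cast_zero, neg_zero, zero_smul] at hw
    have h0 := (mul_eq_zero.mp hw).resolve_left hq0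
    refine ⟨coeff 0 a, ?_⟩
    rw [pow_zero]
    exact eq_smul_one_of_pd fun j => by rw [pd_eq_of_commute hP hP' ha, h0, smul_zero]
  | succ k ih =>
    intro a ha hw
    obtain ⟨c, hc⟩ := ih (a := ham P (X i) a) (fun z hz => by
        rw [ham_jacobi hP, ha _ (pd_ham_X hP hP' hz), ha z hz, map_zero, zero_add]) (by
      have h1 := congrArg (ham P (X i)) hw
      rw [ham_mul, ham_X_dualCoord hP hP', map_smul] at h1
      rw [show -(k : ℂ) • ham P (X i) a = -((k + 1 : ℕ) : ℂ) • ham P (X i) a + ham P (X i) a by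
        push_cast; rw [neg_add, add_smul]; simp, ← h1]
      ring)
    rw [hc, mul_smul_comm, ← pow_succ'] at hw
    have hk : (-((k + 1 : ℕ) : ℂ)) ≠ 0 := neg_ne_zero.mpr (by exact_mod_cast Nat.succ_ne_zero k)
    refine ⟨(-((k + 1 : ℕ) : ℂ))⁻¹ * c, ?_⟩
    rw [mul_smul, hw, smul_smul, inv_mul_cancel₀ hk, one_smul]

/-- `D` is a differential operator that commutes with the Hamiltonian vector fields of all
functions Poisson commuting with `q = dualCoord P i`, and has weight `k` under the flow that
rescales `q` and `x_i`. -/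
structure IsStabilized (P : Matrix ι ι ℂ) (i : ι) (k : ℤ) (D : Module.End ℂ (Fn ι)) : Prop where
  mem : D ∈ diffOp ι
  comm : ∀ z, pd i z = 0 → ∀ f, ham P z (D f) = D (ham P z f)
  weight : ∀ f, ham P (dualCoord P i * X i) (D f) =
    D (ham P (dualCoord P i * X i) f) - (k : ℂ) • D f

section Stabilized

variable {i : ι} {k : ℤ} {D : Module.End ℂ (Fn ι)}

/-- Commuting with the Hamiltonian vector fields of both `z` and `q z` forces commuting with the
multiplication by `z`. -/
lemma IsStabilized.map_mul (hP : P.transpose = -P) (hP' : IsUnit P.det)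
    (h : IsStabilized P i k D) {z : Fn ι} (hz : pd i z = 0) (u : Fn ι) : D (z * u) = z * D u := by
  have hq := pd_dualCoord_self hP hP' i
  have key : ∀ z, pd i z = 0 → ∀ f, dualCoord P i * D (ham P z f) + z * D (pd i f) =
      D (dualCoord P i * ham P z f) + D (z * pd i f) := by
    intro z hz f
    have h1 := h.comm (z * dualCoord P i) (by rw [pd_mul, hz, hq, zero_mul, mul_zero, add_zero]) f
    have h2 := h.comm _ hq f
    rw [ham_dualCoord hP'] at h2
    rw [ham_mul_left hP, ham_mul_left hP, ham_dualCoord hP', h2, h.comm z hz, map_add] at h1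
    rw [add_comm, h1, add_comm]
  have h1 : ∀ u, dualCoord P i * D u = D (dualCoord P i * u) := by
    intro u
    obtain ⟨f, rfl⟩ := exists_pd_eq i u
    have := key _ hq f
    rw [ham_dualCoord hP', ← two_smul ℂ, ← two_smul ℂ] at this
    exact smul_right_injective _ (two_ne_zero (α := ℂ)) this
  obtain ⟨f, rfl⟩ := exists_pd_eq i u
  have := key z hz f
  rw [h1] at this
  exact (add_left_cancel this).symm

lemma IsStabilized.commutator (hP : P.transpose = -P) (hP' : IsUnit P.det)
    (h : IsStabilized P i k D) : IsStabilized P i (k - 1)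
      (D * LinearMap.mulLeft ℂ (X i) - LinearMap.mulLeft ℂ (X i) * D) where
  mem := sub_mem (mul_mem h.mem (mulLeft_mem _)) (mul_mem (mulLeft_mem _) h.mem)
  comm z hz f := by
    simp only [LinearMap.sub_apply, Module.End.mul_apply, LinearMap.mulLeft_apply, map_sub]
    rw [h.comm z hz, ham_mul, ham_mul, h.comm z hz, map_add,
      h.map_mul hP hP' (pd_ham_X hP hP' hz)]
    ring
  weight f := by
    simp only [LinearMap.sub_apply, Module.End.mul_apply, LinearMap.mulLeft_apply, map_sub]
    have h1 : ham P (dualCoord P i * X i) (X i) = X i := by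
      rw [ham_mul_X hP hP', ham_self hP, pd_X_self, mul_zero, mul_one, zero_add]
    rw [h.weight, ham_mul, ham_mul, h.weight, map_add, h1]
    push_cast
    simp only [sub_smul, one_smul, smul_sub, mul_sub, mul_smul_comm]
    ring

lemma IsStabilized.one_commute (h : IsStabilized P i k D) {z : Fn ι} (hz : pd i z = 0) :
    ham P z (D 1) = 0 := by
  rw [h.comm z hz, ham_one, map_zero]

lemma IsStabilized.one_weight (hP : P.transpose = -P) (hP' : IsUnit P.det)
    (h : IsStabilized P i k D) :
    dualCoord P i * ham P (X i) (D 1) = -(k : ℂ) • D 1 := by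
  have h1 := h.weight 1
  have h2 : pd i (D 1) = 0 := by
    rw [← ham_dualCoord hP']; exact h.one_commute (pd_dualCoord_self hP hP' i)
  rw [ham_one, map_zero, ham_mul_X hP hP', h2, mul_zero, add_zero, zero_sub] at h1
  rw [h1, neg_smul]

lemma IsStabilized.eq_zero_of_neg (hP : P.transpose = -P) (hP' : IsUnit P.det)
    (h : IsStabilized P i k D) (hk : k < 0) : D = 0 := by
  refine diffOp_eq_zero_of_polynomial h.mem fun p => ?_
  induction p using MvPolynomial.induction_on generalizing k D with
  | C c =>
    have h1 := eq_zero_of_neg_weight hP hP' (fun z hz => h.one_commute hz) hk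
      (h.one_weight hP hP')
    rw [MvPolynomial.coe_C, ← mul_one (C c), ← smul_eq_C_mul, map_smul, h1, smul_zero]
  | add p q hp hq => rw [MvPolynomial.coe_add, map_add, hp h hk, hq h hk, add_zero]
  | mul_X p j hp =>
    rw [MvPolynomial.coe_mul, MvPolynomial.coe_X, mul_comm]
    by_cases hj : j = i
    · subst hj
      have h1 := hp (h.commutator hP hP') (by omega)
      simp only [LinearMap.sub_apply, Module.End.mul_apply, LinearMap.mulLeft_apply, hp h hk,
        mul_zero, sub_zero] at h1
      exact h1
    · rw [h.map_mul hP hP' (pd_X_of_ne (Ne.symm hj)), hp h hk, mul_zero]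

end Stabilized

/-- The operators stabilized by the flows preserving `q`, of weight `k`, are the combinations of
`q^{k-b} ∂_i^b = q^{k-b} {q, ·}^b`. -/
theorem IsStabilized.exists_eq_sum (hP : P.transpose = -P) (hP' : IsUnit P.det) {i : ι} (k : ℕ) :
    ∀ {D : Module.End ℂ (Fn ι)}, IsStabilized P i k D →
    ∃ c : ℕ → ℂ, D = ∑ b ∈ Finset.range (k + 1),
      c b • (LinearMap.mulLeft ℂ (dualCoord P i ^ (k - b)) * pd i ^ b) := by
  have aux : ∀ (k : ℕ) (c : ℕ → ℂ) {D : Module.End ℂ (Fn ι)}, IsStabilized P i k D →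
      (∀ f, D (X i * f) - X i * D f = ∑ b ∈ Finset.range k,
        c b • (dualCoord P i ^ (k - 1 - b) * (pd i ^ b) f)) →
      ∃ c : ℕ → ℂ, D = ∑ b ∈ Finset.range (k + 1),
        c b • (LinearMap.mulLeft ℂ (dualCoord P i ^ (k - b)) * pd i ^ b) := by
    intro k c D h hc
    obtain ⟨c0, hc0⟩ := eq_pow_of_weight hP hP' k (fun z hz => h.one_commute hz)
      (by simpa using h.one_weight hP hP')
    set D' : Module.End ℂ (Fn ι) := ∑ b ∈ Finset.range k, (c b / ((b : ℂ) + 1)) •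
      (LinearMap.mulLeft ℂ (dualCoord P i ^ (k - (b + 1))) * pd i ^ (b + 1)) with hD'
    have hD'a : ∀ f, D' f = ∑ b ∈ Finset.range k, (c b / ((b : ℂ) + 1)) •
      (dualCoord P i ^ (k - (b + 1)) * (pd i ^ (b + 1)) f) := fun f => by
        simp [hD', LinearMap.sum_apply]
    have h0 : D' 1 = 0 := by
      rw [hD'a]
      refine Finset.sum_eq_zero fun b _ => ?_
      rw [pow_succ, Module.End.mul_apply, pd_one, map_zero, mul_zero, smul_zero]
    have hmem : D - D' ∈ diffOp ι := sub_mem h.mem <| sum_mem fun b _ =>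
      Subalgebra.smul_mem _ (mul_mem (mulLeft_mem _) (pow_mem (pd_mem i) _)) _
    have h1 := diffOp_eq_mulLeft hmem (fun j f => by
      simp only [LinearMap.sub_apply]
      by_cases hj : j = i
      · subst hj
        have h2 : D' (X j * f) = X j * D' f + (D (X j * f) - X j * D f) := by
          rw [hc, hD'a, hD'a, Finset.mul_sum, ← Finset.sum_add_distrib]
          refine Finset.sum_congr rfl fun b _ => ?_
          have hb : ((b : ℂ) + 1) ≠ 0 := by exact_mod_cast Nat.succ_ne_zero b
          rw [pd_pow_X_mul, mul_add, smul_add, mul_smul_comm, smul_smul, div_mul_cancel₀ _ hb,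
            mul_smul_comm, mul_left_comm, Nat.sub_sub, add_comm 1 b]
        rw [h2]; ring
      · have hz : pd i (X j : Fn ι) = 0 := pd_X_of_ne (Ne.symm hj)
        rw [h.map_mul hP hP' hz, mul_sub, hD'a, hD'a, Finset.mul_sum]
        congr 1
        refine Finset.sum_congr rfl fun b _ => ?_
        rw [pd_pow_mul hz, mul_smul_comm, mul_left_comm])
    rw [LinearMap.sub_apply, h0, sub_zero, hc0, sub_eq_iff_eq_add] at h1
    refine ⟨fun b => if b = 0 then c0 else c (b - 1) / (((b - 1 : ℕ) : ℂ) + 1), ?_⟩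
    rw [Finset.sum_range_succ']
    simp only [Nat.succ_ne_zero, if_false, Nat.add_sub_cancel, if_true, pow_zero, mul_one,
      Nat.sub_zero]
    rw [h1, hD', add_comm]
    congr 1
    ext1 f
    simp
  induction k with
  | zero =>
    intro D h
    refine aux 0 0 h fun f => ?_
    have := LinearMap.congr_fun ((h.commutator hP hP').eq_zero_of_neg hP hP' (by simp)) f
    simpa using this
  | succ k ih =>
    intro D h
    have h1 := h.commutator hP hP'
    rw [show ((k + 1 : ℕ) : ℤ) - 1 = (k : ℕ) by push_cast; ring] at h1
    obtain ⟨c, hc⟩ := ih h1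
    refine aux (k + 1) c h fun f => ?_
    have := LinearMap.congr_fun hc f
    simpa [LinearMap.sum_apply] using this

end Classification

/-! ### Symmetric invariant operators are determined by their values on a linear function -/

section LastSlot

variable {ι : Type*} [Fintype ι] [DecidableEq ι] {P : Matrix ι ι ℂ}

/-- An invariant operator that is symmetric in the slots of `J` vanishes as soon as it vanishes
whenever all these slots are filled with the linear function `q`. One replaces the functions `q`
by arbitrary ones, slot after slot: every function has the form `{h, q}`, and in the invariance
under `{h, ·}` all the remaining slots of `J` contribute equally. -/
lemma IsHamInvariant.eq_zero (hP : P.transpose = -P) (hP' : IsUnit P.det) (i₀ : ι) {n : ℕ}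
    {B : MultiOp ι n} (hB : IsHamInvariant P B) (J : Finset (Fin n))
    (hsym : ∀ i ∈ J, ∀ j ∈ J, B.domDomCongr (Equiv.swap i j) = B)
    (hv : ∀ f : Fin n → Fn ι, (∀ j ∈ J, f j = dualCoord P i₀) → B f = 0) : B = 0 := by
  have key : ∀ I : Finset (Fin n), I ⊆ J → ∀ f : Fin n → Fn ι,
      (∀ j ∈ J \ I, f j = dualCoord P i₀) → B f = 0 := by
    intro I
    induction I using Finset.induction_on with
    | empty => exact fun _ f hf => hv f fun j hj => hf j (by simpa using hj)
    | insert i I hi ih =>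
      intro hI f hf
      have hIJ : I ⊆ J := fun j hj => hI (Finset.mem_insert_of_mem hj)
      have hiJ : i ∈ J := hI (Finset.mem_insert_self i I)
      obtain ⟨h, hh⟩ := exists_pd_eq i₀ (-f i)
      have hq : ham P h (dualCoord P i₀) = f i := by
        rw [ham_swap hP, ham_dualCoord hP', hh, neg_neg]
      set f' := Function.update f i (dualCoord P i₀) with hf'
      have hf'q : ∀ j ∈ J \ I, f' j = dualCoord P i₀ := by
        intro j hj
        by_cases hji : j = i
        · subst hji; simp [hf']
        · rw [hf', Function.update_of_ne hji]
          refine hf j ?_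
          simp only [Finset.mem_sdiff, Finset.mem_insert] at hj ⊢
          tauto
      have h1 := hB h f'
      rw [ih hIJ f' hf'q, map_zero, ← Finset.sum_subset (Finset.subset_univ (J \ I))] at h1
      · rw [Finset.sum_congr rfl (g := fun _ => B f), Finset.sum_const,
          ← Nat.cast_smul_eq_nsmul ℂ] at h1
        · refine (smul_eq_zero.mp h1.symm).resolve_left ?_
          refine Nat.cast_ne_zero.mpr (Finset.card_pos.mpr ⟨i, ?_⟩).ne'
          simp [hiJ, hi]
        · intro l hl
          rw [hf'q l hl, hq]
          conv_rhs => rw [← hsym i hiJ l (Finset.mem_sdiff.mp hl).1]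
          rw [MultilinearMap.domDomCongr_apply]
          congr 1
          funext k
          by_cases hkl : k = l
          · subst hkl; simp
          · rw [Function.update_of_ne hkl]
            by_cases hki : k = i
            · subst hki
              rw [Equiv.swap_apply_left, hf', Function.update_self, hf l]
              simp only [Finset.mem_sdiff, Finset.mem_insert] at hl ⊢
              exact ⟨hl.1, by rintro (h | h); exacts [hkl h.symm, hl.2 h]⟩
            · rw [Equiv.swap_apply_of_ne_of_ne hki hkl, hf', Function.update_of_ne hki]
      · intro l _ hl
        refine ih hIJ _ fun j hj => ?_
        have : j ≠ l := by rintro rfl; exact hl hj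
        rw [Function.update_of_ne this, hf'q j hj]
  ext1 f
  exact key J (Finset.Subset.refl J) f (by simp)

/-- The differential operator `h ↦ B(q, …, q, h)`. -/
def lastSlot (P : Matrix ι ι ℂ) (i₀ : ι) {m : ℕ} (B : MultiOp ι (m + 1)) : Module.End ℂ (Fn ι) :=
  B.toLinearMap (fun _ => dualCoord P i₀) (Fin.last m)

lemma lastSlot_apply (P : Matrix ι ι ℂ) (i₀ : ι) {m : ℕ} (B : MultiOp ι (m + 1)) (h : Fn ι) :
    lastSlot P i₀ B h = B (Function.update (fun _ => dualCoord P i₀) (Fin.last m) h) := rfl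

lemma lastSlot_ham {i₀ : ι} {m : ℕ} {B : MultiOp ι (m + 1)} (hB : IsHamInvariant P B) {h : Fn ι}
    {c : ℂ} (hc : ham P h (dualCoord P i₀) = c • dualCoord P i₀) (f : Fn ι) :
    ham P h (lastSlot P i₀ B f) =
      lastSlot P i₀ B (ham P h f) + ((m : ℂ) * c) • lastSlot P i₀ B f := by
  simp only [lastSlot_apply]
  rw [hB, Fin.sum_univ_castSucc, add_comm]
  congr 1
  · rw [Function.update_self, Function.update_idem]
  · rw [Finset.sum_congr rfl
      (g := fun _ => c • B (Function.update (fun _ => dualCoord P i₀) (Fin.last m) f))]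
    · rw [Finset.sum_const, Finset.card_univ, Fintype.card_fin, ← Nat.cast_smul_eq_nsmul ℂ,
        smul_smul]
    · intro k _
      have hk : k.castSucc ≠ Fin.last m := (Fin.castSucc_lt_last k).ne
      rw [Function.update_of_ne hk, hc, MultilinearMap.map_update_smul]
      congr 2
      rw [Function.update_eq_self_iff, Function.update_of_ne hk]

lemma ham_weight_dualCoord (hP : P.transpose = -P) (hP' : IsUnit P.det) (i₀ : ι) :
    ham P (dualCoord P i₀ * X i₀) (dualCoord P i₀) = (-1 : ℂ) • dualCoord P i₀ := by
  rw [ham_mul_X hP hP', ham_X_dualCoord hP hP', pd_dualCoord_self hP hP']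
  simp

lemma ham_dualCoord_of_pd (hP : P.transpose = -P) (hP' : IsUnit P.det) {i₀ : ι} {z : Fn ι}
    (hz : pd i₀ z = 0) : ham P z (dualCoord P i₀) = (0 : ℂ) • dualCoord P i₀ := by
  rw [ham_swap hP, ham_dualCoord hP', hz, neg_zero, zero_smul]

lemma isStabilized_lastSlot (hP : P.transpose = -P) (hP' : IsUnit P.det) (i₀ : ι) {m : ℕ}
    {B : MultiOp ι (m + 1)} (hB : B ∈ polyDiffOp ι (m + 1)) (hB' : IsHamInvariant P B) :
    IsStabilized P i₀ m (lastSlot P i₀ B) where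
  mem := by
    obtain ⟨D, hD, h⟩ := update_mem_diffOp hB (fun _ => dualCoord P i₀) (Fin.last m)
    rwa [show lastSlot P i₀ B = D from LinearMap.ext h]
  comm z hz f := by
    rw [lastSlot_ham hB' (ham_dualCoord_of_pd hP hP' hz), mul_zero, zero_smul, add_zero]
  weight f := by
    rw [lastSlot_ham hB' (ham_weight_dualCoord hP hP' i₀)]
    simp [sub_eq_add_neg]

/-- An invariant operator symmetric in all its arguments is a multiple of the product: its value
at `(q, …, q)` is invariant under the flows preserving `q` and homogeneous of weight `n`, hence a
multiple of `q ^ n`. -/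
lemma IsHamInvariant.eq_smul_mkPiAlgebra (hP : P.transpose = -P) (hP' : IsUnit P.det)
    (i₀ : ι) {n : ℕ} {B : MultiOp ι n} (hB : IsHamInvariant P B)
    (hsym : ∀ τ : Equiv.Perm (Fin n), B.domDomCongr τ = B) :
    ∃ c : ℂ, B = c • MultilinearMap.mkPiAlgebra ℂ (Fin n) (Fn ι) := by
  have ev : ∀ (h : Fn ι) (c : ℂ), ham P h (dualCoord P i₀) = c • dualCoord P i₀ →
      ham P h (B fun _ => dualCoord P i₀) = ((n : ℂ) * c) • B fun _ => dualCoord P i₀ := by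
    intro h c hc
    rw [hB, Finset.sum_congr rfl (g := fun _ => c • B fun _ => dualCoord P i₀)]
    · rw [Finset.sum_const, Finset.card_univ, Fintype.card_fin, ← Nat.cast_smul_eq_nsmul ℂ,
        smul_smul]
    · intro k _
      rw [hc, MultilinearMap.map_update_smul, Function.update_eq_self]
  have h1 : ∀ z, pd i₀ z = 0 → ham P z (B fun _ => dualCoord P i₀) = 0 := fun z hz => by
    rw [ev z 0 (ham_dualCoord_of_pd hP hP' hz), mul_zero, zero_smul]
  have h2 := ev _ _ (ham_weight_dualCoord hP hP' i₀)
  have h3 := h1 _ (pd_dualCoord_self hP hP' i₀)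
  rw [ham_dualCoord hP'] at h3
  rw [ham_mul_X hP hP', h3, mul_zero, add_zero, mul_neg_one] at h2
  obtain ⟨c, hc⟩ := eq_pow_of_weight hP hP' n h1 h2
  refine ⟨c, sub_eq_zero.mp ?_⟩
  refine IsHamInvariant.eq_zero hP hP' i₀ (fun h f => ?_) Finset.univ (fun i _ j _ => ?_)
    fun f hf => ?_
  · simp only [_root_.sub_apply, _root_.smul_apply, map_sub, hB h f, Finset.sum_sub_distrib,
      map_smul, ← Finset.smul_sum]
    congr 2
    simp only [MultilinearMap.mkPiAlgebra_apply]
    have : ∀ s : Finset (Fin n), ham P h (∏ k ∈ s, f k) =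
        ∑ k ∈ s, ∏ l ∈ s, Function.update f k (ham P h (f k)) l := by
      intro s
      induction s using Finset.induction_on with
      | empty => simp [ham_one]
      | insert k s hk ih =>
        rw [Finset.prod_insert hk, ham_mul, ih, Finset.sum_insert hk, Finset.mul_sum,
          Finset.prod_insert hk, Function.update_self]
        congr 1
        · congr 1
          refine Finset.prod_congr rfl fun l hl => ?_
          rw [Function.update_of_ne (by rintro rfl; exact hk hl)]
        · refine Finset.sum_congr rfl fun l hl => ?_
          rw [Finset.prod_insert hk, Function.update_of_ne (by rintro rfl; exact hk hl)]
    exact this Finset.univ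
  · ext1 f
    rw [MultilinearMap.domDomCongr_apply, _root_.sub_apply, _root_.sub_apply]
    congr 1
    · conv_rhs => rw [← hsym (Equiv.swap i j)]
      rfl
    · simp only [_root_.smul_apply, MultilinearMap.mkPiAlgebra_apply]
      rw [Equiv.prod_comp (Equiv.swap i j) f]
  · rw [show f = fun _ => dualCoord P i₀ from funext fun k => hf k (Finset.mem_univ k),
      _root_.sub_apply, hc]
    simp

end LastSlot

/-! ### The permutation action on invariant operators -/

section Action

variable {ι : Type*} [Fintype ι] [DecidableEq ι] {P : Matrix ι ι ℂ}

lemma isPermuted_invRepOfMatrix (hP : P.transpose = -P) (hP' : IsUnit P.det) {n : ℕ}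
    (σ : Equiv.Perm (Fin (n + 1))) (B : Inv P n) :
    IsPermuted σ B.1 (invRepOfMatrix P hP hP' n σ B).1 :=
  (exists_perm_Inv hP hP' σ B).choose_spec

/-- The permutations that fix `0` permute the arguments of the operator. -/
lemma invRepOfMatrix_of_fixed (hP : P.transpose = -P) (hP' : IsUnit P.det) {n : ℕ}
    {σ : Equiv.Perm (Fin (n + 1))} {τ : Equiv.Perm (Fin n)} (h0 : σ 0 = 0)
    (h1 : ∀ k, σ k.succ = (τ k).succ) (B : Inv P n) :
    (invRepOfMatrix P hP hP' n σ B).1 = B.1.domDomCongr τ := by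
  refine (isPermuted_invRepOfMatrix hP hP' _ B).unique ?_
  unfold IsPermuted
  convert zero_mem (totalDiv ι (n + 1)) using 1
  ext1 f
  change (f 0 * B.1 fun k => f (τ k).succ) - (f (σ 0) * B.1 fun k => f (σ k.succ)) = 0
  rw [h0, sub_eq_zero]
  congr 2
  funext k
  rw [h1]

lemma exists_perm_succ {n : ℕ} (τ : Equiv.Perm (Fin n)) :
    ∃ σ : Equiv.Perm (Fin (n + 1)), σ 0 = 0 ∧ ∀ k, σ k.succ = (τ k).succ :=
  ⟨Equiv.Perm.decomposeFin.symm (0, τ), Equiv.Perm.decomposeFin_symm_apply_zero 0 τ, fun k => by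
    rw [Equiv.Perm.decomposeFin_symm_apply_succ, Equiv.swap_self, Equiv.refl_apply]⟩

lemma exists_perm_of_fixed {n : ℕ} {σ : Equiv.Perm (Fin (n + 1))} (h : σ 0 = 0) :
    ∃ τ : Equiv.Perm (Fin n), ∀ k, σ k.succ = (τ k).succ := by
  obtain ⟨⟨p, τ⟩, rfl⟩ := Equiv.Perm.decomposeFin.symm.surjective σ
  rw [Equiv.Perm.decomposeFin_symm_apply_zero] at h
  subst h
  exact ⟨τ, fun k => by
    rw [Equiv.Perm.decomposeFin_symm_apply_succ, Equiv.swap_self, Equiv.refl_apply]⟩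

/-- The product `f₁ ⊗ ⋯ ⊗ fₙ ↦ f₁ ⋯ fₙ`, as an invariant operator. -/
def mulInv (P : Matrix ι ι ℂ) (n : ℕ) : Inv P n :=
  ⟨MultilinearMap.mkPiAlgebra ℂ (Fin n) (Fn ι),
    Submodule.subset_span ⟨1, fun _ => 1, fun _ => one_mem _, by ext1 f; simp [prodOp_apply]⟩,
    fun g _ f => by simp [map_prod]⟩

lemma mulInv_fixed (hP : P.transpose = -P) (hP' : IsUnit P.det) {n : ℕ}
    (σ : Equiv.Perm (Fin (n + 1))) :
    invRepOfMatrix P hP hP' n σ (mulInv P n) = mulInv P n := by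
  refine Subtype.ext ((isPermuted_invRepOfMatrix hP hP' σ _).unique ?_)
  unfold IsPermuted
  convert zero_mem (totalDiv ι (n + 1)) using 1
  ext1 f
  simp only [mulInv, density, _root_.sub_apply, outer_apply, Module.End.one_apply,
    MultilinearMap.domDomCongr_apply, MultilinearMap.mkPiAlgebra_apply, _root_.zero_apply]
  rw [← Fin.prod_univ_succ f, ← Fin.prod_univ_succ fun k => f (σ k), Equiv.prod_comp σ f, sub_self]

/-- The invariant operators fixed by the permutations that fix `0` are the multiples of the
product. -/
lemma exists_eq_smul_mulInv [Nonempty ι] (hP : P.transpose = -P) (hP' : IsUnit P.det) {n : ℕ}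
    {B : Inv P n} (h : ∀ σ : Equiv.Perm (Fin (n + 1)), σ 0 = 0 →
      invRepOfMatrix P hP hP' n σ B = B) : ∃ c : ℂ, B = c • mulInv P n := by
  obtain ⟨c, hc⟩ := (isHamInvariant_of_mem_Inv hP B.2).eq_smul_mkPiAlgebra hP hP'
    (Classical.arbitrary ι) fun τ => by
      obtain ⟨σ, h0, h1⟩ := exists_perm_succ τ
      rw [← invRepOfMatrix_of_fixed hP hP' h0 h1 B, h σ h0]
  exact ⟨c, Subtype.ext hc⟩

end Action

/-! ### Iterated brackets -/

section Iterated

variable {ι : Type*} [Fintype ι] {P : Matrix ι ι ℂ}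

/-- `f₀ ⊗ f₁ ⊗ ⋯ ⊗ fₙ ↦ {f₀, B(f₁, …, fₙ)}`. -/
def bracketOuter (P : Matrix ι ι ℂ) {n : ℕ} (B : MultiOp ι n) : MultiOp ι (n + 1) :=
  ∑ i, ∑ j, P i j • outer (pd i) ((pd j).compMultilinearMap B)

lemma bracketOuter_apply (P : Matrix ι ι ℂ) {n : ℕ} (B : MultiOp ι n)
    (f : Fin (n + 1) → Fn ι) :
    bracketOuter P B f = bracket P (f 0) (B fun k => f k.succ) := by
  simp [bracketOuter, bracket, _root_.sum_apply]

/-- The operator `f₁ ⊗ ⋯ ⊗ f_{m+1} ↦ f₁ ⋯ f_{m-b} {f_{m-b+1}, {…, {f_m, f_{m+1}}}}` with `b`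
brackets, for `b ≤ m`. -/
def iterBracket (P : Matrix ι ι ℂ) (b : ℕ) : (m : ℕ) → MultiOp ι (m + 1)
  | 0 => prodOp 1 fun _ => 1
  | m + 1 => if m < b then bracketOuter P (iterBracket P b m) else outer 1 (iterBracket P b m)

lemma iterBracket_zero (P : Matrix ι ι ℂ) (b : ℕ) : iterBracket P b 0 = prodOp 1 fun _ => 1 := rfl

lemma iterBracket_succ (P : Matrix ι ι ℂ) (b m : ℕ) : iterBracket P b (m + 1) =
    if m < b then bracketOuter P (iterBracket P b m) else outer 1 (iterBracket P b m) := rfl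

lemma iterBracket_mem_Inv (P : Matrix ι ι ℂ) (b m : ℕ) : iterBracket P b m ∈ Inv P (m + 1) := by
  induction m with
  | zero =>
    exact ⟨Submodule.subset_span ⟨1, fun _ => 1, fun _ => one_mem _, rfl⟩, fun g _ f => by
      simp [iterBracket_zero, prodOp_apply]⟩
  | succ m ih =>
    rw [iterBracket_succ]
    split_ifs with h
    · refine ⟨sum_mem fun i _ => sum_mem fun j _ => Submodule.smul_mem _ _
        (outer_mem (pd_mem i) (pd_mem_polyDiffOp j ih.1)), fun g hg f => ?_⟩
      rw [bracketOuter_apply, bracketOuter_apply, hg, ih.2 g hg]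
    · refine ⟨outer_mem (one_mem _) ih.1, fun g hg f => ?_⟩
      simp [ih.2 g hg]

lemma lastSlot_iterBracket [DecidableEq ι] (hP' : IsUnit P.det) (i₀ : ι) (b m : ℕ) :
    lastSlot P i₀ (iterBracket P b m) =
      LinearMap.mulLeft ℂ (dualCoord P i₀ ^ (m - b)) * pd i₀ ^ (min b m) := by
  induction m with
  | zero =>
    ext1 f
    simp [lastSlot_apply, iterBracket_zero, prodOp_apply]
  | succ m ih =>
    have h0 : ∀ f : Fn ι, Function.update (fun _ : Fin (m + 1 + 1) => dualCoord P i₀)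
        (Fin.last (m + 1)) f 0 = dualCoord P i₀ := fun f =>
      Function.update_of_ne (Fin.last_pos).ne _ _
    have h1 : ∀ f : Fn ι, (fun k : Fin (m + 1) => Function.update
        (fun _ : Fin (m + 1 + 1) => dualCoord P i₀) (Fin.last (m + 1)) f k.succ) =
        Function.update (fun _ => dualCoord P i₀) (Fin.last m) f := by
      intro f
      funext k
      by_cases hk : k = Fin.last m
      · subst hk; rw [Fin.succ_last, Function.update_self, Function.update_self]
      · rw [Function.update_of_ne hk, Function.update_of_ne]
        rwa [← Fin.succ_last, Ne, Fin.succ_inj]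
    ext1 f
    have ih' := LinearMap.congr_fun ih f
    rw [lastSlot_apply] at ih'
    rw [lastSlot_apply, iterBracket_succ]
    split_ifs with h
    · rw [bracketOuter_apply, h0, h1, ih', ← ham_apply, ham_dualCoord hP',
        min_eq_right (by omega), min_eq_right (by omega), Nat.sub_eq_zero_of_le (by omega),
        Nat.sub_eq_zero_of_le (by omega), pow_succ']
      simp
    · rw [outer_apply, h0, h1, ih', min_eq_left (by omega), min_eq_left (by omega),
        Nat.succ_sub (by omega), pow_succ']
      simp

end Iterated

/-! ### Homogeneity in the order -/

section Homogeneity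

variable {ι : Type*}

lemma partials_nil : partials ([] : List ι) = 1 := rfl

lemma partials_cons (i : ι) (w : List ι) : partials (i :: w) = pd i * partials w := rfl

lemma partials_mem (w : List ι) : partials w ∈ diffOp ι := by
  induction w with
  | nil => exact one_mem _
  | cons i w ih => exact mul_mem (pd_mem i) ih

lemma prodOp_partials_mem {n : ℕ} (w : Fin n → List ι) :
    prodOp 1 (fun k => partials (w k)) ∈ orderPart ι n (∑ k, (w k).length) :=
  Submodule.subset_span ⟨w, rfl, rfl⟩

lemma orderPart_le_polyDiffOp (n r : ℕ) : orderPart ι n r ≤ polyDiffOp ι n :=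
  Submodule.span_le.mpr fun _ ⟨_, _, hB⟩ =>
    Submodule.subset_span ⟨1, _, fun _ => partials_mem _, hB⟩

lemma pd_mem_orderPart {n r : ℕ} (i : ι) {B : MultiOp ι n} (hB : B ∈ orderPart ι n r) :
    (pd i).compMultilinearMap B ∈ orderPart ι n (r + 1) := by
  induction hB using Submodule.span_induction with
  | mem B hB =>
    obtain ⟨w, hw, rfl⟩ := hB
    have : (pd i).compMultilinearMap (prodOp 1 fun k => partials (w k)) =
        ∑ k, prodOp 1 (fun l => partials (Function.update w k (i :: w k) l)) := by
      ext1 f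
      simp only [LinearMap.compMultilinearMap_apply, prodOp_apply, one_mul, pd_prod,
        _root_.sum_apply]
      refine Finset.sum_congr rfl fun k _ => ?_
      rw [← Finset.mul_prod_erase Finset.univ _ (Finset.mem_univ k), Function.update_self,
        partials_cons, Module.End.mul_apply]
      congr 1
      refine Finset.prod_congr rfl fun l hl => ?_
      rw [Function.update_of_ne (Finset.ne_of_mem_erase hl)]
    rw [this]
    refine sum_mem fun k _ => ?_
    convert prodOp_partials_mem (Function.update w k (i :: w k)) using 2
    rw [← hw, ← Finset.add_sum_erase Finset.univ _ (Finset.mem_univ k),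
      ← Finset.add_sum_erase Finset.univ (fun l => (Function.update w k (i :: w k) l).length)
        (Finset.mem_univ k), Function.update_self, List.length_cons,
      Finset.sum_congr rfl (g := fun l => (Function.update w k (i :: w k) l).length) fun l hl => by
        rw [Function.update_of_ne (Finset.ne_of_mem_erase hl)]]
    ring
  | zero =>
    have : (pd i).compMultilinearMap (0 : MultiOp ι n) = 0 := by ext1 f; simp
    rw [this]; exact zero_mem _
  | add x y _ _ hx hy =>
    have : (pd i).compMultilinearMap (x + y) =
      (pd i).compMultilinearMap x + (pd i).compMultilinearMap y := by ext1 f; simp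
    rw [this]; exact add_mem hx hy
  | smul c x _ hx =>
    have : (pd i).compMultilinearMap (c • x) = c • (pd i).compMultilinearMap x := by
      ext1 f; simp
    rw [this]; exact Submodule.smul_mem _ c hx

lemma outer_partials_mem {n r : ℕ} (v : List ι) {B : MultiOp ι n} (hB : B ∈ orderPart ι n r) :
    outer (partials v) B ∈ orderPart ι (n + 1) (v.length + r) := by
  induction hB using Submodule.span_induction with
  | mem B hB =>
    obtain ⟨w, hw, rfl⟩ := hB
    have : outer (partials v) (prodOp 1 fun k => partials (w k)) =
        prodOp 1 fun k => partials ((Fin.cons v w : Fin (n + 1) → List ι) k) := by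
      ext1 f
      simp [prodOp_apply, Fin.prod_univ_succ]
    rw [this]
    convert prodOp_partials_mem (Fin.cons v w : Fin (n + 1) → List ι) using 2
    simp [Fin.sum_univ_succ, hw]
  | zero =>
    have : outer (partials v) (0 : MultiOp ι n) = 0 := by ext1 f; simp
    rw [this]; exact zero_mem _
  | add x y _ _ hx hy =>
    have : outer (partials v) (x + y) = outer (partials v) x + outer (partials v) y := by
      ext1 f; simp [mul_add]
    rw [this]; exact add_mem hx hy
  | smul c x _ hx =>
    have : outer (partials v) (c • x) = c • outer (partials v) x := by ext1 f; simp
    rw [this]; exact Submodule.smul_mem _ c hx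

lemma iterBracket_mem_orderPart [Fintype ι] (P : Matrix ι ι ℂ) (b m : ℕ) :
    iterBracket P b m ∈ orderPart ι (m + 1) (2 * min b m) := by
  induction m with
  | zero =>
    have := prodOp_partials_mem (fun _ : Fin 1 => ([] : List ι))
    simpa [iterBracket_zero, partials_nil] using this
  | succ m ih =>
    rw [iterBracket_succ]
    split_ifs with h
    · refine sum_mem fun i _ => sum_mem fun j _ => Submodule.smul_mem _ _ ?_
      have h1 := outer_partials_mem [i] (pd_mem_orderPart j ih)
      rw [partials_cons, partials_nil, mul_one] at h1
      convert h1 using 2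
      rw [min_eq_right (by omega), min_eq_right (by omega), List.length_singleton]
      ring
    · have h1 := outer_partials_mem [] ih
      rw [partials_nil] at h1
      convert h1 using 2
      rw [min_eq_left (by omega), min_eq_left (by omega), List.length_nil, zero_add]

/-- Integrating by parts does not change the order: every operator in `n + 1` arguments is, up to
total divergences, a density of the same order. -/
lemma exists_density_orderPart {n : ℕ} (v : List ι) : ∀ {s : ℕ} {B : MultiOp ι n},
    B ∈ orderPart ι n s → ∃ C ∈ orderPart ι n (s + v.length),
      density C - outer (partials v) B ∈ totalDiv ι (n + 1) := by
  induction v with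
  | nil =>
    intro s B hB
    refine ⟨B, by simpa using hB, ?_⟩
    rw [partials_nil, density, sub_self]
    exact zero_mem _
  | cons i v ih =>
    intro s B hB
    obtain ⟨C, hC, h⟩ := ih (pd_mem_orderPart i hB)
    refine ⟨-C, neg_mem ?_, ?_⟩
    · rwa [List.length_cons, add_comm v.length, ← add_assoc]
    · have h1 : (pd i).compMultilinearMap (outer (partials v) B) ∈ totalDiv ι (n + 1) :=
        Submodule.subset_span ⟨i, _, outer_mem (partials_mem v)
          (orderPart_le_polyDiffOp _ _ hB), rfl⟩
      convert neg_mem (add_mem h h1) using 1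
      ext1 f
      simp only [density, partials_cons, _root_.sub_apply, outer_apply, Module.End.one_apply,
        _root_.neg_apply, Module.End.mul_apply, _root_.add_apply,
        LinearMap.compMultilinearMap_apply, pd_mul]
      ring

lemma exists_isPermuted_orderPart {n r : ℕ} (σ : Equiv.Perm (Fin (n + 1))) {B : MultiOp ι n}
    (hB : B ∈ orderPart ι n r) : ∃ C ∈ orderPart ι n r, IsPermuted σ B C := by
  induction hB using Submodule.span_induction with
  | mem B hB =>
    obtain ⟨w, hw, rfl⟩ := hB
    set w' : Fin (n + 1) → List ι := Fin.cons [] w with hw'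
    obtain ⟨C, hC, h⟩ := exists_density_orderPart (w' (σ.symm 0))
      (prodOp_partials_mem fun k : Fin n => w' (σ.symm k.succ))
    refine ⟨C, ?_, ?_⟩
    · convert hC using 2
      rw [add_comm, ← Fin.sum_univ_succ fun k => (w' (σ.symm k)).length,
        Equiv.sum_comp σ.symm fun k => (w' k).length, Fin.sum_univ_succ, ← hw]
      simp [hw']
    · unfold IsPermuted
      convert h using 2
      ext1 f
      simp only [density, MultilinearMap.domDomCongr_apply, outer_apply, Module.End.one_apply,
        prodOp_apply, one_mul]
      rw [← Fin.prod_univ_succ fun k => partials (w' (σ.symm k)) (f k),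
        ← Equiv.prod_comp σ fun k => partials (w' (σ.symm k)) (f k), Fin.prod_univ_succ]
      simp [hw', partials_nil]
  | zero =>
    refine ⟨0, zero_mem _, ?_⟩
    unfold IsPermuted
    convert zero_mem (totalDiv ι (n + 1)) using 1
    ext1 f; simp [density]
  | add x y _ _ hx hy =>
    obtain ⟨C, hC, h⟩ := hx
    obtain ⟨C', hC', h'⟩ := hy
    exact ⟨_, add_mem hC hC', h.add h'⟩
  | smul c x _ hx =>
    obtain ⟨C, hC, h⟩ := hx
    exact ⟨_, Submodule.smul_mem _ c hC, h.smul c⟩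

lemma invRepOfMatrix_mem_orderPart [Fintype ι] [DecidableEq ι] {P : Matrix ι ι ℂ}
    (hP : P.transpose = -P) (hP' : IsUnit P.det) {n r : ℕ} (σ : Equiv.Perm (Fin (n + 1)))
    {B : Inv P n} (hB : B.1 ∈ orderPart ι n r) :
    (invRepOfMatrix P hP hP' n σ B).1 ∈ orderPart ι n r := by
  obtain ⟨C, hC, h⟩ := exists_isPermuted_orderPart σ hB
  rwa [(isPermuted_invRepOfMatrix hP hP' σ B).unique h]

/-- The commutator of polydifferential operators with the Euler field `E`,
`B ↦ ∑ₖ B(…, E fₖ, …) - E B(f₁, …, fₙ)`; on constant coefficient operators it measures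
the order. -/
def eulerCommutator (ι : Type*) [Fintype ι] (n : ℕ) : MultiOp ι n →ₗ[ℂ] MultiOp ι n where
  toFun B := ∑ k, B.compLinearMap (Function.update (fun _ => LinearMap.id) k euler) -
    euler.compMultilinearMap B
  map_add' B C := by
    ext1 f
    simp [_root_.sum_apply, Finset.sum_add_distrib]
    ring
  map_smul' c B := by
    ext1 f
    simp [_root_.sum_apply, Finset.smul_sum, smul_sub]

lemma eulerCommutator_apply [Fintype ι] {n : ℕ} (B : MultiOp ι n) (f : Fin n → Fn ι) :
    eulerCommutator ι n B f =
      ∑ k : Fin n, B (fun l => Function.update (fun _ => LinearMap.id) k euler l (f l)) -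
        euler (B f) := by
  simp [eulerCommutator, _root_.sum_apply]

lemma euler_prod [Fintype ι] {κ : Type*} [DecidableEq κ] (s : Finset κ) (f : κ → Fn ι) :
    euler (∏ k ∈ s, f k) = ∑ k ∈ s, euler (f k) * ∏ l ∈ s.erase k, f l := by
  simp only [euler_apply, pd_prod, Finset.mul_sum, Finset.sum_mul]
  rw [Finset.sum_comm]
  exact Finset.sum_congr rfl fun i _ => Finset.sum_congr rfl fun j _ => by ring

lemma partials_euler [Fintype ι] (w : List ι) (f : Fn ι) :
    partials w (euler f) = euler (partials w f) + (w.length : ℂ) • partials w f := by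
  classical
  induction w generalizing f with
  | nil => simp [partials_nil]
  | cons i w ih =>
    have h1 : ∀ g : Fn ι, pd i (euler g) = euler (pd i g) + pd i g := by
      intro g
      simp only [euler_apply, map_sum, pd_mul, Finset.sum_add_distrib]
      rw [add_comm]
      congr 1
      · exact Finset.sum_congr rfl fun j _ => by rw [pd_comm]
      · rw [Finset.sum_eq_single i]
        · rw [pd_X_self, one_mul]
        · intro j _ hj; rw [pd_X_of_ne hj.symm, zero_mul]
        · simp
    rw [partials_cons, Module.End.mul_apply, Module.End.mul_apply, ih, map_add, h1, map_smul,
      List.length_cons]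
    push_cast
    module

lemma eulerCommutator_of_mem_orderPart [Fintype ι] {n r : ℕ} {B : MultiOp ι n}
    (hB : B ∈ orderPart ι n r) : eulerCommutator ι n B = (r : ℂ) • B := by
  induction hB using Submodule.span_induction with
  | mem B hB =>
    obtain ⟨w, hw, rfl⟩ := hB
    ext1 f
    have h1 : ∀ k : Fin n, (prodOp 1 fun l => partials (w l)) (fun l =>
        Function.update (fun _ => LinearMap.id) k euler l (f l)) =
        (euler (partials (w k) (f k)) + ((w k).length : ℂ) • partials (w k) (f k)) *
          ∏ l ∈ Finset.univ.erase k, partials (w l) (f l) := by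
      intro k
      rw [prodOp_apply, one_mul, ← Finset.mul_prod_erase Finset.univ _ (Finset.mem_univ k),
        Function.update_self, partials_euler]
      congr 1
      refine Finset.prod_congr rfl fun l hl => ?_
      rw [Function.update_of_ne (Finset.ne_of_mem_erase hl)]
      rfl
    rw [eulerCommutator_apply]
    simp only [h1, _root_.smul_apply]
    rw [prodOp_apply, one_mul, euler_prod, ← Finset.sum_sub_distrib, ← hw]
    push_cast
    rw [Finset.sum_smul]
    refine Finset.sum_congr rfl fun k _ => ?_
    rw [← Finset.mul_prod_erase Finset.univ (fun l => partials (w l) (f l)) (Finset.mem_univ k),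
      add_mul, add_sub_cancel_left, smul_mul_assoc]
  | zero => simp
  | add x y _ _ hx hy => rw [map_add, hx, hy, smul_add]
  | smul c x _ hx => rw [map_smul, hx, smul_comm]

end Homogeneity

/-! ### Adjoints -/

section Adjoint

variable {ι : Type*}

/-- The differential operators of the form `∑ ∂_i D_i`. -/
def divOps (ι : Type*) : Submodule ℂ (Module.End ℂ (Fn ι)) :=
  (LinearMap.ker (transposeOne ι)).map (opOf ι)

lemma pd_mul_mem_divOps (i : ι) {D : Module.End ℂ (Fn ι)} (hD : D ∈ diffOp ι) :
    pd i * D ∈ divOps ι := by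
  obtain ⟨c, rfl⟩ := exists_opOf hD
  obtain ⟨c', h, h'⟩ := pd_opOf i c
  exact ⟨c', h', h.symm⟩

lemma eq_zero_of_mulLeft_mem_divOps {a : Fn ι} (h : LinearMap.mulLeft ℂ a ∈ divOps ι) :
    a = 0 := by
  obtain ⟨c, hc, h⟩ := h
  have h3 : opOf ι c = opOf ι (Finsupp.single 0 a) := by
    rw [h]
    ext1 f
    rw [opOf_single, dA_zero]
    rfl
  have := opOf_injective ι h3
  subst this
  have h2 : transposeOne ι (Finsupp.single 0 a) = 0 := hc
  rw [transposeOne_single, dA_zero] at h2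
  simpa using h2

lemma exists_mem_divOps {n : ℕ} {C : MultiOp ι (n + 1)} (hC : C ∈ totalDiv ι (n + 1))
    (f : Fin n → Fn ι) : ∃ D ∈ divOps ι, ∀ h, C (Fin.cons h f) = D h := by
  induction hC using Submodule.span_induction with
  | mem C hC =>
    obtain ⟨i, B, hB, rfl⟩ := hC
    obtain ⟨D, hD, h1⟩ := slot_mem hB f
    exact ⟨_, pd_mul_mem_divOps i hD, fun h => by simp [h1]⟩
  | zero => exact ⟨0, zero_mem _, by simp⟩
  | add x y _ _ hx hy =>
    obtain ⟨D, hD, h1⟩ := hx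
    obtain ⟨E, hE, h2⟩ := hy
    exact ⟨D + E, add_mem hD hE, fun h => by simp [h1, h2]⟩
  | smul c x _ hx =>
    obtain ⟨D, hD, h1⟩ := hx
    exact ⟨c • D, Submodule.smul_mem _ c hD, fun h => by simp [h1]⟩

/-- Integration by parts: `g ∂_i^b` has the transpose `(-∂_i)^b g`. -/
lemma mulLeft_pd_pow_sub_mem_divOps (i : ι) (b : ℕ) : ∀ g : Fn ι,
    LinearMap.mulLeft ℂ g * pd i ^ b - (-1 : ℂ) ^ b • LinearMap.mulLeft ℂ ((pd i ^ b) g) ∈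
      divOps ι := by
  induction b with
  | zero => intro g; simp
  | succ b ih =>
    intro g
    have h1 := pd_mul_mem_divOps i (mul_mem (mulLeft_mem g) (pow_mem (pd_mem i) b))
    convert sub_mem h1 (ih (pd i g)) using 1
    rw [← Module.End.mul_apply (pd i ^ b) (pd i) g, ← pow_succ (pd i) b]
    ext1 f
    simp only [LinearMap.sub_apply, Module.End.mul_apply, LinearMap.mulLeft_apply, pd_mul,
      LinearMap.smul_apply, pow_succ (-1 : ℂ), pow_succ' (pd i) b]
    module

variable [Fintype ι] [DecidableEq ι] {P : Matrix ι ι ℂ}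

/-- Exchanging the arguments `f₀` and `f_{m+1}` of the distribution transposes the operator
`B(q, …, q, ·)`. -/
lemma lastSlot_swap (hP : P.transpose = -P) (hP' : IsUnit P.det) (i₀ : ι) {m : ℕ}
    {B C : MultiOp ι (m + 1)} (h : IsPermuted (Equiv.swap 0 (Fin.last (m + 1))) B C) {a b : ℕ}
    {c : ℂ}
    (hB : lastSlot P i₀ B = c • (LinearMap.mulLeft ℂ (dualCoord P i₀ ^ a) * pd i₀ ^ b)) :
    lastSlot P i₀ C = (-1 : ℂ) ^ b • lastSlot P i₀ B := by
  ext1 g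
  obtain ⟨D, hD, h1⟩ := exists_mem_divOps h
    (Function.update (fun _ => dualCoord P i₀) (Fin.last m) g)
  have h2 : ∀ f, D f = f * lastSlot P i₀ C g - g * lastSlot P i₀ B f := by
    intro f
    rw [← h1]
    simp only [density, _root_.sub_apply, outer_apply, MultilinearMap.domDomCongr_apply,
      Module.End.one_apply, Fin.cons_zero, Fin.cons_succ, Equiv.swap_apply_left, lastSlot_apply]
    rw [← Fin.succ_last, Fin.cons_succ, Function.update_self]
    congr 3
    funext k
    by_cases hk : k = Fin.last m
    · subst hk; simp
    · rw [Equiv.swap_apply_of_ne_of_ne (Fin.succ_ne_zero k) (by rwa [Ne, Fin.succ_inj]),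
        Fin.cons_succ, Function.update_of_ne hk, Function.update_of_ne hk]
  have h3 := Submodule.smul_mem _ c
    (mulLeft_pd_pow_sub_mem_divOps i₀ b (g * dualCoord P i₀ ^ a))
  have hq : pd i₀ (dualCoord P i₀ ^ a) = 0 := by
    clear h3 hB
    induction a with
    | zero => rw [pow_zero, pd_one]
    | succ a ih =>
      rw [pow_succ, pd_mul, ih, pd_dualCoord_self hP hP', zero_mul, mul_zero, add_zero]
  rw [mul_comm g, pd_pow_mul hq] at h3
  refine sub_eq_zero.mp (eq_zero_of_mulLeft_mem_divOps ?_)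
  convert add_mem hD h3 using 1
  ext1 f
  simp only [LinearMap.add_apply, h2, hB, LinearMap.smul_apply, LinearMap.sub_apply,
    Module.End.mul_apply, LinearMap.mulLeft_apply, smul_sub, sub_mul, mul_smul_comm,
    smul_mul_assoc]
  rw [smul_comm c]
  ring_nf

end Adjoint

/-! ### Operators fixed by the permutations of `n - 1` arguments -/

section TwoPoint

variable {ι : Type*} [Fintype ι] [DecidableEq ι] {P : Matrix ι ι ℂ}

/-- The permutations of `n + 1` letters that fix the first and the last one. -/
def fixEnds (n : ℕ) : Finset (Equiv.Perm (Fin (n + 1))) :=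
  Finset.univ.filter fun σ => σ 0 = 0 ∧ σ (Fin.last n) = Fin.last n

lemma mem_fixEnds {n : ℕ} {σ : Equiv.Perm (Fin (n + 1))} :
    σ ∈ fixEnds n ↔ σ 0 = 0 ∧ σ (Fin.last n) = Fin.last n := by simp [fixEnds]

lemma fixEnds_nonempty (n : ℕ) : (fixEnds n).Nonempty := ⟨1, by simp [mem_fixEnds]⟩

lemma mul_mem_fixEnds {n : ℕ} {σ τ : Equiv.Perm (Fin (n + 1))} (hσ : σ ∈ fixEnds n)
    (hτ : τ ∈ fixEnds n) : σ * τ ∈ fixEnds n := by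
  rw [mem_fixEnds] at *
  simp [hσ.1, hσ.2, hτ.1, hτ.2]

lemma inv_mem_fixEnds {n : ℕ} {σ : Equiv.Perm (Fin (n + 1))} (hσ : σ ∈ fixEnds n) :
    σ⁻¹ ∈ fixEnds n := by
  rw [mem_fixEnds] at *
  exact ⟨by rw [Equiv.Perm.inv_eq_iff_eq, hσ.1], by rw [Equiv.Perm.inv_eq_iff_eq, hσ.2]⟩

lemma exists_perm_of_mem_fixEnds {m : ℕ} {σ : Equiv.Perm (Fin (m + 2))}
    (hσ : σ ∈ fixEnds (m + 1)) : ∃ τ : Equiv.Perm (Fin (m + 1)),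
      (∀ k, σ k.succ = (τ k).succ) ∧ τ (Fin.last m) = Fin.last m := by
  obtain ⟨h0, h1⟩ := mem_fixEnds.mp hσ
  obtain ⟨τ, hτ⟩ := exists_perm_of_fixed h0
  refine ⟨τ, hτ, ?_⟩
  rw [← Fin.succ_last, hτ] at h1
  exact Fin.succ_injective _ h1

/-- A permutation of the arguments `f₁, …, f_m` does not change `B(q, …, q, ·)`. -/
lemma lastSlot_invRepOfMatrix (hP : P.transpose = -P) (hP' : IsUnit P.det) (i₀ : ι) {m : ℕ}
    {σ : Equiv.Perm (Fin (m + 2))} (hσ : σ ∈ fixEnds (m + 1)) (B : Inv P (m + 1)) :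
    lastSlot P i₀ (invRepOfMatrix P hP hP' (m + 1) σ B).1 = lastSlot P i₀ B.1 := by
  obtain ⟨τ, hτ, hl⟩ := exists_perm_of_mem_fixEnds hσ
  rw [invRepOfMatrix_of_fixed hP hP' (mem_fixEnds.mp hσ).1 hτ]
  ext1 f
  rw [lastSlot_apply, lastSlot_apply, MultilinearMap.domDomCongr_apply]
  congr 1
  funext k
  by_cases hk : k = Fin.last m
  · subst hk; rw [hl]
  · rw [Function.update_of_ne hk, Function.update_of_ne]
    intro h
    exact hk (τ.injective (h.trans hl.symm))

/-- Operators symmetric in `f₁, …, f_m` are determined by their restriction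
`B(q, …, q, ·)`. -/
lemma eq_of_lastSlot_eq (hP : P.transpose = -P) (hP' : IsUnit P.det) (i₀ : ι) {m : ℕ}
    {B C : Inv P (m + 1)}
    (hB : ∀ σ ∈ fixEnds (m + 1), invRepOfMatrix P hP hP' (m + 1) σ B = B)
    (hC : ∀ σ ∈ fixEnds (m + 1), invRepOfMatrix P hP hP' (m + 1) σ C = C)
    (h : lastSlot P i₀ B.1 = lastSlot P i₀ C.1) : B = C := by
  have : Nonempty ι := ⟨i₀⟩
  refine sub_eq_zero.mp (Subtype.ext ?_)
  refine (isHamInvariant_of_mem_Inv hP (B - C).2).eq_zero hP hP' i₀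
    (Finset.univ.erase (Fin.last m)) (fun i hi j hj => ?_) fun f hf => ?_
  · obtain ⟨σ, h0, h1⟩ := exists_perm_succ (Equiv.swap i j)
    have hσ : σ ∈ fixEnds (m + 1) := by
      refine mem_fixEnds.mpr ⟨h0, ?_⟩
      rw [← Fin.succ_last, h1, Equiv.swap_apply_of_ne_of_ne (Finset.ne_of_mem_erase hi).symm
        (Finset.ne_of_mem_erase hj).symm]
    rw [← invRepOfMatrix_of_fixed hP hP' h0 h1]
    exact congrArg Subtype.val ((map_sub (invRepOfMatrix P hP hP' (m + 1) σ) B C).trans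
      (congrArg₂ _ (hB σ hσ) (hC σ hσ)))
  · have h1 : f = Function.update (fun _ => dualCoord P i₀) (Fin.last m) (f (Fin.last m)) := by
      funext k
      by_cases hk : k = Fin.last m
      · subst hk; rw [Function.update_self]
      · rw [Function.update_of_ne hk, hf k (by simp [hk])]
    have h2 := LinearMap.congr_fun h (f (Fin.last m))
    rw [lastSlot_apply, lastSlot_apply, ← h1] at h2
    change (B.1 - C.1) f = 0
    rw [_root_.sub_apply, h2, sub_self]

/-- The invariant operator obtained from `f₁ ⋯ f_{m-b} {f_{m-b+1}, {…, {f_m, f_{m+1}}}}` by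
averaging over the permutations of `f₁, …, f_m`. -/
def symBracket (hP : P.transpose = -P) (hP' : IsUnit P.det) (m b : ℕ) : Inv P (m + 1) :=
  ((fixEnds (m + 1)).card : ℂ)⁻¹ • ∑ σ ∈ fixEnds (m + 1),
    invRepOfMatrix P hP hP' (m + 1) σ ⟨iterBracket P b m, iterBracket_mem_Inv P b m⟩

lemma symBracket_fixed (hP : P.transpose = -P) (hP' : IsUnit P.det) (m b : ℕ)
    {τ : Equiv.Perm (Fin (m + 2))} (hτ : τ ∈ fixEnds (m + 1)) :
    invRepOfMatrix P hP hP' (m + 1) τ (symBracket hP hP' m b) = symBracket hP hP' m b := by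
  unfold symBracket
  rw [map_smul, map_sum]
  congr 1
  refine Finset.sum_bij (fun σ _ => τ * σ) (fun σ hσ => mul_mem_fixEnds hτ hσ)
    (fun σ _ σ' _ h => mul_left_cancel h)
    (fun σ hσ => ⟨τ⁻¹ * σ, mul_mem_fixEnds (inv_mem_fixEnds hτ) hσ, by simp⟩) fun σ _ => ?_
  rw [map_mul, Module.End.mul_apply]

lemma lastSlot_symBracket (hP : P.transpose = -P) (hP' : IsUnit P.det) (i₀ : ι) {m b : ℕ}
    (hb : b ≤ m) : lastSlot P i₀ (symBracket hP hP' m b).1 =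
      LinearMap.mulLeft ℂ (dualCoord P i₀ ^ (m - b)) * pd i₀ ^ b := by
  have h1 : lastSlot P i₀ (symBracket hP hP' m b).1 = ((fixEnds (m + 1)).card : ℂ)⁻¹ •
      ∑ σ ∈ fixEnds (m + 1), lastSlot P i₀ (invRepOfMatrix P hP hP' (m + 1) σ
        ⟨iterBracket P b m, iterBracket_mem_Inv P b m⟩).1 := by
    ext1 f
    simp only [symBracket, lastSlot_apply, Submodule.coe_smul, Submodule.coe_sum,
      _root_.smul_apply, _root_.sum_apply, LinearMap.smul_apply, LinearMap.sum_apply]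
  rw [h1, Finset.sum_congr rfl fun σ hσ => lastSlot_invRepOfMatrix hP hP' i₀ hσ _,
    Finset.sum_const, ← Nat.cast_smul_eq_nsmul ℂ, smul_smul, inv_mul_cancel₀, one_smul,
    lastSlot_iterBracket hP', min_eq_left hb]
  exact Nat.cast_ne_zero.mpr (fixEnds_nonempty _).card_pos.ne'

lemma symBracket_mem_orderPart (hP : P.transpose = -P) (hP' : IsUnit P.det) {m b : ℕ}
    (hb : b ≤ m) : (symBracket hP hP' m b).1 ∈ orderPart ι (m + 1) (2 * b) := by
  have h1 : iterBracket P b m ∈ orderPart ι (m + 1) (2 * b) := by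
    simpa [min_eq_left hb] using iterBracket_mem_orderPart P b m
  simp only [symBracket, Submodule.coe_smul, Submodule.coe_sum]
  exact Submodule.smul_mem _ _ (sum_mem fun σ _ => invRepOfMatrix_mem_orderPart hP hP' σ h1)

/-- The operators symmetric in `f₁, …, f_m` are the combinations of the symmetrized
brackets. -/
lemma exists_eq_sum_symBracket [Nonempty ι] (hP : P.transpose = -P) (hP' : IsUnit P.det) {m : ℕ}
    {B : Inv P (m + 1)}
    (hB : ∀ σ ∈ fixEnds (m + 1), invRepOfMatrix P hP hP' (m + 1) σ B = B) :
    ∃ c : ℕ → ℂ, B = ∑ b ∈ Finset.range (m + 1), c b • symBracket hP hP' m b := by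
  obtain ⟨i₀⟩ := ‹Nonempty ι›
  have : Nonempty ι := ⟨i₀⟩
  obtain ⟨c, hc⟩ := (isStabilized_lastSlot hP hP' i₀ B.2.1
    (isHamInvariant_of_mem_Inv hP B.2)).exists_eq_sum hP hP' m
  refine ⟨c, eq_of_lastSlot_eq hP hP' i₀ hB (fun σ hσ => ?_) ?_⟩
  · rw [map_sum]
    exact Finset.sum_congr rfl fun b _ => by rw [map_smul, symBracket_fixed hP hP' m b hσ]
  · have h1 : lastSlot P i₀ (∑ b ∈ Finset.range (m + 1), c b • symBracket hP hP' m b : Inv P _).1 =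
        ∑ b ∈ Finset.range (m + 1), c b • lastSlot P i₀ (symBracket hP hP' m b).1 := by
      ext1 f
      simp only [lastSlot_apply, Submodule.coe_smul, Submodule.coe_sum,
        _root_.smul_apply, _root_.sum_apply, LinearMap.smul_apply, LinearMap.sum_apply]
    rw [hc, h1]
    refine Finset.sum_congr rfl fun b hb => ?_
    rw [lastSlot_symBracket hP hP' i₀ (by simp at hb; omega)]

lemma symBracket_ne_zero [Nonempty ι] (hP : P.transpose = -P) (hP' : IsUnit P.det) {m b : ℕ}
    (hb : b ≤ m) : symBracket hP hP' m b ≠ 0 := by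
  intro h0
  obtain ⟨i₀⟩ := ‹Nonempty ι›
  have h1 := lastSlot_symBracket hP hP' i₀ hb
  obtain ⟨f, hf⟩ : ∃ f : Fn ι, (pd i₀ ^ b) f = 1 := by
    clear h1 h0 hb
    induction b with
    | zero => exact ⟨1, rfl⟩
    | succ b ih =>
      obtain ⟨f, hf⟩ := ih
      obtain ⟨g, hg⟩ := exists_pd_eq i₀ f
      exact ⟨g, by rw [pow_succ, Module.End.mul_apply, hg, hf]⟩
  have h2 := LinearMap.congr_fun h1 f
  rw [h0, lastSlot_apply, Module.End.mul_apply, hf, LinearMap.mulLeft_apply, mul_one] at h2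
  exact pow_ne_zero _ (dualCoord_ne_zero hP hP' i₀) h2.symm

/-- Exchanging `f₀` and `f_{m+1}` multiplies the operator with `b` brackets by `(-1)^b`, since
Hamiltonian vector fields are antiselfadjoint. -/
lemma symBracket_swap (hP : P.transpose = -P) (hP' : IsUnit P.det) [Nonempty ι] {m b : ℕ}
    (hb : b ≤ m) :
    invRepOfMatrix P hP hP' (m + 1) (Equiv.swap 0 (Fin.last (m + 1))) (symBracket hP hP' m b) =
      (-1 : ℂ) ^ b • symBracket hP hP' m b := by
  obtain ⟨i₀⟩ := ‹Nonempty ι›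
  refine eq_of_lastSlot_eq hP hP' i₀ (fun σ hσ => ?_) (fun σ hσ => ?_) ?_
  · have h1 : Equiv.swap 0 (Fin.last (m + 1)) * σ * Equiv.swap 0 (Fin.last (m + 1)) ∈
        fixEnds (m + 1) := by
      obtain ⟨h0, h1⟩ := mem_fixEnds.mp hσ
      rw [mem_fixEnds]
      simp [h0, h1]
    have h2 := symBracket_fixed hP hP' m b h1
    have e : σ * Equiv.swap 0 (Fin.last (m + 1)) = Equiv.swap 0 (Fin.last (m + 1)) *
        (Equiv.swap 0 (Fin.last (m + 1)) * σ * Equiv.swap 0 (Fin.last (m + 1))) := by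
      simp [← mul_assoc]
    rw [← Module.End.mul_apply, ← map_mul, e, map_mul, Module.End.mul_apply, h2]
  · rw [map_smul, symBracket_fixed hP hP' m b hσ]
  · have h1 := lastSlot_symBracket hP hP' i₀ hb
    rw [lastSlot_swap hP hP' i₀ (isPermuted_invRepOfMatrix hP hP' _ _) (c := 1)
      (by rw [h1, one_smul])]
    rfl

lemma linearIndependent_symBracket [Nonempty ι] (hP : P.transpose = -P) (hP' : IsUnit P.det)
    (m : ℕ) : LinearIndependent ℂ fun b : Fin (m + 1) => symBracket hP hP' m b := by
  refine LinearIndependent.of_comp (Inv P (m + 1)).subtype ?_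
  refine Module.End.eigenvectors_linearIndependent' (eulerCommutator ι (m + 1))
    (fun b : Fin (m + 1) => ((2 * (b : ℕ) : ℕ) : ℂ)) (fun b c h => ?_) _ fun b => ?_
  · have : 2 * (b : ℕ) = 2 * c := Nat.cast_injective h
    exact Fin.ext (by omega)
  · rw [Module.End.hasEigenvector_iff, Module.End.mem_eigenspace_iff]
    have hb : (b : ℕ) ≤ m := by omega
    refine ⟨eulerCommutator_of_mem_orderPart (symBracket_mem_orderPart hP hP' hb), ?_⟩
    simpa using symBracket_ne_zero hP hP' hb

end TwoPoint

/-! ### Homomorphisms from the tensor squares of the reflection representation -/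

section Reflection

/-- The vector `e_i - (1 / (n + 1)) ∑ e_j` of the reflection representation. -/
def reflVec {n : ℕ} (i : Fin (n + 1)) : sumZero n :=
  ⟨Pi.single i 1 - fun _ => ((n : ℂ) + 1)⁻¹, by
    have h : ((n : ℂ) + 1) ≠ 0 := by exact_mod_cast Nat.succ_ne_zero n
    change ∑ j, (Pi.single i 1 - fun _ => ((n : ℂ) + 1)⁻¹ : Fin (n + 1) → ℂ) j = 0
    simp [Finset.sum_sub_distrib, h]⟩

lemma reflVec_apply {n : ℕ} (i j : Fin (n + 1)) :
    (reflVec i).1 j = (if j = i then 1 else 0) - ((n : ℂ) + 1)⁻¹ := by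
  simp [reflVec, Pi.single_apply]

lemma sumZero_sum {n : ℕ} (v : sumZero n) : ∑ i, v.1 i = 0 := v.2

lemma reflRep_apply {n : ℕ} (σ : Equiv.Perm (Fin (n + 1))) (v : sumZero n) (j : Fin (n + 1)) :
    (reflRep n σ v).1 j = v.1 (σ.symm j) := rfl

lemma reflRep_reflVec {n : ℕ} (σ : Equiv.Perm (Fin (n + 1))) (i : Fin (n + 1)) :
    reflRep n σ (reflVec i) = reflVec (σ i) := by
  ext j
  rw [reflRep_apply, reflVec_apply, reflVec_apply]
  simp [Equiv.symm_apply_eq]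

lemma sum_reflVec (n : ℕ) : ∑ i : Fin (n + 1), reflVec i = 0 := by
  have h : ((n : ℂ) + 1) ≠ 0 := by exact_mod_cast Nat.succ_ne_zero n
  ext j
  simp [Finset.sum_apply, reflVec_apply, Finset.sum_sub_distrib, h]

lemma sum_smul_reflVec {n : ℕ} (v : sumZero n) : ∑ i, v.1 i • reflVec i = v := by
  ext j
  simp [Finset.sum_apply, reflVec_apply, mul_sub, Finset.sum_sub_distrib,
    ← Finset.sum_mul, sumZero_sum]

/-- Contracting with `reflVec k` picks the `k`-th term of a family of sum zero. -/
lemma sum_reflVec_smul {n : ℕ} {E : Type*} [AddCommGroup E] [Module ℂ E] (k : Fin (n + 1))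
    {x : Fin (n + 1) → E} (hx : ∑ i, x i = 0) : ∑ i, (reflVec k).1 i • x i = x k := by
  simp [reflVec_apply, sub_smul, Finset.sum_sub_distrib, ← Finset.smul_sum, hx]

variable {n : ℕ} {M : Type*} [AddCommGroup M] [Module ℂ M]
  {ρ : Representation ℂ (Equiv.Perm (Fin (n + 1))) M}

/-- The vectors fixed by the stabilizer of `0` are multiples of a single invariant vector `Z`. -/
structure HasOnePoint (ρ : Representation ℂ (Equiv.Perm (Fin (n + 1))) M) (Z : M) : Prop where
  fixed : ∀ σ, ρ σ Z = Z
  exists_smul : ∀ x, (∀ σ : Equiv.Perm (Fin (n + 1)), σ 0 = 0 → ρ σ x = x) → ∃ c : ℂ, x = c • Z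

lemma HasOnePoint.fixed_of_stabilizer {Z : M} (hZ : HasOnePoint ρ Z) {x : M}
    (hx : ∀ σ : Equiv.Perm (Fin (n + 1)), σ 0 = 0 → ρ σ x = x) (σ : Equiv.Perm (Fin (n + 1))) :
    ρ σ x = x := by
  obtain ⟨c, rfl⟩ := hZ.exists_smul x hx
  rw [map_smul, hZ.fixed]

lemma HasOnePoint.hom_reflRep_eq_zero {Z : M} (hZ : HasOnePoint ρ Z)
    (T : (reflRep n).IntertwiningMap ρ) : T = 0 := by
  have h1 : ∀ σ, ρ σ (T (reflVec 0)) = T (reflVec (σ 0)) := fun σ => by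
    rw [← T.isIntertwining, reflRep_reflVec]
  have h2 := hZ.fixed_of_stabilizer (x := T (reflVec 0)) fun σ hσ => by rw [h1, hσ]
  have h3 : ∀ i, T (reflVec i) = T (reflVec 0) := fun i => by
    rw [← h2 (Equiv.swap 0 i), h1, Equiv.swap_apply_left]
  have h4 : T (reflVec 0) = 0 := by
    have h5 := congrArg T (sum_reflVec n)
    rw [map_sum, map_zero, Finset.sum_congr rfl fun i _ => h3 i, Finset.sum_const,
      Finset.card_univ, Fintype.card_fin, ← Nat.cast_smul_eq_nsmul ℂ] at h5
    exact (smul_eq_zero.mp h5).resolve_left (by exact_mod_cast Nat.succ_ne_zero n)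
  refine Representation.IntertwiningMap.ext (LinearMap.ext fun v => ?_)
  change T v = 0
  rw [← sum_smul_reflVec v, map_sum]
  exact Finset.sum_eq_zero fun i _ => by rw [map_smul, h3, h4, smul_zero]

lemma HasOnePoint.rank_invariants {Z : M} (hZ : HasOnePoint ρ Z) (h0 : Z ≠ 0) :
    Module.rank ℂ ρ.invariants = 1 := by
  refine (rank_submodule_eq_one_iff _).mpr ⟨Z, hZ.fixed, h0, fun x hx => ?_⟩
  obtain ⟨c, rfl⟩ := hZ.exists_smul x fun σ _ => hx σ
  exact Submodule.smul_mem _ c (Submodule.mem_span_singleton_self _)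

/-- The vectors fixed by the permutations that fix the first and the last letter, on which the
exchange of these two letters acts by `ε`. -/
def endsPart (ρ : Representation ℂ (Equiv.Perm (Fin (n + 1))) M) (ε : ℂ) : Submodule ℂ M where
  carrier := {x | (∀ σ ∈ fixEnds n, ρ σ x = x) ∧ ρ (Equiv.swap 0 (Fin.last n)) x = ε • x}
  zero_mem' := ⟨fun σ _ => map_zero _, by rw [map_zero, smul_zero]⟩
  add_mem' := fun hx hy => ⟨fun σ hσ => by rw [map_add, hx.1 σ hσ, hy.1 σ hσ],
    by rw [map_add, hx.2, hy.2, smul_add]⟩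
  smul_mem' := fun c x hx => ⟨fun σ hσ => by rw [map_smul, hx.1 σ hσ],
    by rw [map_smul, hx.2, smul_comm]⟩

/-- The representation `R` is, by means of the bilinear map `β`, the symmetric (`ε = 1`) or
exterior (`ε = -1`) square of the reflection representation, as far as linear maps to `M` are
concerned. -/
structure IsReflSquare {R : Type*} [AddCommGroup R] [Module ℂ R]
    (τ : Representation ℂ (Equiv.Perm (Fin (n + 1))) R)
    (β : sumZero n →ₗ[ℂ] sumZero n →ₗ[ℂ] R) (ε : ℂ) (M : Type*) [AddCommGroup M] [Module ℂ M] :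
    Prop where
  span : Submodule.span ℂ {x | ∃ v w, x = β v w} = ⊤
  equivariant : ∀ σ v w, τ σ (β v w) = β (reflRep n σ v) (reflRep n σ w)
  symm : ∀ v w, β w v = ε • β v w
  lift : ∀ γ : sumZero n →ₗ[ℂ] sumZero n →ₗ[ℂ] M, (∀ v w, γ w v = ε • γ v w) →
    ∃ T : R →ₗ[ℂ] M, ∀ v w, T (β v w) = γ v w

section Square

variable {R : Type*} [AddCommGroup R] [Module ℂ R]
  {τ : Representation ℂ (Equiv.Perm (Fin (n + 1))) R}
  {β : sumZero n →ₗ[ℂ] sumZero n →ₗ[ℂ] R} {ε : ℂ}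

lemma IsReflSquare.apply_reflVec (hR : IsReflSquare τ β ε M) (T : τ.IntertwiningMap ρ)
    (σ : Equiv.Perm (Fin (n + 1))) (i j : Fin (n + 1)) :
    ρ σ (T (β (reflVec i) (reflVec j))) = T (β (reflVec (σ i)) (reflVec (σ j))) := by
  rw [← T.isIntertwining, hR.equivariant, reflRep_reflVec, reflRep_reflVec]

/-- Evaluation of a homomorphism at the product of the first and the last of the vectors
`reflVec i`. -/
def IsReflSquare.eval (hR : IsReflSquare τ β ε M) :
    τ.IntertwiningMap ρ →ₗ[ℂ] endsPart ρ ε where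
  toFun T := ⟨T (β (reflVec 0) (reflVec (Fin.last n))), fun σ hσ => by
    rw [hR.apply_reflVec, (mem_fixEnds.mp hσ).1, (mem_fixEnds.mp hσ).2], by
    rw [hR.apply_reflVec, Equiv.swap_apply_left, Equiv.swap_apply_right, hR.symm, map_smul]⟩
  map_add' _ _ := rfl
  map_smul' _ _ := rfl

/-- Two distinct letters can be moved to any two distinct letters. -/
lemma exists_perm_ends (hn : n ≠ 0) {i j : Fin (n + 1)} (hij : i ≠ j) :
    ∃ σ : Equiv.Perm (Fin (n + 1)), σ 0 = i ∧ σ (Fin.last n) = j := by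
  have h0 : (0 : Fin (n + 1)) ≠ Fin.last n := fun h => hn (by simpa using congrArg Fin.val h.symm)
  refine ⟨Equiv.swap (Equiv.swap 0 i (Fin.last n)) j * Equiv.swap 0 i, ?_, ?_⟩
  · rw [Equiv.Perm.mul_apply, Equiv.swap_apply_left]
    refine Equiv.swap_apply_of_ne_of_ne (fun h => h0 ?_) hij
    exact (Equiv.swap 0 i).injective (by rw [Equiv.swap_apply_left]; exact h)
  · rw [Equiv.Perm.mul_apply, Equiv.swap_apply_left]

/-- Since `reflVec` has sum zero, a homomorphism takes values in an invariant subspace as soon as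
its value at the product of two distinct vectors `reflVec i` lies there. -/
lemma IsReflSquare.forall_mem (hR : IsReflSquare τ β ε M) (hn : n ≠ 0) {F : Submodule ℂ M}
    (hF : ∀ σ, ∀ x ∈ F, ρ σ x ∈ F) (T : τ.IntertwiningMap ρ)
    (hT : T (β (reflVec 0) (reflVec (Fin.last n))) ∈ F) (x : R) : T x ∈ F := by
  have h1 : ∀ i j, i ≠ j → T (β (reflVec i) (reflVec j)) ∈ F := by
    intro i j hij
    obtain ⟨σ, rfl, rfl⟩ := exists_perm_ends hn hij
    rw [← hR.apply_reflVec]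
    exact hF σ _ hT
  have h2 : ∀ i j, T (β (reflVec i) (reflVec j)) ∈ F := by
    intro i j
    by_cases hij : i = j
    · subst hij
      have h3 : β (reflVec i) (reflVec i) =
          -∑ j ∈ Finset.univ.erase i, β (reflVec i) (reflVec j) := by
        rw [eq_neg_iff_add_eq_zero, Finset.add_sum_erase Finset.univ
          (fun j => β (reflVec i) (reflVec j)) (Finset.mem_univ i), ← map_sum, sum_reflVec,
          map_zero]
      rw [h3, map_neg, map_sum]
      exact neg_mem (sum_mem fun j hj => h1 i j (Finset.ne_of_mem_erase hj).symm)
    · exact h1 i j hij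
  have hx : x ∈ Submodule.span ℂ {x | ∃ v w, x = β v w} := by rw [hR.span]; trivial
  induction hx using Submodule.span_induction with
  | mem x hx =>
    obtain ⟨v, w, rfl⟩ := hx
    rw [← sum_smul_reflVec v, ← sum_smul_reflVec w]
    simp only [map_sum, map_smul, LinearMap.sum_apply, LinearMap.smul_apply]
    exact sum_mem fun i _ => Submodule.smul_mem _ _ (sum_mem fun j _ =>
      Submodule.smul_mem _ _ (h2 _ _))
  | zero => rw [map_zero]; exact zero_mem _
  | add x y _ _ hx hy => rw [map_add]; exact add_mem hx hy
  | smul c x _ hx => rw [map_smul]; exact Submodule.smul_mem _ c hx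

lemma IsReflSquare.eval_injective (hR : IsReflSquare τ β ε M) (hn : n ≠ 0) :
    Function.Injective (hR.eval (ρ := ρ)) := by
  rw [injective_iff_map_eq_zero]
  intro T hT
  refine Representation.IntertwiningMap.ext (LinearMap.ext fun x => ?_)
  have h1 : T (β (reflVec 0) (reflVec (Fin.last n))) = 0 := congrArg Subtype.val hT
  exact (Submodule.mem_bot ℂ).mp (hR.forall_mem hn (F := ⊥) (fun σ x hx => by
    rw [Submodule.mem_bot] at *; rw [hx, map_zero]) T (by rw [h1]; exact zero_mem _) x)

/-- The sum of the vectors `ρ σ x` over the permutations `σ` that move the first letter to `i` and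
the last one to `j`. -/
def moveEnds (ρ : Representation ℂ (Equiv.Perm (Fin (n + 1))) M) (x : M) (i j : Fin (n + 1)) : M :=
  ∑ σ ∈ Finset.univ.filter (fun σ : Equiv.Perm (Fin (n + 1)) => σ 0 = i ∧ σ (Fin.last n) = j),
    ρ σ x

lemma moveEnds_equivariant (x : M) (σ : Equiv.Perm (Fin (n + 1))) (i j : Fin (n + 1)) :
    ρ σ (moveEnds ρ x i j) = moveEnds ρ x (σ i) (σ j) := by
  unfold moveEnds
  rw [map_sum]
  refine Finset.sum_bij (fun π _ => σ * π) (fun π hπ => ?_) (fun π _ π' _ h => mul_left_cancel h)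
    (fun π hπ => ⟨σ⁻¹ * π, ?_, by simp⟩) fun π _ => ?_
  · simp only [Finset.mem_filter, Finset.mem_univ, true_and, Equiv.Perm.mul_apply] at hπ ⊢
    rw [hπ.1, hπ.2]; simp
  · simp only [Finset.mem_filter, Finset.mem_univ, true_and, Equiv.Perm.mul_apply] at hπ ⊢
    rw [hπ.1, hπ.2]; simp
  · rw [map_mul, Module.End.mul_apply]

lemma moveEnds_swap {x : M} (hx : x ∈ endsPart ρ ε) (i j : Fin (n + 1)) :
    moveEnds ρ x j i = ε • moveEnds ρ x i j := by
  unfold moveEnds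
  rw [Finset.smul_sum]
  refine Finset.sum_bij (fun π _ => π * Equiv.swap 0 (Fin.last n)) (fun π hπ => ?_)
    (fun π _ π' _ h => mul_right_cancel h)
    (fun π hπ => ⟨π * Equiv.swap 0 (Fin.last n), ?_, by simp [mul_assoc]⟩) fun π _ => ?_
  · simp only [Finset.mem_filter, Finset.mem_univ, true_and, Equiv.Perm.mul_apply] at hπ ⊢
    simp [hπ.1, hπ.2]
  · simp only [Finset.mem_filter, Finset.mem_univ, true_and, Equiv.Perm.mul_apply] at hπ ⊢
    simp [hπ.1, hπ.2]
  · rw [← map_smul, ← hx.2, ← Module.End.mul_apply, ← map_mul, mul_assoc, Equiv.swap_mul_self,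
      mul_one]

lemma moveEnds_ends {x : M} (hx : x ∈ endsPart ρ ε) :
    moveEnds ρ x 0 (Fin.last n) = ((fixEnds n).card : ℂ) • x := by
  unfold moveEnds
  rw [Nat.cast_smul_eq_nsmul, ← Finset.sum_const]
  exact Finset.sum_congr rfl fun σ hσ => hx.1 σ hσ

/-- Given `x`, the bilinear form `∑ v_i w_j μ_{ij}`, where `μ_{ij}` is the translate of `x` for
`i ≠ j` and the `μ_{ii}` are chosen to make the row sums vanish, defines the homomorphism with
value `x` (up to a factor). That it is `ε`-symmetric uses that the row sums of the translates are
all equal, being multiples of `Z`. -/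
lemma IsReflSquare.eval_surjective (hR : IsReflSquare τ β ε M) (hn : n ≠ 0) {Z : M}
    (hZ : HasOnePoint ρ Z) : Function.Surjective (hR.eval (ρ := ρ)) := by
  rintro ⟨x, hx⟩
  set r : M := ∑ j, moveEnds ρ x 0 j with hr
  have hr1 : ∀ σ, ρ σ r = ∑ j, moveEnds ρ x (σ 0) j := fun σ => by
    rw [hr, map_sum, Finset.sum_congr rfl fun j _ => moveEnds_equivariant x σ 0 j]
    exact Equiv.sum_comp σ fun j => moveEnds ρ x (σ 0) j
  have hr2 : ∀ σ, ρ σ r = r := hZ.fixed_of_stabilizer fun σ hσ => by rw [hr1, hσ]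
  have hrow : ∀ i, ∑ j, moveEnds ρ x i j = r := fun i => by
    have := hr1 (Equiv.swap 0 i)
    rw [hr2, Equiv.swap_apply_left] at this
    exact this.symm
  have hN : ((n : ℂ) + 1) ≠ 0 := by exact_mod_cast Nat.succ_ne_zero n
  have hεr : ε • r = r := by
    have h1 : ∑ i, ∑ j, moveEnds ρ x i j = ε • ∑ i, ∑ j, moveEnds ρ x i j := by
      conv_lhs => rw [Finset.sum_comm]
      simp only [Finset.smul_sum]
      exact Finset.sum_congr rfl fun i _ => Finset.sum_congr rfl fun j _ => moveEnds_swap hx i j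
    simp only [hrow, Finset.sum_const, Finset.card_univ, Fintype.card_fin] at h1
    rw [← Nat.cast_smul_eq_nsmul ℂ, smul_comm] at h1
    push_cast at h1
    exact (smul_right_injective M hN h1).symm
  set μ : Fin (n + 1) → Fin (n + 1) → M :=
    fun i j => moveEnds ρ x i j - if i = j then r else 0 with hμ
  have hμrow : ∀ i, ∑ j, μ i j = 0 := fun i => by
    simp [hμ, Finset.sum_sub_distrib, hrow]
  have hμsymm : ∀ i j, μ j i = ε • μ i j := fun i j => by
    simp only [hμ, smul_sub, moveEnds_swap hx i j, eq_comm (a := j) (b := i)]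
    split_ifs
    · rw [hεr]
    · rw [smul_zero]
  have hμeq : ∀ σ i j, ρ σ (μ i j) = μ (σ i) (σ j) := fun σ i j => by
    simp only [hμ, map_sub, moveEnds_equivariant, σ.injective.eq_iff]
    split_ifs
    · rw [hr2]
    · rw [map_zero]
  have hμcol : ∀ j, ∑ i, μ i j = 0 := fun j => by
    rw [Finset.sum_congr rfl fun i _ => hμsymm j i, ← Finset.smul_sum, hμrow, smul_zero]
  let γ : sumZero n →ₗ[ℂ] sumZero n →ₗ[ℂ] M := LinearMap.mk₂ ℂ
    (fun v w => ∑ i, v.1 i • ∑ j, w.1 j • μ i j)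
    (fun v v' w => by simp [add_smul, Finset.sum_add_distrib])
    (fun c v w => by simp [mul_smul, Finset.smul_sum])
    (fun v w w' => by simp [add_smul, smul_add, Finset.sum_add_distrib])
    (fun c v w => by
      simp only [Submodule.coe_smul, Pi.smul_apply, smul_eq_mul, mul_smul, Finset.smul_sum]
      exact Finset.sum_congr rfl fun i _ => Finset.sum_congr rfl fun j _ => smul_comm _ _ _)
  have hγ : ∀ v w, γ v w = ∑ i, v.1 i • ∑ j, w.1 j • μ i j := fun _ _ => rfl
  obtain ⟨T, hT⟩ := hR.lift γ fun v w => by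
    simp only [hγ, Finset.smul_sum]
    rw [Finset.sum_comm]
    refine Finset.sum_congr rfl fun i _ => Finset.sum_congr rfl fun j _ => ?_
    rw [hμsymm i j]
    simp only [smul_smul]
    congr 1
    ring
  have hTσ : ∀ σ y, T (τ σ y) = ρ σ (T y) := by
    intro σ y
    have hy : y ∈ Submodule.span ℂ {x | ∃ v w, x = β v w} := by rw [hR.span]; trivial
    induction hy using Submodule.span_induction with
    | mem y hy =>
      obtain ⟨v, w, rfl⟩ := hy
      rw [hR.equivariant, hT, hT, hγ, hγ]
      simp only [map_sum, map_smul, hμeq, reflRep_apply]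
      rw [← Equiv.sum_comp σ]
      refine Finset.sum_congr rfl fun i _ => ?_
      rw [Equiv.symm_apply_apply, ← Equiv.sum_comp σ]
      simp only [Equiv.symm_apply_apply]
    | zero => simp only [map_zero]
    | add x y _ _ hx hy => simp only [map_add, hx, hy]
    | smul c x _ hx => simp only [map_smul, hx]
  have hval : T (β (reflVec 0) (reflVec (Fin.last n))) = ((fixEnds n).card : ℂ) • x := by
    have h0 : (0 : Fin (n + 1)) ≠ Fin.last n :=
      fun h => hn (by simpa using congrArg Fin.val h.symm)
    rw [hT, hγ]
    simp only [sum_reflVec_smul _ (hμrow _)]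
    rw [sum_reflVec_smul _ (hμcol _)]
    simp only [hμ]
    rw [if_neg h0, sub_zero, moveEnds_ends hx]
  have hc : ((fixEnds n).card : ℂ) ≠ 0 := Nat.cast_ne_zero.mpr (fixEnds_nonempty n).card_pos.ne'
  refine ⟨((fixEnds n).card : ℂ)⁻¹ • T.intertwiningMap_of_isIntertwiningMap τ ρ hTσ, ?_⟩
  rw [map_smul]
  refine Subtype.ext ?_
  change ((fixEnds n).card : ℂ)⁻¹ • T (β (reflVec 0) (reflVec (Fin.last n))) = x
  rw [hval, smul_smul, inv_mul_cancel₀ hc, one_smul]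

/-- Frobenius reciprocity for the squares of the reflection representation. -/
def IsReflSquare.evalEquiv (hR : IsReflSquare τ β ε M) (hn : n ≠ 0) {Z : M}
    (hZ : HasOnePoint ρ Z) : τ.IntertwiningMap ρ ≃ₗ[ℂ] endsPart ρ ε :=
  LinearEquiv.ofBijective hR.eval ⟨hR.eval_injective hn, hR.eval_surjective hn hZ⟩

end Square

end Reflection

/-- A space with a basis of homogeneous vectors of distinct degrees. -/
lemma rank_of_graded_basis {H κ : Type*} [AddCommGroup H] [Module ℂ H] [Fintype κ]
    {e : κ → H} (hli : LinearIndependent ℂ e) (hsp : ∀ x, ∃ c : κ → ℂ, x = ∑ k, c k • e k)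
    {F : ℕ → Submodule ℂ H} {d : κ → ℕ} (hd : Function.Injective d) (he : ∀ k, e k ∈ F (d k))
    (hF : ∀ r (c : κ → ℂ), ∑ k, c k • e k ∈ F r → ∀ k, c k ≠ 0 → d k = r) :
    Module.rank ℂ H = (Fintype.card κ : ℕ) ∧ (⨆ r, F r) = ⊤ ∧
      ∀ r, (∀ k, d k = r → Module.rank ℂ (F r) = 1) ∧
        ((∀ k, d k ≠ r) → Module.rank ℂ (F r) = 0) := by
  refine ⟨?_, ?_, fun r => ⟨?_, fun hr => ?_⟩⟩
  · have hb := Module.Basis.mk hli (fun x _ => by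
      obtain ⟨c, rfl⟩ := hsp x
      exact sum_mem fun k _ => Submodule.smul_mem _ _ (Submodule.subset_span ⟨k, rfl⟩))
    rw [rank_eq_card_basis hb]
  · rw [eq_top_iff]
    intro x _
    obtain ⟨c, rfl⟩ := hsp x
    exact sum_mem fun k _ => Submodule.smul_mem _ _ (Submodule.mem_iSup_of_mem (d k) (he k))
  · rintro k rfl
    have : F (d k) = Submodule.span ℂ {e k} := by
      refine le_antisymm (fun x hx => ?_) ?_
      · obtain ⟨c, rfl⟩ := hsp x
        refine sum_mem fun l _ => ?_
        by_cases hl : c l = 0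
        · rw [hl, zero_smul]; exact zero_mem _
        · rw [hd (hF _ c hx l hl)]
          exact Submodule.smul_mem _ _ (Submodule.mem_span_singleton_self _)
      · rw [Submodule.span_singleton_le_iff_mem]; exact he k
    rw [this, rank_submodule_eq_one_iff]
    exact ⟨e k, Submodule.mem_span_singleton_self _, hli.ne_zero k, le_refl _⟩
  · have : F r = ⊥ := by
      rw [eq_bot_iff]
      intro x hx
      obtain ⟨c, rfl⟩ := hsp x
      rw [Submodule.mem_bot]
      refine Finset.sum_eq_zero fun k _ => ?_
      by_cases hk : c k = 0
      · rw [hk, zero_smul]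
      · exact absurd (hF r c hx k hk) (hr k)
    rw [this, rank_bot]

/-! ### The exterior and symmetric squares -/

section Squares

lemma update_pair_one {E : Type*} (v w x : E) : Function.update ![v, w] 1 x = ![v, x] := by
  ext i; fin_cases i <;> rfl

lemma update_pair_zero {E : Type*} (v w x : E) : Function.update ![v, w] 0 x = ![x, w] := by
  ext i; fin_cases i <;> rfl

lemma eq_pair {E : Type*} (m : Fin 2 → E) : m = ![m 0, m 1] := by
  ext i; fin_cases i <;> rfl

variable {E N : Type*} [AddCommGroup E] [Module ℂ E] [AddCommGroup N] [Module ℂ N]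

/-- A multilinear map in two arguments as a bilinear map. -/
def pairing (f : MultilinearMap ℂ (fun _ : Fin 2 => E) N) : E →ₗ[ℂ] E →ₗ[ℂ] N :=
  LinearMap.mk₂ ℂ (fun v w => f ![v, w])
    (fun v v' w => by simpa only [update_pair_zero] using f.map_update_add ![v, w] 0 v v')
    (fun c v w => by simpa only [update_pair_zero] using f.map_update_smul ![v, w] 0 c v)
    (fun v w w' => by simpa only [update_pair_one] using f.map_update_add ![v, w] 1 w w')
    (fun c v w => by simpa only [update_pair_one] using f.map_update_smul ![v, w] 1 c w)

/-- A bilinear map as a multilinear map in two arguments. -/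
def ofPairing (γ : E →ₗ[ℂ] E →ₗ[ℂ] N) : MultilinearMap ℂ (fun _ : Fin 2 => E) N :=
  MultilinearMap.mk' (fun m => γ (m 0) (m 1))
    (fun m i x y => by fin_cases i <;> simp)
    (fun m i c x => by fin_cases i <;> simp)

lemma ofPairing_apply (γ : E →ₗ[ℂ] E →ₗ[ℂ] N) (m : Fin 2 → E) :
    ofPairing γ m = γ (m 0) (m 1) := rfl

/-- The exterior product `v ∧ w`. -/
def wedge (E : Type*) [AddCommGroup E] [Module ℂ E] : E →ₗ[ℂ] E →ₗ[ℂ] ⋀[ℂ]^2 E :=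
  pairing (exteriorPower.ιMulti ℂ 2).toMultilinearMap

lemma wedge_apply (v w : E) : wedge E v w = exteriorPower.ιMulti ℂ 2 ![v, w] := rfl

lemma isReflSquare_extSq (n : ℕ) (M : Type*) [AddCommGroup M] [Module ℂ M] :
    IsReflSquare (extSq (reflRep n)) (wedge (sumZero n)) (-1) M where
  span := by
    rw [eq_top_iff, ← exteriorPower.ιMulti_span ℂ 2 (sumZero n), Submodule.span_le]
    rintro _ ⟨m, rfl⟩
    exact Submodule.subset_span ⟨m 0, m 1, by rw [wedge_apply, ← eq_pair]⟩
  equivariant σ v w := by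
    rw [wedge_apply, wedge_apply]
    refine (exteriorPower.map_apply_ιMulti _ _).trans (congrArg _ ?_)
    ext i : 1
    fin_cases i <;> rfl
  symm v w := by
    rw [wedge_apply, wedge_apply, neg_one_smul,
      ← AlternatingMap.map_swap _ ![v, w] (zero_ne_one (α := Fin 2))]
    congr 1
    ext i : 1
    fin_cases i <;> rfl
  lift γ hγ := by
    have h0 : ∀ v, γ v v = 0 := fun v => by
      have h := hγ v v
      rw [neg_one_smul, eq_neg_iff_add_eq_zero, ← two_smul ℂ] at h
      exact (smul_eq_zero.mp h).resolve_left two_ne_zero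
    refine ⟨exteriorPower.alternatingMapLinearEquiv
      { ofPairing γ with
        map_eq_zero_of_eq' := fun m i j h hij => ?_ }, fun v w => ?_⟩
    · change γ (m 0) (m 1) = 0
      have h01 : m 0 = m 1 := by
        fin_cases i <;> fin_cases j <;> first | exact absurd rfl hij | exact h | exact h.symm
      rw [h01, h0]
    · rw [wedge_apply, exteriorPower.alternatingMapLinearEquiv_apply_ιMulti]
      rfl

/-- The symmetric product `v w`. -/
def symProd (E : Type*) [AddCommGroup E] [Module ℂ E] :
    E →ₗ[ℂ] E →ₗ[ℂ] SymmetricPower ℂ (Fin 2) E :=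
  pairing (SymmetricPower.tprod ℂ)

lemma symProd_apply (v w : E) : symProd E v w = SymmetricPower.tprod ℂ ![v, w] := rfl

/-- The linear map out of the symmetric square attached to a symmetric bilinear map. -/
def symLift (γ : E →ₗ[ℂ] E →ₗ[ℂ] N) (hγ : ∀ v w, γ w v = γ v w) :
    SymmetricPower ℂ (Fin 2) E →ₗ[ℂ] N where
  __ := AddCon.lift _ (PiTensorProduct.lift (ofPairing γ)).toAddMonoidHom
    (AddCon.addConGen_le.mpr fun x y h => by
      cases h with
      | perm e f =>
        rw [AddCon.ker_rel]
        simp only [LinearMap.toAddMonoidHom_coe, PiTensorProduct.lift.tprod, ofPairing_apply]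
        have he : (e 0 = 0 ∧ e 1 = 1) ∨ (e 0 = 1 ∧ e 1 = 0) := by
          revert e; decide
        rcases he with ⟨h0, h1⟩ | ⟨h0, h1⟩
        · rw [h0, h1]
        · rw [h0, h1, hγ])
  map_smul' c x := by
    induction x using AddCon.induction_on with
    | H x => exact map_smul (PiTensorProduct.lift (ofPairing γ)) c x

lemma symLift_symProd (γ : E →ₗ[ℂ] E →ₗ[ℂ] N) (hγ : ∀ v w, γ w v = γ v w) (v w : E) :
    symLift γ hγ (symProd E v w) = γ v w :=
  PiTensorProduct.lift.tprod (φ := ofPairing γ) ![v, w]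

lemma isReflSquare_symSq (n : ℕ) (M : Type*) [AddCommGroup M] [Module ℂ M] :
    IsReflSquare (symSq (reflRep n)) (symProd (sumZero n)) 1 M where
  span := by
    rw [eq_top_iff, ← SymmetricPower.span_tprod_eq_top, Submodule.span_le]
    rintro _ ⟨m, rfl⟩
    exact Submodule.subset_span ⟨m 0, m 1, by rw [symProd_apply, ← eq_pair]⟩
  equivariant σ v w := by
    rw [symProd_apply, symProd_apply]
    refine (symMap_mk _ _ _).trans ((congrArg _ (PiTensorProduct.map_tprod _ _)).trans
      (congrArg (SymmetricPower.tprod ℂ) ?_))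
    ext i : 1
    fin_cases i <;> rfl
  symm v w := by
    rw [symProd_apply, symProd_apply, one_smul,
      ← SymmetricPower.tprod_equiv (Equiv.swap 0 1) ![v, w]]
    congr 1
    ext i : 1
    fin_cases i <;> rfl
  lift γ hγ := ⟨symLift γ fun v w => by rw [hγ, one_smul],
    fun v w => symLift_symProd γ _ v w⟩

end Squares

/-! ### The complement of `𝔥 ⊕ ℂ` in the symmetric square -/

section Complement

variable {n : ℕ} {R : Type} [AddCommGroup R] [Module ℂ R]
  {τ : Representation ℂ (Equiv.Perm (Fin (n + 1))) R} {β : sumZero n →ₗ[ℂ] sumZero n →ₗ[ℂ] R}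

/-- The coordinatewise product of two vectors. -/
def coordMul (n : ℕ) : sumZero n →ₗ[ℂ] sumZero n →ₗ[ℂ] (Fin (n + 1) → ℂ) :=
  (LinearMap.mul ℂ (Fin (n + 1) → ℂ)).domRestrict₁₂ (sumZero n) (sumZero n)

lemma coordMul_apply (v w : sumZero n) (i : Fin (n + 1)) : coordMul n v w i = v.1 i * w.1 i := rfl

/-- The map `x ↦ ∑ x_i (a u_i² + b ∑_j u_j²)` from `ℂ^{n+1}` to the symmetric square, where
`u_i = reflVec i`. -/
def sqSection (β : sumZero n →ₗ[ℂ] sumZero n →ₗ[ℂ] R) (a b : ℂ) : (Fin (n + 1) → ℂ) →ₗ[ℂ] R :=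
  ∑ i, (LinearMap.proj i : (Fin (n + 1) → ℂ) →ₗ[ℂ] ℂ).smulRight
    (a • β (reflVec i) (reflVec i) + b • ∑ j, β (reflVec j) (reflVec j))

lemma sqSection_apply (a b : ℂ) (x : Fin (n + 1) → ℂ) :
    sqSection β a b x =
      ∑ i, x i • (a • β (reflVec i) (reflVec i) + b • ∑ j, β (reflVec j) (reflVec j)) := by
  simp [sqSection, LinearMap.sum_apply]

lemma sqSection_equivariant (hβ : ∀ σ v w, τ σ (β v w) = β (reflRep n σ v) (reflRep n σ w))
    (a b : ℂ) (σ : Equiv.Perm (Fin (n + 1))) (x : Fin (n + 1) → ℂ) :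
    τ σ (sqSection β a b x) = sqSection β a b (permRep n σ x) := by
  rw [sqSection_apply, sqSection_apply]
  conv_rhs => rw [← Equiv.sum_comp σ]
  have h : ∑ j, β (reflVec (σ j)) (reflVec (σ j)) = ∑ j, β (reflVec j) (reflVec j) :=
    Equiv.sum_comp σ fun j => β (reflVec j) (reflVec j)
  simp only [map_sum, map_smul, map_add, hβ, reflRep_reflVec, h]
  refine Finset.sum_congr rfl fun i _ => ?_
  rw [show permRep n σ x (σ i) = x i from congrArg x (σ.symm_apply_apply i)]

lemma sum_sq_reflVec (k : Fin (n + 1)) :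
    ∑ j, (reflVec j).1 k * (reflVec j).1 k = 1 - ((n : ℂ) + 1)⁻¹ := by
  have h : ((n : ℂ) + 1) ≠ 0 := by exact_mod_cast Nat.succ_ne_zero n
  have : ∀ j : Fin (n + 1), (reflVec j).1 k * (reflVec j).1 k =
      (if k = j then 1 - 2 * ((n : ℂ) + 1)⁻¹ else 0) + ((n : ℂ) + 1)⁻¹ * ((n : ℂ) + 1)⁻¹ := by
    intro j
    rw [reflVec_apply]
    split_ifs <;> ring
  simp only [this, Finset.sum_add_distrib, Finset.sum_ite_eq, Finset.mem_univ, if_true,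
    Finset.sum_const, Finset.card_univ, Fintype.card_fin, nsmul_eq_mul]
  push_cast
  rw [← mul_assoc, mul_inv_cancel₀ h]
  ring

/-- For suitable constants `sqSection` is a section of the map `v w ↦ (v_i w_i)` from the
symmetric square to `ℂ^{n+1}`. -/
lemma exists_coordMul_sqSection (hn : 2 ≤ n) {π : R →ₗ[ℂ] (Fin (n + 1) → ℂ)}
    (hπ : ∀ v w, π (β v w) = coordMul n v w) : ∃ a b : ℂ, ∀ x, π (sqSection β a b x) = x := by
  set N : ℂ := (n : ℂ) + 1 with hN
  have h0 : N ≠ 0 := by rw [hN]; exact_mod_cast Nat.succ_ne_zero n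
  have h1 : N - 1 ≠ 0 := by
    rw [hN, add_sub_cancel_right]; exact Nat.cast_ne_zero.mpr (by omega)
  have h2 : N - 2 ≠ 0 := by
    rw [hN, show (n : ℂ) + 1 - 2 = (n : ℂ) - 1 by ring, sub_ne_zero]
    exact_mod_cast (show n ≠ 1 by omega)
  -- The diagonal coefficient `a (1 - 2 / N)` is `1` and `a / N ^ 2 + b (1 - 1 / N)` is `0`.
  refine ⟨N / (N - 2), -(1 / ((N - 2) * (N - 1))), fun x => funext fun k => ?_⟩
  have h3 : ∀ i : Fin (n + 1),
      N / (N - 2) * ((reflVec i).1 k * (reflVec i).1 k) +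
        -(1 / ((N - 2) * (N - 1))) * (1 - N⁻¹) = if k = i then 1 else 0 := by
    intro i
    rw [reflVec_apply, ← hN]
    split_ifs <;> field_simp <;> ring
  rw [sqSection_apply, map_sum, Finset.sum_apply]
  have h4 : ∀ i : Fin (n + 1), π (x i • (N / (N - 2)) • β (reflVec i) (reflVec i) +
      x i • -(1 / ((N - 2) * (N - 1))) • ∑ j, β (reflVec j) (reflVec j)) k =
      x i * if k = i then 1 else 0 := by
    intro i
    rw [← h3 i, ← sum_sq_reflVec k]
    simp only [map_add, map_smul, map_sum, hπ, Pi.add_apply, Pi.smul_apply, Finset.sum_apply,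
      coordMul_apply, smul_eq_mul]
    ring
  simp only [smul_add, h4]
  simp

/-- The symmetric square splits off `ℂ^{n+1} = 𝔥 ⊕ ℂ`. -/
lemma IsReflSquare.exists_complement (hR : IsReflSquare τ β 1 (Fin (n + 1) → ℂ)) (hn : 2 ≤ n) :
    ∃ (W : Type) (_ : AddCommGroup W) (_ : Module ℂ W)
      (υ : Representation ℂ (Equiv.Perm (Fin (n + 1))) W),
      Nonempty ((υ.prod ((reflRep n).prod (Representation.trivial ℂ _ ℂ))).Equiv τ) := by
  obtain ⟨π, hπ⟩ := hR.lift (coordMul n) fun v w => by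
    ext i; rw [one_smul, coordMul_apply, coordMul_apply, mul_comm]
  obtain ⟨a, b, hs⟩ := exists_coordMul_sqSection hn hπ
  have hπσ : ∀ σ x, π (τ σ x) = permRep n σ (π x) := by
    intro σ x
    have hx : x ∈ Submodule.span ℂ {x | ∃ v w, x = β v w} := by rw [hR.span]; trivial
    induction hx using Submodule.span_induction with
    | mem x hx =>
      obtain ⟨v, w, rfl⟩ := hx
      rw [hR.equivariant, hπ, hπ]; rfl
    | zero => simp only [map_zero]
    | add x y _ _ hx hy => simp only [map_add, hx, hy]
    | smul c x _ hx => simp only [map_smul, hx]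
  set s := sqSection β a b with hsdef
  let υ : Representation ℂ (Equiv.Perm (Fin (n + 1))) (LinearMap.ker π) :=
    τ.subrepresentation (LinearMap.ker π) fun σ x (hx : π x = 0) => by
      change π (τ σ x) = 0
      rw [hπσ, hx, map_zero]
  let one : ℂ →ₗ[ℂ] (Fin (n + 1) → ℂ) := LinearMap.toSpanSingleton ℂ _ 1
  let f : LinearMap.ker π × (sumZero n × ℂ) →ₗ[ℂ] R :=
    (LinearMap.ker π).subtype.coprod (s ∘ₗ (sumZero n).subtype.coprod one)
  have hf : ∀ w v c, f (w, (v, c)) = w.1 + s (v.1 + fun _ => c) := fun w v c => by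
    change w.1 + s (v.1 + c • 1) = _
    congr 3
    ext; simp
  have hN : ((n : ℂ) + 1) ≠ 0 := by exact_mod_cast Nat.succ_ne_zero n
  have hbij : Function.Bijective f := by
    constructor
    · rw [injective_iff_map_eq_zero]
      rintro ⟨w, v, c⟩ h
      rw [hf] at h
      have h1 : v.1 + (fun _ => c) = 0 := by
        have := congrArg π h
        rwa [map_add, hs, w.2, zero_add, map_zero] at this
      have h2 : c = 0 := by
        have h3 : ∑ i, (v.1 + fun _ => c : Fin (n + 1) → ℂ) i = 0 := by rw [h1]; simp
        simp only [Pi.add_apply, Finset.sum_add_distrib, sumZero_sum, zero_add, Finset.sum_const,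
          Finset.card_univ, Fintype.card_fin, nsmul_eq_mul] at h3
        push_cast at h3
        exact (mul_eq_zero.mp h3).resolve_left hN
      have h4 : v = 0 := by
        refine Subtype.ext (funext fun i => ?_)
        have := congrFun h1 i
        rwa [Pi.add_apply, h2, add_zero] at this
      have h5 : w = 0 := by
        refine Subtype.ext ?_
        rwa [h1, map_zero, add_zero] at h
      rw [h2, h4, h5]; rfl
    · intro x
      set c := (∑ i, π x i) / ((n : ℂ) + 1) with hc
      refine ⟨(⟨x - s (π x), ?_⟩, (⟨π x - fun _ => c, ?_⟩, c)), ?_⟩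
      · rw [LinearMap.mem_ker, map_sub, hs, sub_self]
      · change ∑ i, (π x - fun _ => c : Fin (n + 1) → ℂ) i = 0
        simp only [Pi.sub_apply, Finset.sum_sub_distrib, Finset.sum_const, Finset.card_univ,
          Fintype.card_fin, nsmul_eq_mul]
        push_cast
        rw [hc, mul_div_cancel₀ _ hN, sub_self]
      · rw [hf, sub_add_cancel, sub_add_cancel]
  refine ⟨LinearMap.ker π, inferInstance, inferInstance, υ,
    ⟨Representation.Equiv.mk (LinearEquiv.ofBijective f hbij) fun σ => ?_⟩⟩
  refine LinearMap.ext fun ⟨w, v, c⟩ => ?_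
  change f (υ σ w, (reflRep n σ v, c)) = τ σ (f (w, (v, c)))
  rw [hf, hf, map_add (τ σ), hsdef, sqSection_equivariant hR.equivariant]
  rfl

end Complement

/-! ### Graded bases of the spaces of homomorphisms -/

section GradedBases

variable {m : ℕ} {M : Type*} [AddCommGroup M] [Module ℂ M]

/-- The properties of the representation `ρ` on the invariant operators in `m + 1` functions from
which the spaces of homomorphisms are determined: `G r` is the part of order `r`, `Z` is the
multiplication operator, and `v 0, …, v m`, with `v b` of order `2 b`, is a basis of the vectors
fixed by all permutations that fix the first and the last letter. The field `separated` expresses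
that the parts of different orders are independent. -/
structure IsGradedModel (ρ : Representation ℂ (Equiv.Perm (Fin (m + 1 + 1))) M)
    (G : ℕ → Submodule ℂ M) (Z : M) (v : ℕ → M) : Prop where
  onePoint : HasOnePoint ρ Z
  ne_zero : Z ≠ 0
  zero_mem : Z ∈ G 0
  stable : ∀ r σ, ∀ x ∈ G r, ρ σ x ∈ G r
  separated : ∀ (K r : ℕ) (B : Fin K → M) (d : Fin K → ℕ), (∀ k, B k ∈ G (d k)) →
    ∀ c : Fin K → ℂ, ∑ k, c k • B k ∈ G r → ∑ k, (c k * ((d k : ℂ) - r)) • B k = 0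
  linearIndependent : LinearIndependent ℂ fun b : Fin (m + 1) => v b
  fixed : ∀ b, ∀ σ ∈ fixEnds (m + 1), ρ σ (v b) = v b
  swap : ∀ b ≤ m, ρ (Equiv.swap 0 (Fin.last (m + 1))) (v b) = (-1 : ℂ) ^ b • v b
  mem : ∀ b ≤ m, v b ∈ G (2 * b)
  exists_sum : ∀ x, (∀ σ ∈ fixEnds (m + 1), ρ σ x = x) →
    ∃ c : ℕ → ℂ, x = ∑ b ∈ Finset.range (m + 1), c b • v b

variable {ρ : Representation ℂ (Equiv.Perm (Fin (m + 1 + 1))) M} {G : ℕ → Submodule ℂ M}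
  {Z : M} {v : ℕ → M}

/-- The exchange of the first and the last letter acts on `v b` by `(-1) ^ b`, so its eigenspaces
are spanned by the `v b` with `b` even, respectively odd. -/
lemma IsGradedModel.exists_sum_of_mem_endsPart (h : IsGradedModel ρ G Z v) {s K : ℕ} (hs : s < 2)
    (hK : K = (m + 2 - s) / 2) {x : M} (hx : x ∈ endsPart ρ ((-1) ^ s)) :
    ∃ c : Fin K → ℂ, x = ∑ k, c k • v (2 * k + s) := by
  obtain ⟨c, hc⟩ := h.exists_sum x hx.1
  have h1 : ∑ b : Fin (m + 1), (c b * ((-1) ^ (b : ℕ) - (-1) ^ s)) • v b = 0 := by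
    have h2 := hx.2
    rw [hc, map_sum, Finset.smul_sum, ← sub_eq_zero, ← Finset.sum_sub_distrib] at h2
    rw [← h2, ← Fin.sum_univ_eq_sum_range (fun b =>
      ρ (Equiv.swap 0 (Fin.last (m + 1))) (c b • v b) - (-1 : ℂ) ^ s • c b • v b)]
    refine Finset.sum_congr rfl fun b _ => ?_
    rw [map_smul, h.swap _ (Nat.lt_succ_iff.mp b.2), mul_sub, sub_smul, mul_smul,
      mul_comm (c b), mul_smul]
  have h3 : ∀ b ∈ Finset.range (m + 1), b % 2 ≠ s → c b = 0 := by
    intro b hb hbs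
    have h4 := Fintype.linearIndependent_iff.mp h.linearIndependent _ h1
      ⟨b, Finset.mem_range.mp hb⟩
    refine (mul_eq_zero.mp h4).resolve_right ?_
    rcases Nat.even_or_odd b with he | ho
    · have : s = 1 := by have := Nat.even_iff.mp he; omega
      rw [he.neg_one_pow, this]; norm_num
    · have : s = 0 := by have := Nat.odd_iff.mp ho; omega
      rw [ho.neg_one_pow, this]; norm_num
  refine ⟨fun k => c (2 * k + s), ?_⟩
  rw [hc, Fin.sum_univ_eq_sum_range (fun k => c (2 * k + s) • v (2 * k + s)),
    ← Finset.sum_image (f := fun b => c b • v b) (g := fun k => 2 * k + s)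
      (fun a _ b _ (h : 2 * a + s = 2 * b + s) => by omega)]
  refine (Finset.sum_subset (fun b hb => ?_) fun b hb hb' => ?_).symm
  · obtain ⟨k, hk, rfl⟩ := Finset.mem_image.mp hb
    rw [Finset.mem_range] at hk ⊢
    omega
  · rw [h3 b hb fun hbs => hb' ?_, zero_smul]
    rw [Finset.mem_range] at hb
    exact Finset.mem_image.mpr ⟨b / 2, by rw [Finset.mem_range]; omega, by omega⟩

/-- A family of homomorphisms is a basis of all homomorphisms, its `k`-th member takes values of
order `d k`, and a combination with values of order `r` involves only members with `d k = r`. -/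
structure IsHomogeneousBasis {R : Type*} [AddCommGroup R] [Module ℂ R]
    {τ : Representation ℂ (Equiv.Perm (Fin (m + 1 + 1))) R} {K : ℕ} (G : ℕ → Submodule ℂ M)
    (d : Fin K → ℕ) (e : Fin K → τ.IntertwiningMap ρ) : Prop where
  linearIndependent : LinearIndependent ℂ e
  exists_sum : ∀ T, ∃ c : Fin K → ℂ, T = ∑ k, c k • e k
  mem : ∀ k x, e k x ∈ G (d k)
  eq_of_mem : ∀ r (c : Fin K → ℂ), (∀ x, (∑ k, c k • e k : τ.IntertwiningMap ρ) x ∈ G r) →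
    ∀ k, c k ≠ 0 → d k = r

variable {R : Type*} [AddCommGroup R] [Module ℂ R]
  {τ : Representation ℂ (Equiv.Perm (Fin (m + 1 + 1))) R}
  {β : sumZero (m + 1) →ₗ[ℂ] sumZero (m + 1) →ₗ[ℂ] R}

/-- The homomorphisms from the exterior (`s = 1`) or symmetric (`s = 0`) square have a basis of
homomorphisms of orders `2 s, 2 s + 4, 2 s + 8, …`. -/
lemma IsGradedModel.exists_basis (h : IsGradedModel ρ G Z v) {s K : ℕ} (hs : s < 2)
    (hK : K = (m + 2 - s) / 2) (hR : IsReflSquare τ β ((-1) ^ s) M) :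
    ∃ e : Fin K → τ.IntertwiningMap ρ,
      IsHomogeneousBasis G (fun k => 2 * (2 * (k : ℕ) + s)) e := by
  have hlt : ∀ k : Fin K, 2 * (k : ℕ) + s < m + 1 := fun k => by
    have := k.2; omega
  have hn : m + 1 ≠ 0 := Nat.succ_ne_zero m
  let Φ := hR.evalEquiv (ρ := ρ) hn h.onePoint
  let y : Fin K → endsPart ρ ((-1) ^ s) :=
    fun k => ⟨v (2 * k + s), fun σ hσ => h.fixed _ σ hσ, by
        rw [h.swap _ (Nat.lt_succ_iff.mp (hlt k)), pow_add, pow_mul]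
        norm_num⟩
  have hli : LinearIndependent ℂ fun k : Fin K => v (2 * (k : ℕ) + s) :=
    h.linearIndependent.comp
      (fun k : Fin K => (⟨2 * k + s, hlt k⟩ : Fin (m + 1))) fun a b h => by
        have := congrArg Fin.val h
        exact Fin.ext (by simpa using this)
  have hord : ∀ k : Fin K, v (2 * (k : ℕ) + s) ∈ G (2 * (2 * (k : ℕ) + s)) :=
    fun k => h.mem _ (Nat.lt_succ_iff.mp (hlt k))
  have hval : ∀ k, Φ.symm (y k) (β (reflVec 0) (reflVec (Fin.last (m + 1)))) =
      v (2 * k + s) := fun k =>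
    congrArg Subtype.val (Φ.apply_symm_apply (y k))
  refine ⟨fun k => Φ.symm (y k), ?_, fun T => ?_, fun k x => ?_, fun r c hc k hk => ?_⟩
  · refine LinearIndependent.map' ?_ Φ.symm.toLinearMap Φ.symm.ker
    exact LinearIndependent.of_comp (Submodule.subtype _) hli
  · obtain ⟨c, hc⟩ := h.exists_sum_of_mem_endsPart hs hK (Φ T).2
    refine ⟨c, Φ.injective ?_⟩
    rw [map_sum]
    refine Subtype.ext (hc.trans ?_)
    simp only [map_smul, LinearEquiv.apply_symm_apply, Submodule.coe_sum, Submodule.coe_smul]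
    rfl
  · refine hR.forall_mem hn (h.stable _) _ ?_ x
    rw [hval]
    exact hord k
  · have h1 := hc (β (reflVec 0) (reflVec (Fin.last (m + 1))))
    rw [Representation.IntertwiningMap.sum_apply] at h1
    simp only [Representation.IntertwiningMap.smul_apply, hval] at h1
    have h2 := Fintype.linearIndependent_iff.mp hli _ (h.separated _ _ _ _ hord c h1) k
    have h3 := sub_eq_zero.mp ((mul_eq_zero.mp h2).resolve_left hk)
    exact_mod_cast h3

/-- The homomorphisms from a complement of `𝔥 ⊕ ℂ` in the symmetric square. In the basis of the
homomorphisms from the symmetric square, the member of order `0` comes from the trivial summand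
and the others vanish on `𝔥 ⊕ ℂ`. -/
lemma IsGradedModel.exists_basis_complement (h : IsGradedModel ρ G Z v)
    (hR : IsReflSquare τ β 1 M) {W : Type*} [AddCommGroup W] [Module ℂ W]
    {υ : Representation ℂ (Equiv.Perm (Fin (m + 1 + 1))) W}
    (ψ : (υ.prod ((reflRep (m + 1)).prod (Representation.trivial ℂ _ ℂ))).Equiv τ) :
    ∃ e : Fin (m / 2) → υ.IntertwiningMap ρ,
      IsHomogeneousBasis G (fun k => 4 * ((k : ℕ) + 1)) e := by
  obtain ⟨e, he⟩ := h.exists_basis (s := 0) (K := m / 2 + 1) two_pos (by omega)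
    (by rwa [pow_zero])
  let i : υ.IntertwiningMap τ := ψ.toIntertwiningMap.comp (.inl ℂ υ _)
  let j : (reflRep (m + 1)).IntertwiningMap τ :=
    (ψ.toIntertwiningMap.comp (.inr ℂ υ _)).comp (.inl ℂ _ _)
  let t : (Representation.trivial ℂ (Equiv.Perm (Fin (m + 1 + 1))) ℂ).IntertwiningMap τ :=
    (ψ.toIntertwiningMap.comp (.inr ℂ υ _)).comp (.inr ℂ _ _)
  let p : τ.IntertwiningMap υ := (Representation.IntertwiningMap.fst ℂ υ _).comp
    ψ.symm.toIntertwiningMap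
  let q : τ.IntertwiningMap (Representation.trivial ℂ (Equiv.Perm (Fin (m + 1 + 1))) ℂ) :=
    ((Representation.IntertwiningMap.snd ℂ _ _).comp
      (Representation.IntertwiningMap.snd ℂ υ _)).comp ψ.symm.toIntertwiningMap
  have hpi : ∀ w, p (i w) = w := fun w => congrArg Prod.fst (ψ.symm_apply_apply (w, 0))
  have hqi : ∀ w, q (i w) = 0 := fun w =>
    congrArg (fun x => x.2.2) (ψ.symm_apply_apply (w, 0))
  have hqt : ∀ c, q (t c) = c := fun c =>
    congrArg (fun x => x.2.2) (ψ.symm_apply_apply (0, (0, c)))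
  have hsum : ∀ x, ∃ w u c, x = i w + j u + t c := fun x => by
    refine ⟨(ψ.symm x).1, (ψ.symm x).2.1, (ψ.symm x).2.2, ?_⟩
    have h1 : i (ψ.symm x).1 + j (ψ.symm x).2.1 + t (ψ.symm x).2.2 =
        ψ.toIntertwiningMap (((ψ.symm x).1, 0) + (0, ((ψ.symm x).2.1, 0)) +
          (0, (0, (ψ.symm x).2.2))) := by
      rw [map_add, map_add]; rfl
    rw [h1]
    simp
  have hTj : ∀ (T : τ.IntertwiningMap ρ) u, T (j u) = 0 := fun T u => by
    have := h.onePoint.hom_reflRep_eq_zero (T.comp j)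
    exact congrArg (fun S : (reflRep (m + 1)).IntertwiningMap ρ => S u) this
  have hTt : ∀ (T : τ.IntertwiningMap ρ) c, ∃ a : ℂ, T (t c) = a • Z := fun T c =>
    h.onePoint.exists_smul _ fun σ _ =>
    (Representation.IntertwiningMap.isIntertwining _ _ (T.comp t) σ c).symm
  have het : ∀ (k : Fin (m / 2)) c, e k.succ (t c) = 0 := by
    intro k c
    obtain ⟨a, ha⟩ := hTt (e k.succ) c
    have h1 := he.mem k.succ (t c)
    have h2 := h.separated 1 0 (fun _ => e k.succ (t c))
      (fun _ => 2 * (2 * (k.succ : ℕ) + 0)) (fun _ => h1) 1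
      (by rw [Fin.sum_univ_one, Pi.one_apply, one_smul, ha]
          exact Submodule.smul_mem _ _ h.zero_mem)
    rw [Fin.sum_univ_one] at h2
    refine (smul_eq_zero.mp h2).resolve_left ?_
    rw [Pi.one_apply, one_mul, Nat.cast_zero, sub_zero]
    exact Nat.cast_ne_zero.mpr (by rw [Fin.val_succ]; omega)
  have he0 : ∀ w, e 0 (i w) = 0 := by
    -- The projection to the trivial summand, followed by `1 ↦ Z`, has order `0`, so it is a
    -- nonzero multiple of `e 0`.
    let T : τ.IntertwiningMap ρ := LinearMap.intertwiningMap_of_isIntertwiningMap τ ρ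
      ((LinearMap.toSpanSingleton ℂ M Z) ∘ₗ q.toLinearMap) fun σ x => by
        change q (τ σ x) • Z = ρ σ (q x • Z)
        rw [q.isIntertwining, map_smul, h.onePoint.fixed]
        rfl
    have hT : ∀ x, T x = q x • Z := fun _ => rfl
    obtain ⟨c, hc⟩ := he.exists_sum T
    have h1 := he.eq_of_mem 0 c fun x => by
      rw [← hc, hT]; exact Submodule.smul_mem _ _ h.zero_mem
    have h2 : ∀ k : Fin (m / 2), c k.succ = 0 := fun k => by
      by_contra h3
      have := h1 _ h3
      rw [Fin.val_succ] at this
      omega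
    have h3 : T = c 0 • e 0 := by
      rw [hc, Fin.sum_univ_succ, Finset.sum_eq_zero, add_zero]
      intro k _
      rw [h2, zero_smul]
    intro w
    have h4 : T (i w) = c 0 • e 0 (i w) := by rw [h3]; rfl
    rw [hT, hqi, zero_smul] at h4
    refine (smul_eq_zero.mp h4.symm).resolve_left fun h5 => ?_
    have h6 := hT (t 1)
    rw [hqt, one_smul, h3, h5, zero_smul] at h6
    exact h.ne_zero h6.symm
  have hsplit : ∀ (c : Fin (m / 2) → ℂ) w u a,
      (∑ k, c k • e k.succ : τ.IntertwiningMap ρ) (i w + j u + t a) =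
        (∑ k, c k • (e k.succ).comp i : υ.IntertwiningMap ρ) w := by
    intro c w u a
    rw [map_add, map_add, hTj, add_zero]
    simp only [Representation.IntertwiningMap.sum_apply, Representation.IntertwiningMap.smul_apply,
      het, smul_zero, Finset.sum_const_zero, add_zero]
    rfl
  refine ⟨fun k => (e k.succ).comp i, ?_, fun T => ?_, fun k x => ?_, fun r c hc k hk => ?_⟩
  · rw [Fintype.linearIndependent_iff]
    intro c hc k
    have h1 : ∑ k, c k • e k.succ = 0 := by
      refine Representation.IntertwiningMap.ext (LinearMap.ext fun x => ?_)
      obtain ⟨w, u, a, rfl⟩ := hsum x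
      exact (hsplit c w u a).trans (by rw [hc]; rfl)
    exact Fintype.linearIndependent_iff.mp
      (he.linearIndependent.comp Fin.succ (Fin.succ_injective _)) c h1 k
  · obtain ⟨c, hc⟩ := he.exists_sum (T.comp p)
    refine ⟨fun k => c k.succ, Representation.IntertwiningMap.ext (LinearMap.ext fun w => ?_)⟩
    have h1 : T w = (T.comp p) (i w) := by
      rw [Representation.IntertwiningMap.comp_apply, hpi]
    change T w = (∑ k : Fin (m / 2), c k.succ • (e k.succ).comp i : υ.IntertwiningMap ρ) w
    rw [h1, hc]
    simp only [Representation.IntertwiningMap.sum_apply, Representation.IntertwiningMap.smul_apply]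
    rw [Fin.sum_univ_succ, he0, smul_zero, zero_add]
    rfl
  · have h1 := he.mem k.succ (i x)
    rwa [Fin.val_succ, show 2 * (2 * ((k : ℕ) + 1) + 0) = 4 * ((k : ℕ) + 1) by ring] at h1
  · have h1 := he.eq_of_mem r (Fin.cons 0 c) (fun x => by
      obtain ⟨w, u, a, rfl⟩ := hsum x
      rw [Fin.sum_univ_succ]
      simp only [Fin.cons_zero, Fin.cons_succ, zero_smul, zero_add]
      rw [hsplit]
      exact hc w) k.succ (by rwa [Fin.cons_succ])
    rw [Fin.val_succ] at h1
    omega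

/-- The ranks of the spaces of homogeneous homomorphisms. -/
lemma IsHomogeneousBasis.rank {K : ℕ} {d : Fin K → ℕ} {e : Fin K → τ.IntertwiningMap ρ}
    (he : IsHomogeneousBasis G d e) (hd : Function.Injective d)
    {F : ℕ → Submodule ℂ (τ.IntertwiningMap ρ)} (hF : ∀ r T, T ∈ F r ↔ ∀ x, T x ∈ G r)
    {S : Finset ℕ} (hS : ∀ r, r ∈ S ↔ ∃ k, d k = r) :
    Module.rank ℂ (τ.IntertwiningMap ρ) = (K : ℕ) ∧ (⨆ r, F r) = ⊤ ∧
      ∀ r, Module.rank ℂ (F r) = if r ∈ S then 1 else 0 := by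
  obtain ⟨h1, h2, h3⟩ := rank_of_graded_basis he.linearIndependent he.exists_sum hd
    (fun k => (hF _ _).mpr (he.mem k)) fun r c hc => he.eq_of_mem r c ((hF _ _).mp hc)
  refine ⟨by rw [h1, Fintype.card_fin], h2, fun r => ?_⟩
  split_ifs with hr
  · obtain ⟨k, hk⟩ := (hS r).mp hr
    exact (h3 r).1 k hk
  · exact (h3 r).2 fun k hk => hr ((hS r).mpr ⟨k, hk⟩)

end GradedBases

/-! ### The invariant polydifferential operators as a graded model -/

section Model

variable {ι : Type*} [Fintype ι] {P : Matrix ι ι ℂ}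

lemma mulInv_val (P : Matrix ι ι ℂ) (n : ℕ) :
    (mulInv P n).1 = MultilinearMap.mkPiAlgebra ℂ (Fin n) (Fn ι) := rfl

lemma mulInv_ne_zero (P : Matrix ι ι ℂ) (n : ℕ) : mulInv P n ≠ 0 := by
  intro h
  have h1 := congrArg (fun B : Inv P n => B.1 fun _ => 1) h
  simp [mulInv_val] at h1

lemma mulInv_mem_orderPart (P : Matrix ι ι ℂ) (n : ℕ) : (mulInv P n).1 ∈ orderPart ι n 0 := by
  refine Submodule.subset_span ⟨fun _ => [], by simp, ?_⟩
  rw [mulInv_val]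
  ext1 f
  simp [prodOp_apply, partials]

/-- The commutators of the two sides of a relation with the Euler field show that a homogeneous
combination of homogeneous operators involves only terms of its own order. -/
lemma sum_sub_smul_eq_zero {n r : ℕ} {κ : Type*} [Fintype κ] {B : κ → Inv P n} {d : κ → ℕ}
    (hB : ∀ k, (B k).1 ∈ orderPart ι n (d k)) {c : κ → ℂ}
    (hc : (∑ k, c k • B k).1 ∈ orderPart ι n r) :
    ∑ k, (c k * ((d k : ℂ) - r)) • B k = 0 := by
  have h1 := eulerCommutator_of_mem_orderPart hc
  refine Subtype.ext ?_
  simp only [Submodule.coe_sum, Submodule.coe_smul, map_sum, map_smul, Submodule.coe_zero,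
    eulerCommutator_of_mem_orderPart (hB _), Finset.smul_sum] at h1 ⊢
  rw [← sub_eq_zero, ← Finset.sum_sub_distrib] at h1
  rw [← h1]
  refine Finset.sum_congr rfl fun k _ => ?_
  rw [mul_sub, sub_smul, mul_smul, mul_smul, smul_comm (c k) (r : ℂ)]

variable [DecidableEq ι] [Nonempty ι] (hP : P.transpose = -P) (hP' : IsUnit P.det)

lemma hasOnePoint_invRepOfMatrix (n : ℕ) :
    HasOnePoint (invRepOfMatrix P hP hP' n) (mulInv P n) :=
  ⟨mulInv_fixed hP hP', fun _ => exists_eq_smul_mulInv hP hP'⟩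

lemma isGradedModel_invRepOfMatrix (m : ℕ) :
    IsGradedModel (invRepOfMatrix P hP hP' (m + 1))
      (fun r => (orderPart ι (m + 1) r).comap (Inv P (m + 1)).subtype) (mulInv P (m + 1))
      (symBracket hP hP' m) where
  onePoint := hasOnePoint_invRepOfMatrix hP hP' (m + 1)
  ne_zero := mulInv_ne_zero P (m + 1)
  zero_mem := mulInv_mem_orderPart P (m + 1)
  stable _ σ _ hB := invRepOfMatrix_mem_orderPart hP hP' σ hB
  separated _ _ _ _ hB _ hc := sum_sub_smul_eq_zero hB hc
  linearIndependent := linearIndependent_symBracket hP hP' m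
  fixed b _ hσ := symBracket_fixed hP hP' m b hσ
  swap _ hb := symBracket_swap hP hP' hb
  mem _ hb := symBracket_mem_orderPart hP hP' hb
  exists_sum _ hB := exists_eq_sum_symBracket hP hP' hB

end Model

/-- For `n = 0` the exterior square of the reflection representation vanishes. -/
lemma subsingleton_hom_extSq_reflRep_zero {M : Type*} [AddCommGroup M] [Module ℂ M]
    (ρ : Representation ℂ (Equiv.Perm (Fin (0 + 1))) M) :
    Subsingleton ((extSq (reflRep 0)).IntertwiningMap ρ) := by
  have h0 : ∀ v : sumZero 0, v = 0 := fun v => by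
    have h : ∑ i, v.1 i = 0 := v.2
    rw [Fin.sum_univ_one] at h
    refine Subtype.ext (funext fun i => ?_)
    rwa [show i = 0 from Fin.eq_zero i]
  refine ⟨fun S T => Representation.IntertwiningMap.ext (LinearMap.ext fun x => ?_)⟩
  have hx : x ∈ Submodule.span ℂ {x | ∃ v w, x = wedge (sumZero 0) v w} := by
    rw [(isReflSquare_extSq 0 M).span]; trivial
  have h1 : Submodule.span ℂ {x | ∃ v w, x = wedge (sumZero 0) v w} ≤ ⊥ := by
    rw [Submodule.span_le]
    rintro _ ⟨v, w, rfl⟩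
    rw [h0 v, map_zero]
    rfl
  rw [(Submodule.mem_bot ℂ).mp (h1 hx), map_zero, map_zero]

end InvPoly

end

theorem mainTheorem5 {V : Type*} [AddCommGroup V] [Module ℂ V] [Nontrivial V]
    {ι : Type*} [Fintype ι] [DecidableEq ι] (b : Module.Basis ι ℂ V)
    (ω : LinearMap.BilinForm ℂ V) (hω : ω.IsAlt) (hω' : ω.Nondegenerate) (n : ℕ) :
    -- (i) the trivial isotypic part
    (Module.rank ℂ (InvPoly.invariantPart b hω hω' n) = 1 ∧
      (∀ φ : InvPoly.Inv (InvPoly.poissonMatrix b ω) n,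
        φ ∈ InvPoly.invariantPart b hω hω' n ↔
          ∃ c : ℂ, φ.1 = c • MultilinearMap.mkPiAlgebra ℂ (Fin n) (InvPoly.Fn ι)) ∧
      ∀ φ : InvPoly.Inv (InvPoly.poissonMatrix b ω) n,
        φ ∈ InvPoly.invariantPart b hω hω' n → φ.1 ∈ InvPoly.orderPart ι n 0) ∧
    -- (ii) the reflection representation
    (∀ T : (InvPoly.reflRep n).IntertwiningMap (InvPoly.invRep b hω hω' n), T = 0) ∧
    -- (iii) its exterior square
    (Module.rank ℂ ((InvPoly.extSq (InvPoly.reflRep n)).IntertwiningMap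
        (InvPoly.invRep b hω hω' n)) = (n / 2 : ℕ) ∧
      (⨆ r, InvPoly.homOfOrder b hω hω' n (InvPoly.extSq (InvPoly.reflRep n)) r) = ⊤ ∧
      ∀ r, Module.rank ℂ (InvPoly.homOfOrder b hω hω' n (InvPoly.extSq (InvPoly.reflRep n)) r) =
        if r ∈ (Finset.Icc 1 (n / 2)).image (fun j => 2 * (2 * j - 1)) then 1 else 0) ∧
    -- (iv) its symmetric square minus the reflection and the trivial representation
    (2 ≤ n →
      (∃ (W : Type) (_ : AddCommGroup W) (_ : Module ℂ W)
        (τ : Representation ℂ (Equiv.Perm (Fin (n + 1))) W),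
        Nonempty ((τ.prod ((InvPoly.reflRep n).prod (Representation.trivial ℂ _ ℂ))).Equiv
          (InvPoly.symSq (InvPoly.reflRep n)))) ∧
      ∀ (W : Type*) [AddCommGroup W] [Module ℂ W]
        (τ : Representation ℂ (Equiv.Perm (Fin (n + 1))) W),
        Nonempty ((τ.prod ((InvPoly.reflRep n).prod (Representation.trivial ℂ _ ℂ))).Equiv
          (InvPoly.symSq (InvPoly.reflRep n))) →
        Module.rank ℂ (τ.IntertwiningMap (InvPoly.invRep b hω hω' n)) = ((n - 1) / 2 : ℕ) ∧
        (⨆ r, InvPoly.homOfOrder b hω hω' n τ r) = ⊤ ∧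
        ∀ r, Module.rank ℂ (InvPoly.homOfOrder b hω hω' n τ r) =
          if r ∈ (Finset.Icc 1 ((n - 1) / 2)).image (fun j => 4 * j) then 1 else 0) := by
  have hne : Nonempty ι := b.index_nonempty
  have hP := InvPoly.poissonMatrix_transpose b hω hω'
  have hP' := InvPoly.poissonMatrix_det b hω'
  have hZ := InvPoly.hasOnePoint_invRepOfMatrix hP hP' n
  have hinv : ∀ φ : InvPoly.Inv (InvPoly.poissonMatrix b ω) n,
      φ ∈ InvPoly.invariantPart b hω hω' n ↔
        ∃ c : ℂ, φ = c • InvPoly.mulInv (InvPoly.poissonMatrix b ω) n := by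
    refine fun φ => ⟨fun h => hZ.exists_smul φ fun σ _ => h σ, ?_⟩
    rintro ⟨c, rfl⟩
    exact Submodule.smul_mem _ c hZ.fixed
  refine ⟨⟨?_, fun φ => ?_, fun φ hφ => ?_⟩, hZ.hom_reflRep_eq_zero, ?_, fun hn => ?_⟩
  · exact hZ.rank_invariants (InvPoly.mulInv_ne_zero _ n)
  · rw [hinv]
    exact exists_congr fun c => Subtype.ext_iff
  · obtain ⟨c, rfl⟩ := (hinv φ).mp hφ
    exact Submodule.smul_mem _ c (InvPoly.mulInv_mem_orderPart _ n)
  · rcases n with _ | m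
    · have hsub : Subsingleton ((InvPoly.extSq (InvPoly.reflRep 0)).IntertwiningMap
          (InvPoly.invRep b hω hω' 0)) :=
        InvPoly.subsingleton_hom_extSq_reflRep_zero
          (M := InvPoly.Inv (InvPoly.poissonMatrix b ω) 0) (InvPoly.invRep b hω hω' 0)
      refine ⟨?_, Subsingleton.elim _ _, fun r => ?_⟩
      · exact (rank_subsingleton' ℂ _).trans Nat.cast_zero.symm
      · exact rank_subsingleton' ℂ _
    · obtain ⟨e, he⟩ := (InvPoly.isGradedModel_invRepOfMatrix hP hP' m).exists_basis
        (s := 1) (K := (m + 1) / 2) one_lt_two rfl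
        (by rw [pow_one]; exact InvPoly.isReflSquare_extSq (m + 1) _)
      refine he.rank (fun k l h => Fin.ext (by simpa using h)) (fun _ _ => Iff.rfl) fun r => ?_
      simp only [Finset.mem_image, Finset.mem_Icc]
      constructor
      · rintro ⟨j, hj, rfl⟩
        exact ⟨⟨j - 1, by omega⟩, by simp only; omega⟩
      · rintro ⟨k, rfl⟩
        exact ⟨k + 1, by omega, by omega⟩
  · obtain ⟨m, rfl⟩ : ∃ m, n = m + 1 := ⟨n - 1, by omega⟩
    refine ⟨(InvPoly.isReflSquare_symSq (m + 1) _).exists_complement hn, ?_⟩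
    rintro W _ _ τ ⟨ψ⟩
    obtain ⟨e, he⟩ := (InvPoly.isGradedModel_invRepOfMatrix hP hP' m).exists_basis_complement
      (InvPoly.isReflSquare_symSq (m + 1) _) ψ
    refine he.rank (fun k l h => Fin.ext (by simpa using h)) (fun _ _ => Iff.rfl) fun r => ?_
    simp only [Finset.mem_image, Finset.mem_Icc]
    constructor
    · rintro ⟨j, hj, rfl⟩
      exact ⟨⟨j - 1, by omega⟩, by simp only; omega⟩
    · rintro ⟨k, rfl⟩
      exact ⟨k + 1, by omega, rfl⟩
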